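/- Digraphs are finite. A rooted digraph $(G;x_1,\dots,x_t)$ is a digraph $G$ with $t$ distinct distinguished vertices. A digraph is semi-complete if it has no loops and no parallel arcs and any two distinct vertices are joined by at least one arc. An immersion of a digraph $H$ (loops and parallel edges allowed) into a simple digraph $T$ maps the vertices of $H$ injectively to vertices of $T$, each edge $(u,v)$ with $u\neq v$ to a directed path of $T$ from the image of $u$ to the image of $v$, and each loop at $u$ to a directed cycle of $T$ through the image of $u$, such that the paths and cycles assigned to distinct edges are arc-disjoint. It preserves roots if it maps the $i$-th root of $H$ to the $i$-th root of $T$ for every $i$. A path decomposition of $T$ is a sequence $(W_1,\dots,W_r)$ of subsets of $V(T)$ (bags) with $\bigcup_i W_i=V(T)$, with $W_i\cap W_m\subseteq W_j$ for $i<j<m$, and such that for every arc $(u,v)$ either some bag contains both $u$ and $v$, or $u\in W_i$ and $v\in W_j$ for some $i>j$. Its width is $\max_i(|W_i|-1)$. **Theorem.** There exists an algorithm that, given a rooted digraph $(H;v_1,\dots,v_t)$ with $k$ vertices and $\ell$ edges, a nonempty semi-complete rooted digraph $(T;w_1,\dots,w_t)$ (by its adjacency matrix) and a path decomposition $(W_1,\dots,W_r)$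 of $T$ of width at most $p$, where $p\ge 2$, decides in time $$2^{O(k\log p+p\ell(\log \ell+\log p))}\cdot(|V(T)|+r)$$ whether $H$ can be immersed into $T$ while preserving roots (the term $\ell\log\ell$ is $0$ for $\ell=0$). In particular, if consecutive bags of the decomposition are distinct, the time is $$2^{O(k\log p+p\ell(\log \ell+\log p))}\cdot|V(T)|.$$ Here $2^{O(E)}$ means at most $C\,2^{CE}$ for an absolute constant $C$. Time is the number of steps of one fixed program of a random access machine with unit-cost addition, subtraction, multiplication, division, indirect memory access and tests, all of whose words have $O(1+E+\log(|V(T)|+r))$ bits, where $E=k\log p+p\ell(\log\ell+\log p)$. -/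

import Mathlib

/-! ### Digraphs, rooted immersions, path decompositions -/

/-- A digraph with vertex set `V` and edge set `E`; loops and parallel edges are allowed. -/
structure MultiDigraph (V E : Type*) where
  /-- the vertex at which an edge starts -/
  src : E → V
  /-- the vertex at which an edge ends -/
  tgt : E → V

/-- A simple digraph (no loops; parallel edges cannot occur in a `Digraph`) is semi-complete if any
two distinct vertices are joined by an arc in at least one of the two directions. -/
def Digraph.IsSemicomplete {V : Type*} (G : Digraph V) : Prop :=
  (∀ v, ¬ G.Adj v v) ∧ ∀ u v, u ≠ v → G.Adj u v ∨ G.Adj v u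

/-- The list of arcs traversed by the vertex sequence `q`. -/
def walkArcs {V : Type*} (q : List V) : List (V × V) := q.zip q.tail

/-- `q` is the vertex sequence of a directed path of `G` leading from `a` to `b`. -/
structure Digraph.IsPathFromTo {V : Type*} (G : Digraph V) (a b : V) (q : List V) : Prop where
  head_eq : q.head? = some a
  last_eq : q.getLast? = some b
  chain : q.IsChain G.Adj
  nodup : q.Nodup

/-- `q` is the vertex sequence `a, x₁, …, xₘ, a` of a directed cycle of `G` passing through `a`,
written from `a` back to `a`. -/
structure Digraph.IsCycleThrough {V : Type*} (G : Digraph V) (a : V) (q : List V) : Prop where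
  head_eq : q.head? = some a
  last_eq : q.getLast? = some a
  two_le_length : 2 ≤ q.length
  chain : q.IsChain G.Adj
  nodup_tail : q.tail.Nodup

/-- An immersion of `H` into the simple digraph `G`: distinct vertices go to distinct vertices, a
non-loop edge goes to a directed path between the images of its ends, a loop goes to a directed
cycle through the image of its vertex, and the images of distinct edges are edge-disjoint. -/
structure Immersion {V E W : Type*} (H : MultiDigraph V E) (G : Digraph W) where
  /-- the images of the vertices -/
  onVert : V → W
  /-- the images of the edges, as vertex sequences -/
  onEdge : E → List W
  injective : Function.Injective onVert
  isPath : ∀ e, H.src e ≠ H.tgt e →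
    G.IsPathFromTo (onVert (H.src e)) (onVert (H.tgt e)) (onEdge e)
  isCycle : ∀ e, H.src e = H.tgt e → G.IsCycleThrough (onVert (H.src e)) (onEdge e)
  edgeDisjoint : ∀ e f, e ≠ f → (walkArcs (onEdge e)).Disjoint (walkArcs (onEdge f))

/-- `(H; u₁, …, u_t)` can be immersed into `(G; w₁, …, w_t)` while preserving roots. -/
def RootedImmersible {V E W : Type*} {t : ℕ} (H : MultiDigraph V E) (u : Fin t → V)
    (G : Digraph W) (w : Fin t → W) : Prop :=
  ∃ η : Immersion H G, ∀ i, η.onVert (u i) = w i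

/-- `(W₁, …, W_r)` is a path decomposition of the digraph `G`. -/
structure IsPathDecomposition {V : Type*} [DecidableEq V] (G : Digraph V) {r : ℕ}
    (W : Fin r → Finset V) : Prop where
  cover : ∀ v, ∃ i, v ∈ W i
  inter_subset : ∀ i j k, i < j → j < k → W i ∩ W k ⊆ W j
  arc : ∀ u v, G.Adj u v → (∃ i, u ∈ W i ∧ v ∈ W i) ∨ ∃ i j, j < i ∧ u ∈ W i ∧ v ∈ W j

/-- The width `max_i (|W_i| - 1)`. -/
def decompWidth {V : Type*} {r : ℕ} (W : Fin r → Finset V) : ℕ :=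
  Finset.univ.sup fun i => (W i).card - 1

/-! ### Random access machine programs with bounded words and a step count -/

/-- Arithmetic instructions (on natural numbers; `sub` is truncated, `div` is the quotient). -/
inductive ArithOp
  | add
  | sub
  | mul
  | div

/-- The function computed by an arithmetic instruction. -/
def ArithOp.eval : ArithOp → ℕ → ℕ → ℕ
  | .add, a, b => a + b
  | .sub, a, b => a - b
  | .mul, a, b => a * b
  | .div, a, b => a / b

/-- Programs of a random access machine. Registers are numbered; a program mentions only finitely
many of them. -/
inductive RamProg
  /-- do nothing -/
  | nop
  /-- `x := c` -/
  | const (x c : ℕ)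
  /-- `x := y ∘ z` -/
  | arith (o : ArithOp) (x y z : ℕ)
  /-- `x := mem[y]` -/
  | load (x y : ℕ)
  /-- `mem[x] := y` -/
  | store (x y : ℕ)
  /-- first `c`, then `d` -/
  | seq (c d : RamProg)
  /-- if `x ≠ 0` then `c` else `d` -/
  | cond (x : ℕ) (c d : RamProg)
  /-- while `x ≠ 0` do `c` -/
  | loop (x : ℕ) (c : RamProg)

/-- A configuration: the contents of the registers and of the memory. -/
structure RamState where
  /-- registers -/
  reg : ℕ → ℕ
  /-- memory -/
  mem : ℕ → ℕ

/-- The configuration after `x := a`. -/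
def RamState.setReg (s : RamState) (x a : ℕ) : RamState :=
  ⟨Function.update s.reg x a, s.mem⟩

/-- The configuration after `mem[a] := b`. -/
def RamState.setMem (s : RamState) (a b : ℕ) : RamState :=
  ⟨s.reg, Function.update s.mem a b⟩

/-- `RamExec B c s s' m`: the program `c`, started in configuration `s`, halts in configuration `s'`
after exactly `m` elementary steps, and only words smaller than `B` are ever written to a register
(hence only such words are written to the memory or used as addresses). Each instruction and each
test of a condition is one step. A program that would exceed the word bound has no execution. -/
inductive RamExec (B : ℕ) : RamProg → RamState → RamState → ℕ → Prop
  | nop (s) : RamExec B .nop s s 1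
  | const (s) (x c) : c < B → RamExec B (.const x c) s (s.setReg x c) 1
  | arith (s) (o) (x y z) : o.eval (s.reg y) (s.reg z) < B →
      RamExec B (.arith o x y z) s (s.setReg x (o.eval (s.reg y) (s.reg z))) 1
  | load (s) (x y) : s.mem (s.reg y) < B →
      RamExec B (.load x y) s (s.setReg x (s.mem (s.reg y))) 1
  | store (s) (x y) : RamExec B (.store x y) s (s.setMem (s.reg x) (s.reg y)) 1
  | seq {c d s s' s'' m m'} : RamExec B c s s' m → RamExec B d s' s'' m' →
      RamExec B (.seq c d) s s'' (m + m')
  | cond_true {x c d s s' m} : s.reg x ≠ 0 → RamExec B c s s' m →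
      RamExec B (.cond x c d) s s' (m + 1)
  | cond_false {x c d s s' m} : s.reg x = 0 → RamExec B d s s' m →
      RamExec B (.cond x c d) s s' (m + 1)
  | loop_true {x c s s' s'' m m'} : s.reg x ≠ 0 → RamExec B c s s' m →
      RamExec B (.loop x c) s' s'' m' → RamExec B (.loop x c) s s'' (m + m' + 1)
  | loop_false {x c s} : s.reg x = 0 → RamExec B (.loop x c) s s 1

/-- The initial configuration: the input stands in memory cells `0, 1, 2, …`, everything else
is `0`. -/
def RamState.init (input : List ℕ) : RamState :=
  ⟨fun _ => 0, fun a => input.getD a 0⟩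

/-! ### Inputs -/

/-- The data of an input: a digraph `H` with `k` vertices and `l` edges, a simple digraph `T` on `n`
vertices, `t` roots in each of them, and a sequence of `r` bags of vertices of `T`, each bag listed
in some order. -/
structure RootedInput where
  k : ℕ
  l : ℕ
  t : ℕ
  n : ℕ
  r : ℕ
  H : MultiDigraph (Fin k) (Fin l)
  T : Digraph (Fin n)
  rootH : Fin t → Fin k
  rootT : Fin t → Fin n
  bagList : Fin r → List (Fin n)

/-- The bags as sets. -/
def RootedInput.bag (I : RootedInput) (i : Fin I.r) : Finset (Fin I.n) := (I.bagList i).toFinset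

/-- The promise on inputs: the roots are distinct, `T` is a nonempty semi-complete digraph, and the
bags (each listed without repetition) form a path decomposition of `T`. -/
structure RootedInput.Valid (I : RootedInput) : Prop where
  n_pos : 0 < I.n
  rootH_injective : Function.Injective I.rootH
  rootT_injective : Function.Injective I.rootT
  semicomplete : I.T.IsSemicomplete
  bag_nodup : ∀ i, (I.bagList i).Nodup
  decomposition : IsPathDecomposition I.T I.bag

open Classical in
/-- The input as a list of numbers: the sizes `k, l, t, n, r`, the ends of the edges of `H`, the
roots, the adjacency matrix of `T` row by row, and for each bag its size followed by its elements. -/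
noncomputable def RootedInput.encode (I : RootedInput) : List ℕ :=
  [I.k, I.l, I.t, I.n, I.r]
    ++ (List.finRange I.l).flatMap (fun e => [(I.H.src e : ℕ), (I.H.tgt e : ℕ)])
    ++ (List.finRange I.t).map (fun i => (I.rootH i : ℕ))
    ++ (List.finRange I.t).map (fun i => (I.rootT i : ℕ))
    ++ (List.finRange I.n).flatMap
        (fun a => (List.finRange I.n).map fun b => if I.T.Adj a b then 1 else 0)
    ++ (List.finRange I.r).flatMap
        (fun i => (I.bagList i).length :: (I.bagList i).map fun v => (v : ℕ))

/-- The exponent `k log p + p ℓ (log ℓ + log p)` (logarithms to base `2`; the term with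
`log ℓ` vanishes for `ℓ = 0`). -/
noncomputable def dpExponent (k l p : ℕ) : ℝ :=
  k * Real.logb 2 p + p * l * (Real.logb 2 l + Real.logb 2 p)

/-! The algorithm is a dynamic programme along the path decomposition. Scan the bags from left to
right, let `A` be the set of vertices met so far, and call a vertex of `A` forgotten once it has
left the bags. Arcs between vertices without a common bag point from right to left. So a forgotten
vertex has no arc to a vertex outside `A`, and by semi-completeness it receives an arc from every
vertex outside `A`.

Cut the paths and cycles of an immersion into maximal pieces inside `A`. A piece that still has to
be continued ends in the current bag, because a forgotten vertex cannot be left towards the outside.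
A piece may begin at a forgotten vertex, but from outside all forgotten vertices look alike. It only
matters which pieces begin at the same one, since an arc into it may be used only once. Hence it is
enough to record which vertices of `H` are mapped and, for every edge and every possible end (one of
the `P` slots of the bag, or the terminal), a name for the beginning of the piece with that end:
absent, initial vertex, one of the slots, or an anonymous class. There are at most `l * (P + 1)`
pieces, so `l * (P + 1) + 1` classes always leave a fresh one. This gives `q = P + 3 + l * (P + 1)`
names and `2 ^ k * q ^ (l * (P + 1))` states, which is `2 ^ O(E)` because `P ≤ p + 1`.

There are three kinds of transition. A new vertex creates pieces consisting of that vertex alone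
(`IntroR`). Each arc between it and `A` is then offered to at most one edge, where it joins two
pieces (`ArcR`). A vertex leaving the bag has its slot name replaced by an unused class (`ForgetR`).
The invariant `Good` has two halves. `Snd` says that each state in the table is realised by walks
using disjoint arc sets; they are shortened to paths and cycles only at the end (`Snd.immersible`).
`CmpS` says that each immersion has its trace in the table. Arcs from the new vertex to forgotten
vertices without a name are never offered; `Good.finish` shows that none is missed, because a path
using one would leave a piece whose beginning has no name.

On the machine a state is a mixed radix number and a table of states is a block of memory. A
transition is carried out by brute force over all triples of a choice, an old state and a new state,
compared digit by digit (`wp_genOp`). The program is written in a small language whose compiler is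
verified by `exec_of_wp`. Only the unnested loops over the `r` bags have a length not bounded by `2
^ O(E)`, which gives `2 ^ O(E) * (r + 1)` steps; if consecutive bags differ then `r ≤ 2 * n + 1`
(`r_le`). The case `k = 0` is answered at once, because then the exponent does not control `p`. -/

/-! ### A small imperative language compiled to random access machine programs -/

/-- Arithmetic expressions over registers and memory. -/
inductive Ex
  | c (n : ℕ)
  | v (x : ℕ)
  | op (o : ArithOp) (a b : Ex)
  | ld (a : Ex)

namespace Ex

/-- The value of an expression. -/
def eval : Ex → RamState → ℕ
  | c n, _ => n
  | v x, s => s.reg x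
  | op o a b, s => o.eval (a.eval s) (b.eval s)
  | ld a, s => s.mem (a.eval s)

/-- Code that puts the value of the expression into register `t`, using only registers from `t`
on. -/
def comp : Ex → ℕ → RamProg
  | c n, t => .const t n
  | v x, t => .seq (.const (t + 1) 0) (.arith .add t x (t + 1))
  | op o a b, t => .seq (a.comp t) (.seq (b.comp (t + 1)) (.arith o t t (t + 1)))
  | ld a, t => .seq (a.comp t) (.load t t)

/-- The number of steps of `comp`. -/
def cost : Ex → ℕ
  | c _ => 1
  | v _ => 2
  | op _ a b => a.cost + (b.cost + 1)
  | ld a => a.cost + 1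

/-- If registers and memory hold numbers below `K`, all intermediate values are below
`K ^ deg`. -/
def deg : Ex → ℕ
  | c _ => 1
  | v _ => 1
  | op .add a b => a.deg + b.deg
  | op .mul a b => a.deg + b.deg
  | op .sub a b => max a.deg b.deg
  | op .div a b => max a.deg b.deg
  | ld a => a.deg

/-- Constants are below `100` and variables are registers below `1000`. -/
def Wf : Ex → Prop
  | c n => n < 100
  | v x => x < 1000
  | op _ a b => a.Wf ∧ b.Wf
  | ld a => a.Wf

instance decidableWf : (e : Ex) → Decidable e.Wf
  | c n => inferInstanceAs (Decidable (n < 100))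
  | v x => inferInstanceAs (Decidable (x < 1000))
  | op _ a b => by
      have := a.decidableWf
      have := b.decidableWf
      exact inferInstanceAs (Decidable (a.Wf ∧ b.Wf))
  | ld a => a.decidableWf

instance : Add Ex := ⟨.op .add⟩
instance : Sub Ex := ⟨.op .sub⟩
instance : Mul Ex := ⟨.op .mul⟩
instance : Div Ex := ⟨.op .div⟩
instance (n : ℕ) : OfNat Ex n := ⟨.c n⟩

/-- Truth of an expression. -/
def Tr (e : Ex) (s : RamState) : Prop := e.eval s ≠ 0

/-- The negation of a truth value. -/
def not (a : Ex) : Ex := 1 - a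
/-- `a = b` as an expression. -/
def eq (a b : Ex) : Ex := 1 - ((a - b) + (b - a))
/-- `a < b` as an expression. -/
def lt (a b : Ex) : Ex := b - a
/-- If `c` then `a` else `b`, for truth values `a` and `b`. -/
def cnd (c a b : Ex) : Ex := c * a + c.not * b
/-- The remainder. -/
def mod (a b : Ex) : Ex := a - a / b * b

section
variable (a b e : Ex) (s : RamState) (n x : ℕ)

@[simp] theorem eval_v : (v x).eval s = s.reg x := rfl
@[simp] theorem eval_ofNat : (no_index (OfNat.ofNat n : Ex)).eval s = OfNat.ofNat n := rfl
@[simp] theorem eval_add : (a + b).eval s = a.eval s + b.eval s := rfl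
@[simp] theorem eval_sub : (a - b).eval s = a.eval s - b.eval s := rfl
@[simp] theorem eval_mul : (a * b).eval s = a.eval s * b.eval s := rfl
@[simp] theorem eval_div : (a / b).eval s = a.eval s / b.eval s := rfl
@[simp] theorem eval_ld : (ld a).eval s = s.mem (a.eval s) := rfl

@[simp] theorem eval_mod : (a.mod b).eval s = a.eval s % b.eval s := by
  simp only [mod, eval_sub, eval_mul, eval_div]
  have := Nat.div_add_mod' (a.eval s) (b.eval s)
  omega

@[simp] theorem tr_v : (v x).Tr s ↔ s.reg x ≠ 0 := Iff.rfl
@[simp] theorem tr_not : a.not.Tr s ↔ ¬ a.Tr s := by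
  simp only [Tr, not, eval_sub, eval_ofNat]; omega
@[simp] theorem tr_eq : (a.eq b).Tr s ↔ a.eval s = b.eval s := by
  simp only [Tr, eq, eval_sub, eval_ofNat, eval_add]; omega
@[simp] theorem tr_lt : (a.lt b).Tr s ↔ a.eval s < b.eval s := by
  simp only [Tr, lt, eval_sub]; omega
@[simp] theorem tr_mul : (a * b).Tr s ↔ a.Tr s ∧ b.Tr s := by
  simp [Tr]
@[simp] theorem tr_add : (a + b).Tr s ↔ a.Tr s ∨ b.Tr s := by
  simp only [Tr, eval_add]; omega
@[simp] theorem tr_cnd : (cnd e a b).Tr s ↔ e.Tr s ∧ a.Tr s ∨ ¬ e.Tr s ∧ b.Tr s := by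
  simp [cnd]

end

theorem deg_pos : (e : Ex) → 1 ≤ e.deg
  | c _ => le_rfl
  | v _ => le_rfl
  | op .add a _ => le_add_right a.deg_pos
  | op .mul a _ => le_add_right a.deg_pos
  | op .sub a _ => le_max_of_le_left a.deg_pos
  | op .div a _ => le_max_of_le_left a.deg_pos
  | ld a => a.deg_pos

end Ex

/-! ### Correctness of compiled expressions. -/

/-- All registers and all memory cells hold numbers below `K`. -/
structure RamState.Bdd (K : ℕ) (s : RamState) : Prop where
  reg : ∀ x, s.reg x < K
  mem : ∀ a, s.mem a < K

/-- The machine configuration `s` represents the configuration `σ` of the variables. -/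
structure RamState.Rep (s σ : RamState) : Prop where
  reg : ∀ x < 1000, s.reg x = σ.reg x
  mem : s.mem = σ.mem

theorem Ex.eval_lt {K : ℕ} (hK : 100 ≤ K) {σ : RamState} (hσ : σ.Bdd K) :
    (e : Ex) → e.Wf → e.eval σ < K ^ e.deg
  | .c n, h => by simpa [Ex.eval, Ex.deg] using lt_of_lt_of_le h hK
  | .v x, _ => by simpa [Ex.eval, Ex.deg] using hσ.reg x
  | .op o a b, h => by
      have ha := Ex.eval_lt hK hσ a h.1
      have hb := Ex.eval_lt hK hσ b h.2
      have h1 : K ≤ K ^ a.deg := Nat.le_self_pow (Nat.one_le_iff_ne_zero.1 a.deg_pos) K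
      have h2 : K ≤ K ^ b.deg := Nat.le_self_pow (Nat.one_le_iff_ne_zero.1 b.deg_pos) K
      have h3 : K ^ a.deg ≤ K ^ max a.deg b.deg :=
        Nat.pow_le_pow_right (by omega) (le_max_left _ _)
      cases o <;> simp only [Ex.eval, Ex.deg, ArithOp.eval, pow_add]
      · nlinarith
      · omega
      · exact Nat.mul_lt_mul'' ha hb
      · exact lt_of_le_of_lt (Nat.div_le_self _ _) (lt_of_lt_of_le ha h3)
  | .ld a, h => by
      have h1 : K ≤ K ^ a.deg := Nat.le_self_pow (Nat.one_le_iff_ne_zero.1 a.deg_pos) K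
      exact lt_of_lt_of_le (hσ.mem _) h1

/-- The second operand is compiled one register higher, so the value of the first survives in
register `t`. Scratch registers start at `1000` while variables lie below it, hence the represented
configuration is unaffected and can be used for every subexpression. -/
theorem Ex.comp_exec {K B : ℕ} (hK : 100 ≤ K) {σ : RamState} (hσ : σ.Bdd K) :
    (e : Ex) → e.Wf → K ^ e.deg ≤ B → ∀ (t : ℕ) (s : RamState), 1000 ≤ t → s.Rep σ →
      ∃ s', RamExec B (e.comp t) s s' e.cost ∧ s'.mem = s.mem ∧ s'.reg t = e.eval σ ∧
        ∀ x < t, s'.reg x = s.reg x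
  | .c n, h, hB, t, s, _, _ =>
      ⟨_, .const s t n (lt_of_lt_of_le (Ex.eval_lt hK hσ (.c n) h) hB), rfl,
        Function.update_self .., fun x hx => Function.update_of_ne hx.ne ..⟩
  | .v x, h, hB, t, s, ht, hs => by
      have hx : x < 1000 := h
      have h1 := lt_of_lt_of_le (Ex.eval_lt hK hσ (.v x) h) hB
      have h2 : (s.setReg (t + 1) 0).reg x = σ.reg x := by
        rw [← hs.reg x hx]; exact Function.update_of_ne (by omega) ..
      have h3 : (s.setReg (t + 1) 0).reg (t + 1) = 0 := Function.update_self ..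
      have h4 : ArithOp.add.eval ((s.setReg (t + 1) 0).reg x) ((s.setReg (t + 1) 0).reg (t + 1))
          = σ.reg x := by rw [h2, h3]; rfl
      refine ⟨_, .seq (.const s (t + 1) 0 (by omega)) (.arith _ .add t x (t + 1) ?_), rfl, ?_, ?_⟩
      · rw [h4]; exact h1
      · rw [h4]; exact Function.update_self ..
      · intro y hy
        rw [h4]
        exact (Function.update_of_ne hy.ne ..).trans (Function.update_of_ne (by omega) ..)
  | .op o a b, h, hB, t, s, ht, hs => by
      have h0 := lt_of_lt_of_le (Ex.eval_lt hK hσ (.op o a b) h) hB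
      have ha : a.deg ≤ (Ex.op o a b).deg := by cases o <;> simp [Ex.deg]
      have hb : b.deg ≤ (Ex.op o a b).deg := by cases o <;> simp [Ex.deg]
      obtain ⟨s1, e1, m1, r1, f1⟩ := Ex.comp_exec hK hσ a h.1
        ((Nat.pow_le_pow_right (by omega) ha).trans hB) t s ht hs
      obtain ⟨s2, e2, m2, r2, f2⟩ := Ex.comp_exec hK hσ b h.2
        ((Nat.pow_le_pow_right (by omega) hb).trans hB) (t + 1) s1 (by omega)
        ⟨fun x hx => (f1 x (by omega)).trans (hs.reg x hx), m1.trans hs.mem⟩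
      have h4 : o.eval (s2.reg t) (s2.reg (t + 1)) = (Ex.op o a b).eval σ := by
        rw [f2 t (by omega), r1, r2]; rfl
      refine ⟨_, .seq e1 (.seq e2 (.arith _ o t t (t + 1) (by rw [h4]; exact h0))),
        m2.trans m1, ?_, ?_⟩
      · rw [h4]; exact Function.update_self ..
      · intro y hy
        exact (Function.update_of_ne hy.ne ..).trans ((f2 y (by omega)).trans (f1 y hy))
  | .ld a, h, hB, t, s, ht, hs => by
      obtain ⟨s1, e1, m1, r1, f1⟩ := Ex.comp_exec hK hσ a h hB t s ht hs
      have h1 : K ≤ K ^ a.deg := Nat.le_self_pow (Nat.one_le_iff_ne_zero.1 a.deg_pos) K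
      have h4 : s1.mem (s1.reg t) = (Ex.ld a).eval σ := by rw [m1, r1, hs.mem]; rfl
      refine ⟨_, .seq e1 (.load _ t t ?_), m1, ?_, ?_⟩
      · rw [h4]; exact lt_of_lt_of_le (hσ.mem _) (h1.trans hB)
      · rw [h4]; exact Function.update_self ..
      · intro y hy
        exact (Function.update_of_ne hy.ne ..).trans (f1 y hy)

/-- Commands. `forr b x e c` runs `c` for `x = 0, …, e - 1`, with register `x + 1` counting down;
the flag `b` selects which of two bounds on the number of iterations is meant. -/
inductive Cmd
  | skip
  | set (x : ℕ) (e : Ex)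
  | sto (a e : Ex)
  | seq (c d : Cmd)
  | ite (e : Ex) (c d : Cmd)
  | forr (b : Bool) (x : ℕ) (e : Ex) (c : Cmd)

/-- Sequential composition. -/
infixr:67 " ;; " => Cmd.seq

namespace Cmd

/-- The body of the loop `forr`, with the updates of the counters. -/
def loopBody (x : ℕ) (p : RamProg) : RamProg :=
  .seq p (.seq (.const 1000 1) (.seq (.arith .add x x 1000) (.arith .sub (x + 1) (x + 1) 1000)))

/-- Compilation. -/
def comp : Cmd → RamProg
  | skip => .nop
  | set x e => .seq (e.comp 1000) (.seq (.const 1001 0) (.arith .add x 1000 1001))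
  | sto a e => .seq (a.comp 1000) (.seq (e.comp 1001) (.store 1000 1001))
  | seq c d => .seq c.comp d.comp
  | ite e c d => .seq (e.comp 1000) (.cond 1000 c.comp d.comp)
  | forr _ x e c => .seq (e.comp 1000) (.seq (.const 1001 0)
      (.seq (.arith .add (x + 1) 1000 1001) (.seq (.const x 0) (.loop (x + 1) (loopBody x c.comp)))))

/-- A bound for the number of steps, if loops with flag `false` have at most `Z` and loops with
flag `true` at most `R` iterations. -/
def cst (Z R : ℕ) : Cmd → ℕ
  | skip => 1
  | set _ e => e.cost + 2
  | sto a e => a.cost + e.cost + 1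
  | seq c d => c.cst Z R + d.cst Z R
  | ite e c d => e.cost + 1 + c.cst Z R + d.cst Z R
  | forr b _ e c => e.cost + 4 + (if b then R else Z) * (c.cst Z R + 4)

/-- The maximal degree of an expression. -/
def deg : Cmd → ℕ
  | skip => 1
  | set _ e => e.deg
  | sto a e => max a.deg e.deg
  | seq c d => max c.deg d.deg
  | ite e c d => max e.deg (max c.deg d.deg)
  | forr _ _ e c => max e.deg c.deg

/-- Constants are below `100` and variables are registers below `1000`. -/
def Wf : Cmd → Prop
  | skip => True
  | set x e => x < 1000 ∧ e.Wf
  | sto a e => a.Wf ∧ e.Wf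
  | seq c d => c.Wf ∧ d.Wf
  | ite e c d => e.Wf ∧ c.Wf ∧ d.Wf
  | forr _ x e c => x + 1 < 1000 ∧ e.Wf ∧ c.Wf

/-- Sufficient preconditions for a command to run with all registers and memory cells below `K`,
with the bounds `Z` and `R` on the numbers of iterations of loops, and to establish `Q`. -/
def wp (K Z R : ℕ) : Cmd → (RamState → Prop) → RamState → Prop
  | skip, Q, s => Q s
  | set x e, Q, s => e.eval s < K ∧ Q (s.setReg x (e.eval s))
  | sto a e, Q, s => e.eval s < K ∧ Q (s.setMem (a.eval s) (e.eval s))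
  | seq c d, Q, s => wp K Z R c (wp K Z R d Q) s
  | ite e c d, Q, s => (e.Tr s → wp K Z R c Q s) ∧ (¬ e.Tr s → wp K Z R d Q s)
  | forr b x e c, Q, s => e.eval s < K ∧ e.eval s ≤ (if b then R else Z) ∧
      ∃ Inv : ℕ → RamState → Prop,
        Inv 0 ((s.setReg (x + 1) (e.eval s)).setReg x 0) ∧
        (∀ i < e.eval s, ∀ τ, Inv i τ → τ.reg x = i → τ.reg (x + 1) = e.eval s - i →
          wp K Z R c (fun τ' => τ'.reg x = i ∧ τ'.reg (x + 1) = e.eval s - i ∧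
            Inv (i + 1) ((τ'.setReg x (i + 1)).setReg (x + 1) (e.eval s - i - 1))) τ) ∧
        ∀ τ, Inv (e.eval s) τ → Q τ

end Cmd

theorem RamState.Bdd.setReg {K : ℕ} {σ : RamState} (h : σ.Bdd K) {x a : ℕ} (ha : a < K) :
    (σ.setReg x a).Bdd K := by
  refine ⟨fun y => ?_, h.mem⟩
  rcases eq_or_ne y x with rfl | hy
  · exact lt_of_eq_of_lt (Function.update_self ..) ha
  · exact lt_of_eq_of_lt (Function.update_of_ne hy ..) (h.reg y)

theorem RamState.Bdd.setMem {K : ℕ} {σ : RamState} (h : σ.Bdd K) {x a : ℕ} (ha : a < K) :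
    (σ.setMem x a).Bdd K := by
  refine ⟨h.reg, fun y => ?_⟩
  rcases eq_or_ne y x with rfl | hy
  · exact lt_of_eq_of_lt (Function.update_self ..) ha
  · exact lt_of_eq_of_lt (Function.update_of_ne hy ..) (h.mem y)

@[simp] theorem RamState.setReg_reg (s : RamState) (x a y : ℕ) :
    (s.setReg x a).reg y = if y = x then a else s.reg y := Function.update_apply ..
@[simp] theorem RamState.setReg_mem (s : RamState) (x a : ℕ) : (s.setReg x a).mem = s.mem := rfl
@[simp] theorem RamState.setMem_reg (s : RamState) (x a : ℕ) : (s.setMem x a).reg = s.reg := rfl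
@[simp] theorem RamState.setMem_mem (s : RamState) (x a y : ℕ) :
    (s.setMem x a).mem y = if y = x then a else s.mem y := Function.update_apply ..

/-! ### From preconditions to executions of the compiled program. -/

namespace Cmd

/-- Induction on the number `j` of remaining iterations. The body must restore the invariant for
every configuration that agrees with its result below register `1000` up to the new counter values,
because updating the counters destroys the scratch register `1000`. -/
theorem loop_exec {B : ℕ} {x : ℕ} (hx : x + 1 < 1000) {p : RamProg} (hB : 2 ≤ B)
    (Inv : ℕ → RamState → Prop) (N m : ℕ) (hN : N < B)
    (h : ∀ i < N, ∀ s : RamState, s.reg x = i → s.reg (x + 1) = N - i → Inv i s →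
      ∃ s' n, RamExec B p s s' n ∧ n ≤ m ∧ s'.reg x = i ∧ s'.reg (x + 1) = N - i ∧
        ∀ s'' : RamState, (∀ y < 1000, s''.reg y =
          if y = x + 1 then N - i - 1 else if y = x then i + 1 else s'.reg y) →
          s''.mem = s'.mem → Inv (i + 1) s'') :
    ∀ j i, i + j = N → ∀ s : RamState, s.reg x = i → s.reg (x + 1) = N - i → Inv i s →
      ∃ s' n, RamExec B (.loop (x + 1) (loopBody x p)) s s' n ∧ n ≤ j * (m + 4) + 1 ∧ Inv N s' := by
  intro j
  induction j with
  | zero =>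
    rintro i rfl s - h1 h2
    exact ⟨s, 1, .loop_false (by rw [h1]; simp), by simp, h2⟩
  | succ j ih =>
    intro i hi s h0 h1 h2
    obtain ⟨s', n, e, hn, r0, r1, hI⟩ := h i (by omega) s h0 h1 h2
    have e1 : RamExec B (.const 1000 1) s' (s'.setReg 1000 1) 1 := .const _ _ _ (by omega)
    have v1 : ArithOp.add.eval ((s'.setReg 1000 1).reg x) ((s'.setReg 1000 1).reg 1000) = i + 1 := by
      simp [ArithOp.eval, show x ≠ 1000 by omega, r0]
    have e2 := RamExec.arith (B := B) (s'.setReg 1000 1) .add x x 1000 (by rw [v1]; omega)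
    rw [v1] at e2
    set s2 := (s'.setReg 1000 1).setReg x (i + 1) with hs2
    have v2 : ArithOp.sub.eval (s2.reg (x + 1)) (s2.reg 1000) = N - i - 1 := by
      simp [hs2, ArithOp.eval, show x + 1 ≠ 1000 by omega, show 1000 ≠ x by omega, r1]
    have e3 := RamExec.arith (B := B) s2 .sub (x + 1) (x + 1) 1000 (by rw [v2]; omega)
    rw [v2] at e3
    obtain ⟨s4, n4, e4, hn4, hQ⟩ := ih (i + 1) (by omega) (s2.setReg (x + 1) (N - i - 1))
      (by simp [hs2]) (by simp; omega) (hI _ (by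
        intro y hy
        simp [hs2, show y ≠ 1000 by omega]) rfl)
    refine ⟨s4, _, .loop_true (by rw [h1]; omega) (.seq e (.seq e1 (.seq e2 e3))) e4, ?_, hQ⟩
    ring_nf at hn4 ⊢
    omega

/-- Two bounds are kept apart: the values stored in variables and memory stay below `K`, and only
intermediate values of expressions may grow to `K ^ deg`. Thus a word bound that is a fixed power of
`K` serves the whole program. -/
theorem exec_of_wp {K Z R B : ℕ} (hK : 100 ≤ K) :
    ∀ (c : Cmd), c.Wf → K ^ c.deg ≤ B → ∀ (Q : RamState → Prop) (s σ : RamState), s.Rep σ →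
      σ.Bdd K → c.wp K Z R Q σ →
      ∃ s' σ' n, RamExec B c.comp s s' n ∧ n ≤ c.cst Z R ∧ s'.Rep σ' ∧ σ'.Bdd K ∧ Q σ' := by
  intro c
  induction c with
  | skip => exact fun _ _ Q s σ h h' hQ => ⟨s, σ, 1, .nop s, le_rfl, h, h', hQ⟩
  | set x e =>
    intro hw hB Q s σ hs hσ ⟨hv, hQ⟩
    obtain ⟨s1, e1, m1, r1, f1⟩ := Ex.comp_exec hK hσ e hw.2 hB 1000 s le_rfl hs
    have hB1 : K ≤ B := (Nat.le_self_pow (Nat.one_le_iff_ne_zero.1 e.deg_pos) K).trans hB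
    have v1 : ArithOp.add.eval ((s1.setReg 1001 0).reg 1000) ((s1.setReg 1001 0).reg 1001)
        = e.eval σ := by simp [ArithOp.eval, r1]
    have e3 := RamExec.arith (B := B) (s1.setReg 1001 0) .add x 1000 1001 (by rw [v1]; omega)
    rw [v1] at e3
    refine ⟨_, _, _, .seq e1 (.seq (.const _ _ _ (by omega)) e3), le_rfl, ⟨?_, ?_⟩,
      hσ.setReg hv, hQ⟩
    · intro y hy
      simp only [RamState.setReg_reg]
      split_ifs with h1 h2
      · rfl
      · omega
      · rw [f1 y hy, hs.reg y hy]
    · exact m1.trans hs.mem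
  | sto a e =>
    intro hw hB Q s σ hs hσ ⟨hv, hQ⟩
    have hd := max_le_iff.1 (show max a.deg e.deg ≤ _ from le_rfl)
    obtain ⟨s1, e1, m1, r1, f1⟩ := Ex.comp_exec hK hσ a hw.1
      ((Nat.pow_le_pow_right (by omega) hd.1).trans hB) 1000 s le_rfl hs
    obtain ⟨s2, e2, m2, r2, f2⟩ := Ex.comp_exec hK hσ e hw.2
      ((Nat.pow_le_pow_right (by omega) hd.2).trans hB) 1001 s1 (by omega)
      ⟨fun x hx => (f1 x hx).trans (hs.reg x hx), m1.trans hs.mem⟩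
    refine ⟨_, _, _, .seq e1 (.seq e2 (.store _ _ _)), ?_, ⟨?_, ?_⟩, hσ.setMem hv, hQ⟩
    · simp [cst]; omega
    · intro y hy
      simp only [RamState.setMem_reg]
      rw [f2 y (by omega), f1 y hy, hs.reg y hy]
    · funext y
      simp only [RamState.setMem_mem]
      rw [f2 1000 (by omega), r1, r2, m2, m1, hs.mem]
  | seq c d ihc ihd =>
    intro hw hB Q s σ hs hσ hQ
    have hd := max_le_iff.1 (show max c.deg d.deg ≤ _ from le_rfl)
    obtain ⟨s1, σ1, n1, e1, l1, R1, B1, Q1⟩ := ihc hw.1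
      ((Nat.pow_le_pow_right (by omega) hd.1).trans hB) _ s σ hs hσ hQ
    obtain ⟨s2, σ2, n2, e2, l2, R2, B2, Q2⟩ := ihd hw.2
      ((Nat.pow_le_pow_right (by omega) hd.2).trans hB) _ s1 σ1 R1 B1 Q1
    exact ⟨s2, σ2, _, .seq e1 e2, add_le_add l1 l2, R2, B2, Q2⟩
  | ite e c d ihc ihd =>
    intro hw hB Q s σ hs hσ ⟨hQ, hQ'⟩
    have hd := max_le_iff.1 (show max e.deg (max c.deg d.deg) ≤ _ from le_rfl)
    have hd' := max_le_iff.1 hd.2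
    obtain ⟨s1, e1, m1, r1, f1⟩ := Ex.comp_exec hK hσ e hw.1
      ((Nat.pow_le_pow_right (by omega) hd.1).trans hB) 1000 s le_rfl hs
    have hs1 : s1.Rep σ := ⟨fun x hx => (f1 x hx).trans (hs.reg x hx), m1.trans hs.mem⟩
    by_cases ht : e.Tr σ
    · obtain ⟨s2, σ2, n2, e2, l2, R2, B2, Q2⟩ := ihc hw.2.1
        ((Nat.pow_le_pow_right (by omega) hd'.1).trans hB) _ s1 σ hs1 hσ (hQ ht)
      exact ⟨s2, σ2, _, .seq e1 (.cond_true (by rw [r1]; exact ht) e2),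
        by simp only [cst]; omega, R2, B2, Q2⟩
    · obtain ⟨s2, σ2, n2, e2, l2, R2, B2, Q2⟩ := ihd hw.2.2
        ((Nat.pow_le_pow_right (by omega) hd'.2).trans hB) _ s1 σ hs1 hσ (hQ' ht)
      exact ⟨s2, σ2, _, .seq e1 (.cond_false (by rw [r1]; simpa [Ex.Tr] using ht) e2),
        by simp only [cst]; omega, R2, B2, Q2⟩
  | forr b x e c ihc =>
    intro hw hB Q s σ hs hσ ⟨hv, hv', Inv, hI0, hIs, hIQ⟩
    have hx := hw.1
    have hd := max_le_iff.1 (show max e.deg c.deg ≤ _ from le_rfl)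
    have hB1 : K ≤ B := ((Nat.le_self_pow (Nat.one_le_iff_ne_zero.1 e.deg_pos) K).trans
      (Nat.pow_le_pow_right (by omega) hd.1)).trans hB
    obtain ⟨s1, e1, m1, r1, f1⟩ := Ex.comp_exec hK hσ e hw.2.1
      ((Nat.pow_le_pow_right (by omega) hd.1).trans hB) 1000 s le_rfl hs
    have v1 : ArithOp.add.eval ((s1.setReg 1001 0).reg 1000) ((s1.setReg 1001 0).reg 1001)
        = e.eval σ := by simp [ArithOp.eval, r1]
    have e3 := RamExec.arith (B := B) (s1.setReg 1001 0) .add (x + 1) 1000 1001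
      (by rw [v1]; omega)
    rw [v1] at e3
    have e4 : RamExec B (.const x 0) (((s1.setReg 1001 0).setReg (x + 1) (e.eval σ)))
      ((((s1.setReg 1001 0).setReg (x + 1) (e.eval σ))).setReg x 0) 1 := .const _ _ _ (by omega)
    obtain ⟨s5, n5, e5, l5, σ5, R5, B5, I5⟩ := loop_exec (B := B) hx (p := c.comp) (by omega)
      (fun i s => ∃ σ, s.Rep σ ∧ σ.Bdd K ∧ Inv i σ) (e.eval σ) (c.cst Z R) (by omega) (by
        rintro i hi s r0 r1 ⟨τ, hR, hb, hI⟩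
        obtain ⟨s', σ', n, he, hn, hR', hb', h1, h2, h3⟩ := ihc hw.2.2
          ((Nat.pow_le_pow_right (by omega) hd.2).trans hB) _ s τ hR hb
          (hIs i hi τ hI (by rw [← hR.reg x (by omega), r0])
            (by rw [← hR.reg (x + 1) (by omega), r1]))
        refine ⟨s', n, he, hn, by rw [hR'.reg x (by omega), h1],
          by rw [hR'.reg (x + 1) (by omega), h2], fun s'' hs'' hm'' => ⟨_, ⟨?_, ?_⟩, ?_, h3⟩⟩
        · intro y hy
          simp [hs'' y hy, hR'.reg y hy]
        · simp [hm'', hR'.mem]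
        · exact (hb'.setReg (by omega)).setReg (by omega))
      (e.eval σ) 0 (by simp) (((s1.setReg 1001 0).setReg (x + 1) (e.eval σ)).setReg x 0)
      (by simp) (by simp)
      ⟨(σ.setReg (x + 1) (e.eval σ)).setReg x 0, ⟨fun y hy => by
          simp only [RamState.setReg_reg]
          split_ifs <;> first | rfl | omega | rw [f1 y hy, hs.reg y hy], m1.trans hs.mem⟩,
        (hσ.setReg hv).setReg (by omega), hI0⟩
    refine ⟨s5, σ5, _, .seq e1 (.seq (.const _ _ _ (by omega)) (.seq e3 (.seq e4 e5))), ?_,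
      R5, B5, hIQ _ I5⟩
    simp only [cst]
    have := Nat.mul_le_mul_right (c.cst Z R + 4) hv'
    omega

theorem wp_mono {K Z R : ℕ} {Q Q' : RamState → Prop} (h : ∀ s, Q s → Q' s) :
    ∀ (c : Cmd) (s : RamState), c.wp K Z R Q s → c.wp K Z R Q' s := by
  intro c
  induction c generalizing Q Q' with
  | skip => exact h
  | set x e => exact fun s hs => ⟨hs.1, h _ hs.2⟩
  | sto a e => exact fun s hs => ⟨hs.1, h _ hs.2⟩
  | seq c d ihc ihd => exact fun s hs => ihc (ihd h) s hs
  | ite e c d ihc ihd => exact fun s hs => ⟨fun t => ihc h s (hs.1 t), fun t => ihd h s (hs.2 t)⟩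
  | forr b x e c ihc =>
    rintro s ⟨h1, h2, Inv, h3, h4, h5⟩
    exact ⟨h1, h2, Inv, h3, h4, fun τ hτ => h _ (h5 τ hτ)⟩

end Cmd

/-! ### The dynamic programming states and their transitions -/

/-- A state of the dynamic programme: for every vertex of `H` whether it is mapped, and for every
edge `e` and every end `x` (a slot, or `P` for the terminal) the name of the beginning of the piece
of `e` that ends there (`0` if there is none, `1` for the initial vertex of the path). -/
structure DPState (k l : ℕ) where
  b : Fin k → ℕ
  g : Fin l → ℕ → ℕ

section DP

variable {V : Type*} {k l t : ℕ} (H : MultiDigraph (Fin k) (Fin l)) (T : Digraph V)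
  (rootH : Fin t → Fin k) (rootT : Fin t → V) (P q : ℕ)

/-- Mapping the vertex `u` of `H` (or none) to `v` is compatible with the roots. -/
def RootOk (u : Option (Fin k)) (v : V) : Prop := ∀ i, u = some (rootH i) ↔ rootT i = v

/-- The vertex `v` appears in slot `s`. -/
def IntroR (s : ℕ) (v : V) (f f' : DPState k l) : Prop :=
  ∃ u : Option (Fin k), RootOk rootH rootT u v ∧ (∀ w, u = some w → f.b w = 0 ∧ f'.b w = 1) ∧
    (∀ w, u ≠ some w → f'.b w = f.b w) ∧ ∀ e, ∀ x ≤ P,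
      (x = s ∧ u = some (H.src e) ∧ f'.g e x = 1) ∨
      (x = s ∧ u ≠ some (H.src e) ∧ (f'.g e x = f.g e x ∨ f'.g e x = s + 2)) ∨
      (x ≠ s ∧ x = P ∧ u = some (H.tgt e) ∧ f'.g e x = s + 2) ∨
      (x ≠ s ∧ ¬ (x = P ∧ u = some (H.tgt e)) ∧ f'.g e x = f.g e x)

/-- The states agree. -/
def SameR (f f' : DPState k l) : Prop :=
  (∀ w, f'.b w = f.b w) ∧ ∀ e, ∀ x ≤ P, f'.g e x = f.g e x

/-- If `en` holds, the arc from the vertex in slot `x` to the vertex named `y` may be used. -/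
def ArcR (en : Prop) (x y : ℕ) (f f' : DPState k l) : Prop :=
  SameR P f f' ∨ (en ∧ ∃ e z, z ≤ P ∧ z ≠ x ∧ f.g e z = y ∧ f.g e x ≠ 0 ∧
    (∀ w, f'.b w = f.b w) ∧ f'.g e z = f.g e x ∧ f'.g e x = 0 ∧
    ∀ e', ∀ x' ≤ P, ¬ (e' = e ∧ x' = z) → ¬ (e' = e ∧ x' = x) → f'.g e' x' = f.g e' x')

/-- The vertex in slot `s` is forgotten. -/
def ForgetR (s : ℕ) (f f' : DPState k l) : Prop :=
  ∃ c, P + 2 ≤ c ∧ c < q ∧ (∀ e, f.g e s = 0) ∧ (∀ w, f'.b w = f.b w) ∧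
    ∀ e, ∀ x ≤ P, f.g e x ≠ c ∧ f'.g e x = if f.g e x = s + 2 then c else f.g e x

/-- A naming of vertices by numbers, which names the vertex in slot `s` by `s + 2`. -/
structure Naming (occ : ℕ → Option V) (A : Set V) (ρ : ℕ → Option V) : Prop where
  slot : ∀ s < P, ρ (s + 2) = occ s
  inj : ∀ y y' a, ρ y = some a → ρ y' = some a → y = y'
  lb : ∀ y a, ρ y = some a → 2 ≤ y
  ub : ∀ y a, ρ y = some a → y < q
  mem : ∀ y a, ρ y = some a → a ∈ A

theorem Naming.occ_inj {occ : ℕ → Option V} {A : Set V} {ρ : ℕ → Option V}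
    (h : Naming P q occ A ρ) {s s' : ℕ} {a : V} (hs : s < P) (hs' : s' < P)
    (h1 : occ s = some a) (h2 : occ s' = some a) : s = s' := by
  have := h.inj (s + 2) (s' + 2) a (by rw [h.slot s hs, h1]) (by rw [h.slot s' hs', h2])
  omega

theorem Naming.empty (hocc : ∀ s, (occ : ℕ → Option V) s = none) :
    Naming P q occ (∅ : Set V) (fun _ => none) :=
  ⟨fun s _ => (hocc s).symm, by simp, by simp, by simp, by simp⟩

theorem Naming.intro {occ : ℕ → Option V} {A : Set V} {ρ : ℕ → Option V}
    (h : Naming P q occ A ρ) {s : ℕ} {v : V} (hs : s < P) (hq : P + 2 ≤ q) (hv : v ∉ A) :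
    Naming P q (Function.update occ s (some v)) (insert v A)
      (Function.update ρ (s + 2) (some v)) := by
  have key : ∀ y a, Function.update ρ (s + 2) (some v) y = some a →
      (y = s + 2 ∧ a = v) ∨ (y ≠ s + 2 ∧ ρ y = some a) := by
    intro y a hy
    rw [Function.update_apply] at hy
    split_ifs at hy with h1
    · exact .inl ⟨h1, by simpa using hy.symm⟩
    · exact .inr ⟨h1, hy⟩
  refine ⟨?_, ?_, ?_, ?_, ?_⟩
  · intro s' hs'
    simp only [Function.update_apply]
    by_cases h1 : s' = s
    · simp [h1]
    · simp [h1, h.slot s' hs']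
  · intro y y' a h1 h2
    rcases key _ _ h1 with ⟨e1, rfl⟩ | ⟨e1, e2⟩ <;> rcases key _ _ h2 with ⟨e3, e4⟩ | ⟨e3, e4⟩
    · omega
    · exact absurd (h.mem _ _ e4) hv
    · exact absurd (h.mem _ _ e2) (e4 ▸ hv)
    · exact h.inj _ _ _ e2 e4
  · intro y a h1
    rcases key _ _ h1 with ⟨e1, -⟩ | ⟨e1, e2⟩
    · omega
    · exact h.lb _ _ e2
  · intro y a h1
    rcases key _ _ h1 with ⟨e1, -⟩ | ⟨e1, e2⟩
    · omega
    · exact h.ub _ _ e2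
  · intro y a h1
    rcases key _ _ h1 with ⟨-, rfl⟩ | ⟨e1, e2⟩
    · exact Set.mem_insert _ _
    · exact Set.mem_insert_of_mem _ (h.mem _ _ e2)

/-- The vertex in slot `s` moves from the name `s + 2` to `c`, and whatever `c` named before loses
its name. This costs nothing as long as no recorded piece begins at `c`, which is what `ForgetR`
demands. -/
theorem Naming.forget {occ : ℕ → Option V} {A : Set V} {ρ : ℕ → Option V}
    (h : Naming P q occ A ρ) {s c : ℕ} (hs : s < P) (hc : P + 2 ≤ c) (hq : c < q) :
    Naming P q (Function.update occ s none) A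
      (Function.update (Function.update ρ (s + 2) none) c (ρ (s + 2))) := by
  have key : ∀ y a, Function.update (Function.update ρ (s + 2) none) c (ρ (s + 2)) y = some a →
      (y = c ∧ ρ (s + 2) = some a) ∨ (y ≠ s + 2 ∧ y ≠ c ∧ ρ y = some a) := by
    intro y a hy
    simp only [Function.update_apply] at hy
    split_ifs at hy with h1 h2
    · exact .inl ⟨h1, hy⟩
    · exact .inr ⟨h2, h1, hy⟩
  refine ⟨?_, ?_, ?_, ?_, ?_⟩
  · intro s' hs'
    simp only [Function.update_apply, show s' + 2 ≠ c by omega, if_false]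
    by_cases h1 : s' = s
    · simp [h1]
    · simp [h1, h.slot s' hs']
  · intro y y' a h1 h2
    rcases key _ _ h1 with ⟨e1, e2⟩ | ⟨e1, e1', e2⟩ <;>
      rcases key _ _ h2 with ⟨e3, e4⟩ | ⟨e3, e3', e4⟩
    · omega
    · exact absurd (h.inj _ _ _ e4 e2) e3
    · exact absurd (h.inj _ _ _ e2 e4) e1
    · exact h.inj _ _ _ e2 e4
  · intro y a h1
    rcases key _ _ h1 with ⟨e1, -⟩ | ⟨e1, -, e2⟩
    · omega
    · exact h.lb _ _ e2
  · intro y a h1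
    rcases key _ _ h1 with ⟨e1, -⟩ | ⟨e1, -, e2⟩
    · omega
    · exact h.ub _ _ e2
  · intro y a h1
    rcases key _ _ h1 with ⟨-, e2⟩ | ⟨e1, -, e2⟩
    · exact h.mem _ _ e2
    · exact h.mem _ _ e2

/-! ### Soundness -/

/-- The state `f` is realised by the partial mapping `η` and the arc sets `U e`. -/
structure SndW (occ : ℕ → Option V) (A : Set V) (D : (ℕ → Option V) → V → V → Prop)
    (f : DPState k l) (ρ : ℕ → Option V) (η : Fin k → V) (U : Fin l → V → V → Prop) : Prop where
  nm : Naming P q occ A ρ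
  used : ∀ e, ∀ x ≤ P, 2 ≤ f.g e x → ∃ a, ρ (f.g e x) = some a
  free : ∀ e, ∀ x < P, occ x = none → f.g e x = 0
  bmem : ∀ u, f.b u = 1 → η u ∈ A
  binj : ∀ u w, f.b u = 1 → f.b w = 1 → η u = η w → u = w
  root : ∀ i, f.b (rootH i) = 1 → η (rootH i) = rootT i
  beg : ∀ e, ∀ x ≤ P, f.g e x = 1 → f.b (H.src e) = 1
  fin : ∀ e, f.g e P ≠ 0 → f.b (H.tgt e) = 1
  uT : ∀ e a b, U e a b → T.Adj a b
  uinj : ∀ e e' a b, U e a b → U e' a b → e = e'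
  uD : ∀ e a b, U e a b → D ρ a b
  walk : ∀ e, ∀ x ≤ P, ∀ a c, f.g e x ≠ 0 →
    (if f.g e x = 1 then η (H.src e) = a else ρ (f.g e x) = some a) →
    (if x = P then η (H.tgt e) = c else occ x = some c) → Relation.ReflTransGen (U e) a c
  closed : ∀ e, f.g e P = 1 → Relation.TransGen (U e) (η (H.src e)) (η (H.tgt e))

/-- The state `f` is realised by a partial immersion with arcs in `D`. -/
def Snd (occ : ℕ → Option V) (A : Set V) (D : (ℕ → Option V) → V → V → Prop)
    (f : DPState k l) : Prop :=
  ∃ ρ η U, SndW H T rootH rootT P q occ A D f ρ η U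

variable {H T rootH rootT P q}

theorem snd_init [Nonempty V] {occ : ℕ → Option V} (hocc : ∀ s, occ s = none)
    {D : (ℕ → Option V) → V → V → Prop} {f : DPState k l} (hb : ∀ u, f.b u = 0)
    (hg : ∀ e, ∀ x ≤ P, f.g e x = 0) : Snd H T rootH rootT P q occ ∅ D f := by
  refine ⟨_, fun _ => Classical.arbitrary V, fun _ _ _ => False,
    Naming.empty P q hocc, ?_, ?_, ?_, ?_, ?_, ?_, ?_, ?_, ?_, ?_, ?_, ?_⟩
  · intro e x hx h; rw [hg e x hx] at h; omega
  · intro e x hx _; exact hg e x hx.le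
  · intro u hu; rw [hb u] at hu; omega
  · intro u w hu; rw [hb u] at hu; omega
  · intro i hi; rw [hb] at hi; omega
  · intro e x hx h; rw [hg e x hx] at h; omega
  · intro e h; exact absurd (hg e P le_rfl) h
  · simp
  · simp
  · simp
  · intro e x hx a c h; exact absurd (hg e x hx) h
  · intro e h; rw [hg e P le_rfl] at h; omega

/-- The arc from `X` to `Y` is added to the arcs of the single edge `e`, where it joins the piece
ending at `X` to the piece beginning at `Y`. Disjointness survives because all arcs used so far lie
in `D` and the new arc does not. -/
theorem Snd.arc {occ : ℕ → Option V} {A : Set V} {D D' : (ℕ → Option V) → V → V → Prop}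
    {f f' : DPState k l} (h : Snd H T rootH rootT P q occ A D f) {en : Prop} {x y : ℕ} (hx : x < P)
    (hy : 2 ≤ y) (hR : ArcR P en x y f f') (hD : ∀ ρ a b, D ρ a b → D' ρ a b)
    (hen : en → ∀ ρ X Y, Naming P q occ A ρ → occ x = some X → ρ y = some Y →
      T.Adj X Y ∧ ¬ D ρ X Y ∧ D' ρ X Y) :
    Snd H T rootH rootT P q occ A D' f' := by
  obtain ⟨ρ, η, U, h⟩ := h
  rcases hR with ⟨hb, hg⟩ | ⟨hE, e, z, hz, hzx, hzy, hx0, hb, hgz, hgx, hg⟩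
  · refine ⟨ρ, η, U, h.nm, ?_, ?_, ?_, ?_, ?_, ?_, ?_, h.uT, h.uinj,
      fun e a b hu => hD _ _ _ (h.uD e a b hu), ?_, ?_⟩
    · intro e x hx; rw [hg e x hx]; exact h.used e x hx
    · intro e x hx; rw [hg e x hx.le]; exact h.free e x hx
    · intro u; rw [hb]; exact h.bmem u
    · intro u w; rw [hb, hb]; exact h.binj u w
    · intro i; rw [hb]; exact h.root i
    · intro e x hx; rw [hg e x hx, hb]; exact h.beg e x hx
    · intro e; rw [hg e P le_rfl, hb]; exact h.fin e
    · intro e x hx; rw [hg e x hx]; exact h.walk e x hx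
    · intro e; rw [hg e P le_rfl]; exact h.closed e
  · obtain ⟨X, hX⟩ : ∃ X, occ x = some X := by
      rcases hX : occ x with _ | X
      · exact absurd (h.free e x hx hX) hx0
      · exact ⟨X, rfl⟩
    obtain ⟨Y, hY⟩ := h.used e z hz (by omega)
    rw [hzy] at hY
    obtain ⟨hT, hnD, hD'⟩ := hen hE ρ X Y h.nm hX hY
    have hU' : ∀ e' a b, (U e' a b ∨ (e' = e ∧ a = X ∧ b = Y)) → D' ρ a b := by
      rintro e' a b (hu | ⟨rfl, rfl, rfl⟩)
      · exact hD _ _ _ (h.uD _ _ _ hu)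
      · exact hD'
    have mono : ∀ e' a b, Relation.ReflTransGen (U e') a b → Relation.ReflTransGen
        (fun a b => U e' a b ∨ (e' = e ∧ a = X ∧ b = Y)) a b :=
      fun e' a b hab => Relation.ReflTransGen.mono (fun a b hu => Or.inl hu) _ _ hab
    have cases : ∀ e', ∀ x' ≤ P, (e' = e ∧ x' = z ∧ f'.g e' x' = f.g e x) ∨
        (e' = e ∧ x' = x ∧ f'.g e' x' = 0) ∨ (f'.g e' x' = f.g e' x' ∧ ¬ (e' = e ∧ x' = z)) := by
      intro e' x' hx'
      by_cases h1 : e' = e ∧ x' = z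
      · exact .inl ⟨h1.1, h1.2, by rw [h1.1, h1.2, hgz]⟩
      · by_cases h2 : e' = e ∧ x' = x
        · exact .inr (.inl ⟨h2.1, h2.2, by rw [h2.1, h2.2, hgx]⟩)
        · exact .inr (.inr ⟨hg e' x' hx' h1 h2, h1⟩)
    -- A joined piece contains at least one arc. Recording this as `TransGen` is what `closed` needs
    -- for loops, where a walk without arcs would also lead from the source to the target.
    have joined : ∀ a c, (if f.g e x = 1 then η (H.src e) = a else ρ (f.g e x) = some a) →
        (if z = P then η (H.tgt e) = c else occ z = some c) → Relation.TransGen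
        (fun a b => U e a b ∨ (e = e ∧ a = X ∧ b = Y)) a c := by
      intro a c ha hc
      have w1 := mono e _ _ (h.walk e x hx.le a X hx0 ha (by rw [if_neg hx.ne]; exact hX))
      have w2 := mono e _ _ (h.walk e z hz Y c (by omega)
        (by rw [hzy, if_neg (by omega)]; exact hY) hc)
      exact Relation.TransGen.trans_left (Relation.TransGen.tail' w1 (Or.inr ⟨rfl, rfl, rfl⟩)) w2
    refine ⟨ρ, η, fun e' a b => U e' a b ∨ (e' = e ∧ a = X ∧ b = Y), h.nm, ?_, ?_, ?_, ?_, ?_, ?_,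
      ?_, ?_, ?_, hU', ?_, ?_⟩
    · intro e' x' hx' h2
      rcases cases e' x' hx' with ⟨-, -, c3⟩ | ⟨-, -, c3⟩ | ⟨c3, -⟩ <;> rw [c3] at h2 ⊢
      · exact h.used e x hx.le h2
      · omega
      · exact h.used e' x' hx' h2
    · intro e' x' hx' h2
      rcases cases e' x' hx'.le with ⟨c1, c2, c3⟩ | ⟨-, -, c3⟩ | ⟨c3, -⟩
      · subst c1 c2
        have := h.free e' x' hx' h2
        omega
      · exact c3
      · rw [c3]; exact h.free e' x' hx' h2
    · intro u; rw [hb]; exact h.bmem u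
    · intro u w; rw [hb, hb]; exact h.binj u w
    · intro i; rw [hb]; exact h.root i
    · intro e' x' hx'
      rw [hb]
      rcases cases e' x' hx' with ⟨c1, -, c3⟩ | ⟨-, -, c3⟩ | ⟨c3, -⟩ <;> rw [c3]
      · rw [c1]; exact h.beg e x hx.le
      · simp
      · exact h.beg e' x' hx'
    · intro e'
      rw [hb]
      rcases cases e' P le_rfl with ⟨c1, c2, c3⟩ | ⟨c1, c2, c3⟩ | ⟨c3, -⟩
      · intro _; rw [c1]; exact h.fin e (by rw [c2, hzy]; omega)
      · exact fun h => absurd c3 h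
      · rw [c3]; exact h.fin e'
    · rintro e' a b (hu | ⟨-, rfl, rfl⟩)
      · exact h.uT _ _ _ hu
      · exact hT
    · rintro e1 e2 a b (hu | ⟨rfl, rfl, rfl⟩) (hw | ⟨rfl, h1, h2⟩)
      · exact h.uinj _ _ _ _ hu hw
      · subst h1 h2; exact absurd (h.uD _ _ _ hu) hnD
      · exact absurd (h.uD _ _ _ hw) hnD
      · rfl
    · intro e' x' hx' a c h0 ha hc
      rcases cases e' x' hx' with ⟨c1, c2, c3⟩ | ⟨-, -, c3⟩ | ⟨c3, -⟩ <;> rw [c3] at h0 ha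
      · subst c1 c2
        exact (joined a c ha hc).to_reflTransGen
      · omega
      · exact mono _ _ _ (h.walk e' x' hx' a c h0 ha hc)
    · intro e' h1
      rcases cases e' P le_rfl with ⟨c1, c2, c3⟩ | ⟨c1, c2, c3⟩ | ⟨c3, -⟩ <;> rw [c3] at h1
      · subst c1
        exact joined _ _ (by rw [if_pos h1]) (by rw [if_pos c2.symm])
      · omega
      · exact Relation.TransGen.mono (fun a b hu => Or.inl hu) _ _ (h.closed e' h1)

theorem Snd.mono {occ : ℕ → Option V} {A : Set V} {D D' : (ℕ → Option V) → V → V → Prop}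
    {f : DPState k l} (h : Snd H T rootH rootT P q occ A D f)
    (hD : ∀ ρ a b, Naming P q occ A ρ → D ρ a b → D' ρ a b) :
    Snd H T rootH rootT P q occ A D' f := by
  obtain ⟨ρ, η, U, h⟩ := h
  exact ⟨ρ, η, U, h.nm, h.used, h.free, h.bmem, h.binj, h.root, h.beg, h.fin, h.uT, h.uinj,
    fun e a b hu => hD _ _ _ h.nm (h.uD e a b hu), h.walk, h.closed⟩

/-- Forgetting is a pure renaming: the arcs, the walks and the mapping stay, and every recorded
beginning denotes the same vertex under the new naming. -/
theorem Snd.forget {occ : ℕ → Option V} {A : Set V} {D : V → V → Prop}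
    {f f' : DPState k l} (h : Snd H T rootH rootT P q occ A (fun _ => D) f) {s : ℕ} (hs : s < P)
    (hR : ForgetR P q s f f') :
    Snd H T rootH rootT P q (Function.update occ s none) A (fun _ => D) f' := by
  obtain ⟨ρ, η, U, h⟩ := h
  obtain ⟨c, hc, hcq, h0, hb, hg⟩ := hR
  have h1 : ∀ e, ∀ x ≤ P, f'.g e x = 1 ↔ f.g e x = 1 := by
    intro e x hx
    rw [(hg e x hx).2]
    split_ifs <;> omega
  have hz : ∀ e, ∀ x ≤ P, f'.g e x = 0 ↔ f.g e x = 0 := by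
    intro e x hx
    rw [(hg e x hx).2]
    split_ifs <;> omega
  -- Since `c` occurs nowhere in `f`, overwriting what it named does not disturb any recorded
  -- beginning.
  have hr : ∀ e, ∀ x ≤ P, Function.update (Function.update ρ (s + 2) none) c (ρ (s + 2))
      (f'.g e x) = ρ (f.g e x) := by
    intro e x hx
    have hcx := (hg e x hx).1
    rw [(hg e x hx).2]
    split_ifs with h2
    · simp [h2]
    · simp [hcx, h2]
  refine ⟨_, η, U, h.nm.forget P q hs hc hcq, ?_, ?_, ?_, ?_, ?_, ?_, ?_, h.uT, h.uinj, h.uD, ?_, ?_⟩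
  · intro e x hx h2
    rw [hr e x hx]
    have := (h1 e x hx)
    have := (hz e x hx)
    exact h.used e x hx (by omega)
  · intro e x hx h2
    rw [hz e x hx.le]
    by_cases h3 : x = s
    · rw [h3]; exact h0 e
    · rw [Function.update_of_ne h3] at h2; exact h.free e x hx h2
  · intro u; rw [hb]; exact h.bmem u
  · intro u w; rw [hb, hb]; exact h.binj u w
  · intro i; rw [hb]; exact h.root i
  · intro e x hx; rw [h1 e x hx, hb]; exact h.beg e x hx
  · intro e; rw [Ne, hz e P le_rfl, hb]; exact h.fin e
  · intro e x hx a d hne ha hd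
    rw [hr e x hx] at ha
    rw [Ne, hz e x hx] at hne
    simp only [h1 e x hx] at ha
    refine h.walk e x hx a d hne ha ?_
    split_ifs at hd ⊢
    · exact hd
    · rw [Function.update_apply] at hd
      split_ifs at hd
      exact hd
  · intro e; rw [h1 e P le_rfl]; exact h.closed e

/-- Only pieces without arcs are created, so the new walks are reflexive. If the new vertex is both
source and target of a loop, it yields two pieces: one starts at the initial vertex and ends in the
slot, the other starts in the slot and ends at the terminal. The loop therefore still has to be
closed by arcs. -/
theorem Snd.intro {occ : ℕ → Option V} {A : Set V} {D : V → V → Prop}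
    {f f' : DPState k l} (h : Snd H T rootH rootT P q occ A (fun _ => D) f) {s : ℕ} {v : V}
    (hs : s < P) (hq : P + 2 ≤ q) (hv : v ∉ A) (hocc : occ s = none)
    (hR : IntroR H rootH rootT P s v f f') :
    Snd H T rootH rootT P q (Function.update occ s (some v)) (insert v A) (fun _ => D) f' := by
  classical
  obtain ⟨ρ, η, U, h⟩ := h
  obtain ⟨u, hu, hu1, hb, hg⟩ := hR
  set η' : Fin k → V := fun w => if u = some w then v else η w with hη'
  have hb1 : ∀ w, f'.b w = 1 → u = some w ∨ (u ≠ some w ∧ f.b w = 1) := by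
    intro w hw
    by_cases h1 : u = some w
    · exact .inl h1
    · exact .inr ⟨h1, by rw [← hb w h1]; exact hw⟩
  have hbm : ∀ w, f.b w = 1 → u ≠ some w ∧ f'.b w = 1 := by
    intro w hw
    have h1 : u ≠ some w := fun h1 => by have := (hu1 w h1).1; omega
    exact ⟨h1, by rw [hb w h1]; exact hw⟩
  have hη1 : ∀ w, f.b w = 1 → η' w = η w := fun w hw => if_neg (hbm w hw).1
  have hs2 : ρ (s + 2) = none := by rw [h.nm.slot s hs, hocc]
  -- Slot `s` was free. Hence an unchanged entry there is `0`, and the name `s + 2` denoted nothing,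
  -- so no older piece can begin with it.
  have hcase : ∀ e, ∀ x ≤ P, f'.g e x ≠ 0 →
      (x = s ∧ u = some (H.src e) ∧ f'.g e x = 1) ∨ (x = s ∧ f'.g e x = s + 2) ∨
      (x ≠ s ∧ x = P ∧ u = some (H.tgt e) ∧ f'.g e x = s + 2) ∨
      (x ≠ s ∧ f'.g e x = f.g e x ∧ f.g e x ≠ s + 2) := by
    intro e x hx h0
    rcases hg e x hx with h1 | ⟨h1, -, h2 | h2⟩ | h1 | ⟨h1, -, h2⟩
    · exact .inl h1
    · exact absurd (h2.trans (by rw [h1]; exact h.free e s hs hocc)) h0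
    · exact .inr (.inl ⟨h1, h2⟩)
    · exact .inr (.inr (.inl h1))
    · refine .inr (.inr (.inr ⟨h1, h2, fun h3 => ?_⟩))
      obtain ⟨a, ha⟩ := h.used e x hx (by omega)
      rw [h3, hs2] at ha
      simp at ha
  refine ⟨_, η', U, h.nm.intro P q hs hq hv, ?_, ?_, ?_, ?_, ?_, ?_, ?_, h.uT, h.uinj, h.uD, ?_, ?_⟩
  · intro e x hx h2
    rcases hcase e x hx (by omega) with ⟨-, -, h3⟩ | ⟨-, h3⟩ | ⟨-, -, -, h3⟩ | ⟨-, h3, h4⟩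
    · omega
    · exact ⟨v, by simp [h3]⟩
    · exact ⟨v, by simp [h3]⟩
    · rw [h3] at h2 ⊢
      rw [Function.update_of_ne h4]
      exact h.used e x hx h2
  · intro e x hx h2
    by_contra h0
    rcases hcase e x hx.le h0 with ⟨h3, -, -⟩ | ⟨h3, -⟩ | ⟨-, h3, -, -⟩ | ⟨h5, h3, h4⟩
    · simp [h3] at h2
    · simp [h3] at h2
    · omega
    · rw [Function.update_of_ne h5] at h2
      rw [h3] at h0
      exact h0 (h.free e x hx h2)
  · intro w hw
    rcases hb1 w hw with h1 | ⟨h1, h2⟩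
    · simp [hη', h1]
    · rw [hη1 w h2]; exact Set.mem_insert_of_mem _ (h.bmem w h2)
  · intro w w' hw hw' hww
    rcases hb1 w hw with h1 | ⟨h1, h2⟩ <;> rcases hb1 w' hw' with h1' | ⟨h1', h2'⟩
    · rw [h1] at h1'; exact Option.some.inj h1'
    · rw [hη1 w' h2'] at hww
      have : η' w = v := if_pos h1
      exact absurd (h.bmem w' h2') (by rw [← hww, this]; exact hv)
    · rw [hη1 w h2] at hww
      have : η' w' = v := if_pos h1'
      exact absurd (h.bmem w h2) (by rw [hww, this]; exact hv)
    · rw [hη1 w h2, hη1 w' h2'] at hww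
      exact h.binj w w' h2 h2' hww
  · intro i hi
    rcases hb1 _ hi with h1 | ⟨h1, h2⟩
    · rw [(hu i).1 h1]; exact if_pos h1
    · rw [hη1 _ h2]; exact h.root i h2
  · intro e x hx h1
    rcases hcase e x hx (by omega) with ⟨-, h3, -⟩ | ⟨-, h3⟩ | ⟨-, -, -, h3⟩ | ⟨-, h3, h4⟩
    · exact (hu1 _ h3).2
    · omega
    · omega
    · exact (hbm _ (h.beg e x hx (by omega))).2
  · intro e h0
    rcases hcase e P le_rfl h0 with ⟨h3, -⟩ | ⟨h3, -⟩ | ⟨-, -, h3, -⟩ | ⟨-, h3, h4⟩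
    · omega
    · omega
    · exact (hu1 _ h3).2
    · exact (hbm _ (h.fin e (by omega))).2
  · intro e x hx a c h0 ha hc
    rcases hcase e x hx h0 with ⟨h1, h2, h3⟩ | ⟨h1, h3⟩ | ⟨h5, h1, h2, h3⟩ | ⟨h5, h3, h4⟩
    · rw [if_pos h3] at ha
      rw [if_neg (by omega), h1, Function.update_self] at hc
      have : η' (H.src e) = v := if_pos h2
      rw [← ha, this, Option.some.inj hc]
    · rw [if_neg (by omega), h3, Function.update_self] at ha
      rw [if_neg (by omega), h1, Function.update_self] at hc
      rw [← Option.some.inj ha, Option.some.inj hc]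
    · rw [if_neg (by omega), h3, Function.update_self] at ha
      rw [if_pos h1] at hc
      have : η' (H.tgt e) = v := if_pos h2
      rw [← Option.some.inj ha, ← hc, this]
    · rw [h3] at h0 ha
      refine h.walk e x hx a c h0 ?_ ?_
      · split_ifs at ha ⊢ with h6
        · rw [← hη1 _ (h.beg e x hx h6)]; exact ha
        · rwa [Function.update_of_ne h4] at ha
      · split_ifs at hc ⊢ with h6
        · rw [← hη1 _ (h.fin e (by rw [← h6]; exact h0))]; exact hc
        · rwa [Function.update_of_ne h5] at hc
  · intro e h1
    rcases hcase e P le_rfl (by omega) with ⟨h3, -⟩ | ⟨h3, -⟩ | ⟨-, -, -, h3⟩ | ⟨-, h3, h4⟩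
    · omega
    · omega
    · omega
    · rw [h3] at h1
      rw [hη1 _ (h.beg e P le_rfl h1), hη1 _ (h.fin e (by omega))]
      exact h.closed e h1

/-! ### From arc-disjoint walks to an immersion. -/

theorem walkArcs_of_isChain {r : V → V → Prop} : ∀ {q : List V}, q.IsChain r →
    ∀ x ∈ walkArcs q, r x.1 x.2
  | [], _, x, hx => by simp [walkArcs] at hx
  | [a], _, x, hx => by simp [walkArcs] at hx
  | a :: b :: q, h, x, hx => by
      rw [List.isChain_cons_cons] at h
      simp only [walkArcs, List.tail_cons, List.zip_cons_cons, List.mem_cons] at hx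
      rcases hx with rfl | hx
      · exact h.1
      · exact walkArcs_of_isChain h.2 x (by simpa [walkArcs] using hx)

/-- Prepend the first vertex to a repetition-free chain for the rest; if it already occurs there,
keep only the part of the chain from that occurrence on. -/
theorem exists_nodup_chain {r : V → V → Prop} {a b : V} (h : Relation.ReflTransGen r a b) :
    ∃ q : List V, q.head? = some a ∧ q.getLast? = some b ∧ q.IsChain r ∧ q.Nodup := by
  induction h using Relation.ReflTransGen.head_induction_on with
  | refl => exact ⟨[b], by simp⟩
  | @head a c hac _ ih =>
    obtain ⟨q, h1, h2, h3, h4⟩ := ih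
    by_cases ha : a ∈ q
    · obtain ⟨q1, q2, rfl⟩ := List.append_of_mem ha
      refine ⟨a :: q2, rfl, ?_, (List.isChain_append.1 h3).2.1, (List.nodup_append.1 h4).2.1⟩
      rw [← h2, List.getLast?_append_of_ne_nil _ (by simp)]
    · refine ⟨a :: q, rfl, ?_, ?_, List.nodup_cons.2 ⟨ha, h4⟩⟩
      · cases q with
        | nil => simp at h1
        | cons d q => rw [List.getLast?_cons_cons]; exact h2
      · cases q with
        | nil => simp at h1
        | cons d q =>
          simp only [List.head?_cons, Option.some.injEq] at h1
          subst h1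
          exact List.isChain_cons_cons.2 ⟨hac, h3⟩

/-- Shortening a walk uses only arcs of its own set `U e`, so the results stay arc-disjoint. For a
loop, split off the first arc of the closed walk and shorten the remainder, which leads back to the
start; together they form a cycle. -/
theorem Snd.immersible {occ : ℕ → Option V} {A : Set V} {D : (ℕ → Option V) → V → V → Prop}
    {f : DPState k l} (h : Snd H T rootH rootT P q occ A D f) (hb : ∀ u, f.b u = 1)
    (hg : ∀ e, f.g e P = 1) : RootedImmersible H rootH T rootT := by
  obtain ⟨ρ, η, U, h⟩ := h
  have key : ∀ e, ∃ q : List V, q.IsChain (U e) ∧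
      (H.src e ≠ H.tgt e → T.IsPathFromTo (η (H.src e)) (η (H.tgt e)) q) ∧
      (H.src e = H.tgt e → T.IsCycleThrough (η (H.src e)) q) := by
    intro e
    have ht := h.closed e (hg e)
    by_cases he : H.src e = H.tgt e
    · obtain ⟨c, hc1, hc2⟩ := Relation.TransGen.head'_iff.1 ht
      obtain ⟨q, h1, h2, h3, h4⟩ := exists_nodup_chain hc2
      rcases q with _ | ⟨d, q⟩
      · simp at h1
      · simp only [List.head?_cons, Option.some.injEq] at h1
        subst h1
        have h5 := List.isChain_cons_cons.2 ⟨hc1, h3⟩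
        refine ⟨_, h5, fun h => absurd he h, fun _ => ⟨rfl, ?_, by simp, ?_, h4⟩⟩
        · rw [List.getLast?_cons_cons, h2, he]
        · exact h5.imp (fun a b hab => h.uT e a b hab)
    · obtain ⟨q, h1, h2, h3, h4⟩ := exists_nodup_chain ht.to_reflTransGen
      exact ⟨q, h3, fun _ => ⟨h1, h2, h3.imp (fun a b hab => h.uT e a b hab), h4⟩,
        fun h => absurd h he⟩
  choose Q hQ1 hQ2 hQ3 using key
  refine ⟨⟨η, Q, fun u w huw => h.binj u w (hb u) (hb w) huw, hQ2, hQ3, ?_⟩,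
    fun i => h.root i (hb _)⟩
  intro e e' hne x hx hx'
  exact hne (h.uinj e e' _ _ (walkArcs_of_isChain (hQ1 e) x hx) (walkArcs_of_isChain (hQ1 e') x hx'))

end DP

/-! ### Completeness -/

section Cmp

variable {V : Type*} {k l t : ℕ} (H : MultiDigraph (Fin k) (Fin l)) (T : Digraph V)
  (rootH : Fin t → Fin k) (rootT : Fin t → V) (P q : ℕ)

/-- The paths and cycles of a rooted immersion, as sequences `Q e 0, …, Q e (m e)`. -/
structure PathSys (η : Fin k → V) (Q : Fin l → ℕ → V) (m : Fin l → ℕ) : Prop where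
  inj : Function.Injective η
  root : ∀ i, η (rootH i) = rootT i
  pos : ∀ e, 0 < m e
  start : ∀ e, Q e 0 = η (H.src e)
  finish : ∀ e, Q e (m e) = η (H.tgt e)
  adj : ∀ e, ∀ j < m e, T.Adj (Q e j) (Q e (j + 1))
  inj0 : ∀ e, ∀ j < m e, ∀ j' < m e, Q e j = Q e j' → j = j'
  disj : ∀ e e', ∀ j < m e, ∀ j' < m e', Q e j = Q e' j' → Q e (j + 1) = Q e' (j' + 1) → e = e'

variable {H T rootH rootT} in
theorem mem_walkArcs {q : List V} {j : ℕ} (hj : j + 1 < q.length) :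
    (q[j], q[j + 1]) ∈ walkArcs q := by
  rw [walkArcs, List.mem_iff_getElem]
  refine ⟨j, by simp; omega, by simp⟩

-- A path and a cycle share the property that no vertex repeats once the last one is dropped.
-- Completeness uses only this, so loops and other edges need no separate treatment from here on.
variable {H T rootH rootT} in
theorem RootedImmersible.exists_pathSys (h : RootedImmersible H rootH T rootT) :
    ∃ η Q m, PathSys H T rootH rootT η Q m := by
  obtain ⟨I, hI⟩ := h
  have key : ∀ e, (I.onEdge e).head? = some (I.onVert (H.src e)) ∧
      (I.onEdge e).getLast? = some (I.onVert (H.tgt e)) ∧ (I.onEdge e).IsChain T.Adj ∧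
      2 ≤ (I.onEdge e).length ∧ (I.onEdge e).dropLast.Nodup := by
    intro e
    by_cases he : H.src e = H.tgt e
    · obtain ⟨h1, h2, h3, h4, h5⟩ := I.isCycle e he
      refine ⟨h1, he ▸ h2, h4, h3, ?_⟩
      generalize I.onEdge e = q at *
      rcases q with _ | ⟨a, q⟩
      · simp
      · rcases List.eq_nil_or_concat q with rfl | ⟨q', b, hqq⟩
        · simp
        · rw [List.concat_eq_append] at hqq
          subst hqq
          simp only [List.head?_cons, Option.some.injEq] at h1
          rw [← List.cons_append, List.getLast?_concat] at h2
          simp only [List.tail_cons] at h5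
          rw [← List.cons_append, List.dropLast_concat]
          -- The cycle starts and ends at the same vertex, so dropping the first entry or the last
          -- leaves the same entries in different order.
          have h6 := (List.nodup_append_comm.1 h5)
          simpa [h1, Option.some.inj h2] using h6
    · obtain ⟨h1, h2, h4, h5⟩ := I.isPath e he
      refine ⟨h1, h2, h4, ?_, h5.sublist (List.dropLast_sublist _)⟩
      generalize I.onEdge e = q at *
      match q with
      | [] => simp at h1
      | [a] =>
        simp only [List.head?_cons, Option.some.injEq, List.getLast?_singleton] at h1 h2
        exact absurd (I.injective (h1.symm.trans h2)) he
      | a :: b :: q => simp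
  have : ∀ e, ∃ m, (I.onEdge e).length = m + 1 ∧ 0 < m := fun e =>
    ⟨(I.onEdge e).length - 1, by have := (key e).2.2.2.1; omega, by have := (key e).2.2.2.1; omega⟩
  choose m hm hm0 using this
  have hQ : ∀ e, ∃ Q : ℕ → V, ∀ j (hj : j ≤ m e), Q j = (I.onEdge e)[j]'(by rw [hm e]; omega) := by
    intro e
    -- The default value is never reached: only positions `j ≤ m e` are used.
    refine ⟨fun j => (I.onEdge e).getD j (I.onVert (H.src e)), fun j hj => ?_⟩
    simp [List.getElem?_eq_getElem (show j < (I.onEdge e).length by rw [hm e]; omega)]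
  choose Q hQ using hQ
  refine ⟨I.onVert, Q, m, I.injective, hI, hm0, ?_, ?_, ?_, ?_, ?_⟩
  · intro e
    have := (key e).1
    rw [List.head?_eq_getElem?, List.getElem?_eq_getElem (by rw [hm e]; omega)] at this
    rw [hQ e 0 (by omega)]
    exact Option.some.inj this
  · intro e
    have := (key e).2.1
    rw [List.getLast?_eq_getElem?, List.getElem?_eq_getElem (by rw [hm e]; omega)] at this
    rw [hQ e _ le_rfl]
    have h2 := Option.some.inj this
    simpa [hm e] using h2
  · intro e j hj
    rw [hQ e j hj.le, hQ e (j + 1) hj]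
    exact List.isChain_iff_getElem.1 (key e).2.2.1 j (by rw [hm e]; omega)
  · intro e j hj j' hj' h
    rw [hQ e j hj.le, hQ e j' hj'.le] at h
    refine (List.Nodup.getElem_inj_iff (key e).2.2.2.2 (i := j) (j := j')
      (hi := by simp [hm e]; omega) (hj := by simp [hm e]; omega)).1 ?_
    simpa using h
  · intro e e' j hj j' hj' h1 h2
    by_contra hne
    refine I.edgeDisjoint e e' hne (mem_walkArcs (j := j) (by rw [hm e]; omega)) ?_
    rw [← hQ e j hj.le, ← hQ e (j + 1) hj, h1, h2, hQ e' j' hj'.le, hQ e' (j' + 1) hj']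
    exact mem_walkArcs (by rw [hm e']; omega)

/-- `Q e i, …, Q e j` is a maximal piece of the path `Q e` inside `A` with arcs in `D`. -/
structure Seg (A : Set V) (D : V → V → Prop) (Q : Fin l → ℕ → V) (m : Fin l → ℕ) (e : Fin l)
    (i j : ℕ) : Prop where
  le : i ≤ j
  le_m : j ≤ m e
  mem : Q e i ∈ A
  mid : ∀ t, i ≤ t → t < j → D (Q e t) (Q e (t + 1))
  left : ∀ t, t + 1 = i → ¬ D (Q e t) (Q e (t + 1))
  right : j < m e → ¬ D (Q e j) (Q e (j + 1))

section Seg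
variable {A : Set V} {D : V → V → Prop} {Q : Fin l → ℕ → V} {m : Fin l → ℕ} {e : Fin l} {i i' j j' : ℕ}

theorem Seg.left_unique (h : Seg A D Q m e i j) (h' : Seg A D Q m e i' j) : i = i' := by
  rcases lt_trichotomy i i' with h1 | h1 | h1
  · exact absurd (h.mid (i' - 1) (by omega) (by have := h'.le; omega))
      (h'.left (i' - 1) (by omega))
  · exact h1
  · exact absurd (h'.mid (i - 1) (by omega) (by have := h.le; omega))
      (h.left (i - 1) (by omega))

theorem Seg.right_unique (h : Seg A D Q m e i j) (h' : Seg A D Q m e i j') : j = j' := by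
  rcases lt_trichotomy j j' with h1 | h1 | h1
  · exact absurd (h'.mid j h.le h1) (h.right (by have := h'.le_m; omega))
  · exact h1
  · exact absurd (h.mid j' h'.le h1) (h'.right (by have := h.le_m; omega))

theorem exists_seg_left (hD : ∀ a b, D a b → a ∈ A ∧ b ∈ A) (hj : j ≤ m e) (hA : Q e j ∈ A)
    (hr : j < m e → ¬ D (Q e j) (Q e (j + 1))) : ∃ i, Seg A D Q m e i j := by
  have : ∀ n ≤ m e, Q e n ∈ A → ∃ i ≤ n, Q e i ∈ A ∧ (∀ t, i ≤ t → t < n →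
      D (Q e t) (Q e (t + 1))) ∧ ∀ t, t + 1 = i → ¬ D (Q e t) (Q e (t + 1)) := by
    intro n
    induction n with
    | zero => exact fun _ h => ⟨0, le_rfl, h, fun t h1 h2 => by omega, fun t h => by omega⟩
    | succ n ih =>
      intro hn hA
      by_cases hd : D (Q e n) (Q e (n + 1))
      · obtain ⟨i, h1, h2, h3, h4⟩ := ih (by omega) (hD _ _ hd).1
        refine ⟨i, by omega, h2, fun t ht ht' => ?_, h4⟩
        rcases Nat.lt_succ_iff_lt_or_eq.1 ht' with h5 | rfl
        · exact h3 t ht h5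
        · exact hd
      · refine ⟨n + 1, le_rfl, hA, fun t h1 h2 => by omega, fun t ht => ?_⟩
        obtain rfl : t = n := by omega
        exact hd
  obtain ⟨i, h1, h2, h3, h4⟩ := this j hj hA
  exact ⟨i, h1, hj, h2, h3, h4, hr⟩

theorem exists_seg_right (hi : i ≤ m e) (hA : Q e i ∈ A)
    (hl : ∀ t, t + 1 = i → ¬ D (Q e t) (Q e (t + 1))) : ∃ j, Seg A D Q m e i j := by
  have : ∀ n i, i + n = m e → ∃ j, i ≤ j ∧ j ≤ m e ∧ (∀ t, i ≤ t → t < j →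
      D (Q e t) (Q e (t + 1))) ∧ (j < m e → ¬ D (Q e j) (Q e (j + 1))) := by
    intro n
    induction n with
    | zero => exact fun i h => ⟨i, le_rfl, by omega, fun t h1 h2 => by omega, fun h => by omega⟩
    | succ n ih =>
      intro i hn
      by_cases hd : D (Q e i) (Q e (i + 1))
      · obtain ⟨j, h1, h2, h3, h4⟩ := ih (i + 1) (by omega)
        refine ⟨j, by omega, h2, fun t ht ht' => ?_, h4⟩
        rcases eq_or_lt_of_le ht with rfl | h5
        · exact hd
        · exact h3 t h5 ht'
      · exact ⟨i, le_rfl, by omega, fun t h1 h2 => by omega, fun _ => hd⟩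
  obtain ⟨j, h1, h2, h3, h4⟩ := this (m e - i) i (by omega)
  exact ⟨j, h1, h2, hA, h3, hl, h4⟩

end Seg

/-- The end `x` is where position `j` of the path `Q e` is. -/
def EndAt (occ : ℕ → Option V) (Q : Fin l → ℕ → V) (m : Fin l → ℕ) (e : Fin l) (j x : ℕ) : Prop :=
  (j = m e ∧ x = P) ∨ (j < m e ∧ x < P ∧ occ x = some (Q e j))

/-- The number `y` is the name of position `i` of the path `Q e`. -/
def BegAt (ρ : ℕ → Option V) (Q : Fin l → ℕ → V) (e : Fin l) (i y : ℕ) : Prop :=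
  (i = 0 ∧ y = 1) ∨ (0 < i ∧ ρ y = some (Q e i))

/-- The state `f` describes the traces of the paths `Q` on the arcs in `D`, with the naming `ρ`. -/
structure CmpW (η : Fin k → V) (Q : Fin l → ℕ → V) (m : Fin l → ℕ) (occ : ℕ → Option V)
    (A : Set V) (D : V → V → Prop) (f : DPState k l) (ρ : ℕ → Option V) : Prop where
  nm : Naming P q occ A ρ
  b1 : ∀ u, η u ∈ A → f.b u = 1
  b0 : ∀ u, η u ∉ A → f.b u = 0
  c1 : ∀ e i j, Seg A D Q m e i j → ∃ x y, EndAt P occ Q m e j x ∧ BegAt ρ Q e i y ∧ f.g e x = y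
  c2 : ∀ e, ∀ x ≤ P, f.g e x ≠ 0 → ∃ i j, Seg A D Q m e i j ∧ EndAt P occ Q m e j x ∧
    BegAt ρ Q e i (f.g e x)

/-- The state `f` describes the traces of the paths `Q` on the arcs in `D`. -/
def CmpS (η : Fin k → V) (Q : Fin l → ℕ → V) (m : Fin l → ℕ) (occ : ℕ → Option V)
    (A : Set V) (D : (ℕ → Option V) → V → V → Prop) (f : DPState k l) : Prop :=
  ∃ ρ, CmpW P q η Q m occ A (D ρ) f ρ

/-! ### How the trace of an immersion changes under the three transitions. -/

variable {H T rootH rootT P q}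
variable {η : Fin k → V} {Q : Fin l → ℕ → V} {m : Fin l → ℕ}

theorem EndAt.le {occ : ℕ → Option V} {e : Fin l} {j x : ℕ} (h : EndAt P occ Q m e j x) : x ≤ P := by
  rcases h with ⟨-, h⟩ | ⟨-, h, -⟩ <;> omega

theorem EndAt.left_unique (hQ : PathSys H T rootH rootT η Q m) {occ : ℕ → Option V} {e : Fin l}
    {j j' x : ℕ} (h : EndAt P occ Q m e j x) (h' : EndAt P occ Q m e j' x) : j = j' := by
  rcases h with ⟨h1, h2⟩ | ⟨h1, h2, h3⟩ <;> rcases h' with ⟨h1', h2'⟩ | ⟨h1', h2', h3'⟩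
  · omega
  · omega
  · omega
  · exact hQ.inj0 e j h1 j' h1' (Option.some.inj (h3.symm.trans h3'))

theorem EndAt.right_unique {occ : ℕ → Option V} {A : Set V} {ρ : ℕ → Option V}
    (hn : Naming P q occ A ρ) {e : Fin l}
    {j x x' : ℕ} (h : EndAt P occ Q m e j x) (h' : EndAt P occ Q m e j x') : x = x' := by
  rcases h with ⟨h1, h2⟩ | ⟨h1, h2, h3⟩ <;> rcases h' with ⟨h1', h2'⟩ | ⟨h1', h2', h3'⟩
  · omega
  · omega
  · omega
  · exact hn.occ_inj P q h2 h2' h3 h3'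

theorem BegAt.lt {occ : ℕ → Option V} {A : Set V} {ρ : ℕ → Option V}
    (hn : Naming P q occ A ρ) (hq : 2 ≤ q) {e : Fin l} {i y : ℕ} (h : BegAt ρ Q e i y) :
    0 < y ∧ y < q := by
  rcases h with ⟨-, h⟩ | ⟨-, h⟩
  · omega
  · have := hn.lb _ _ h
    have := hn.ub _ _ h
    omega

theorem Seg.congr {A : Set V} {D D' : V → V → Prop} {e : Fin l} {i j : ℕ}
    (hD : ∀ j < m e, D (Q e j) (Q e (j + 1)) ↔ D' (Q e j) (Q e (j + 1))) (h : Seg A D Q m e i j) :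
    Seg A D' Q m e i j := by
  have h1 := h.le
  have h2 := h.le_m
  refine ⟨h.le, h.le_m, h.mem, fun t ht ht' => (hD t (by omega)).1 (h.mid t ht ht'),
    fun t ht hd => h.left t ht ((hD t (by omega)).2 hd), fun hj hd => h.right hj ((hD j hj).2 hd)⟩

theorem CmpW.congr {occ : ℕ → Option V} {A : Set V} {D D' : V → V → Prop} {f f' : DPState k l}
    {ρ : ℕ → Option V} (h : CmpW P q η Q m occ A D f ρ)
    (hD : ∀ e, ∀ j < m e, D (Q e j) (Q e (j + 1)) ↔ D' (Q e j) (Q e (j + 1)))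
    (hb : ∀ u, f'.b u = f.b u) (hg : ∀ e, ∀ x ≤ P, f'.g e x = f.g e x) :
    CmpW P q η Q m occ A D' f' ρ := by
  refine ⟨h.nm, fun u hu => (hb u).trans (h.b1 u hu), fun u hu => (hb u).trans (h.b0 u hu), ?_, ?_⟩
  · intro e i j hs
    obtain ⟨x, y, h1, h2, h3⟩ := h.c1 e i j (hs.congr fun j hj => (hD e j hj).symm)
    exact ⟨x, y, h1, h2, (hg e x h1.le).trans h3⟩
  · intro e x hx h0
    rw [hg e x hx] at h0 ⊢
    obtain ⟨i, j, h1, h2, h3⟩ := h.c2 e x hx h0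
    exact ⟨i, j, h1.congr (hD e), h2, h3⟩

theorem CmpW.lt {occ : ℕ → Option V} {A : Set V} {D : V → V → Prop} {f : DPState k l}
    {ρ : ℕ → Option V} (h : CmpW P q η Q m occ A D f ρ) (hq : 2 ≤ q) :
    (∀ u, f.b u < 2) ∧ ∀ e, ∀ x ≤ P, f.g e x < q := by
  refine ⟨fun u => ?_, fun e x hx => ?_⟩
  · by_cases hu : η u ∈ A
    · rw [h.b1 u hu]; omega
    · rw [h.b0 u hu]; omega
  · by_cases h0 : f.g e x = 0
    · omega
    · obtain ⟨i, j, -, -, h3⟩ := h.c2 e x hx h0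
      exact (h3.lt h.nm hq).2

theorem cmpS_init {occ : ℕ → Option V} (hocc : ∀ s, occ s = none)
    {D : (ℕ → Option V) → V → V → Prop} {f : DPState k l} (hb : ∀ u, f.b u = 0)
    (hg : ∀ e, ∀ x ≤ P, f.g e x = 0) : CmpS P q η Q m occ ∅ D f :=
  ⟨_, Naming.empty P q hocc, fun _ hu => absurd hu (Set.notMem_empty _), fun u _ => hb u,
    fun _ _ _ h => absurd h.mem (Set.notMem_empty _), fun e x hx h0 => absurd (hg e x hx) h0⟩

/-- By disjointness and injectivity, at most one position of one path runs along the offered arc. If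
there is one, the piece ending there and the piece beginning at the next position merge and all
others stay; otherwise the state is kept. -/
theorem CmpS.arc {occ : ℕ → Option V} {A : Set V} {D D' : (ℕ → Option V) → V → V → Prop}
    {f : DPState k l} (h : CmpS P q η Q m occ A D f) (hQ : PathSys H T rootH rootT η Q m)
    {en : Prop} {x y : ℕ} (hx : x < P)
    (hDA : ∀ ρ, Naming P q occ A ρ → ∀ a b, D ρ a b → a ∈ A ∧ b ∈ A)
    (hD : ∀ ρ a b, D ρ a b → D' ρ a b)
    (hen : ∀ ρ a b, Naming P q occ A ρ → T.Adj a b → D' ρ a b → ¬ D ρ a b →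
      en ∧ occ x = some a ∧ ρ y = some b) :
    ∃ f', ArcR P en x y f f' ∧ CmpS P q η Q m occ A D' f' := by
  classical
  obtain ⟨ρ, h⟩ := h
  by_cases hnew : ∃ e, ∃ j < m e, D' ρ (Q e j) (Q e (j + 1)) ∧ ¬ D ρ (Q e j) (Q e (j + 1))
  · obtain ⟨e, j0, hj0, hd', hd⟩ := hnew
    obtain ⟨hE, hX, hY⟩ := hen ρ _ _ h.nm (hQ.adj e j0 hj0) hd' hd
    have hXA : Q e j0 ∈ A := h.nm.mem (x + 2) _ (by rw [h.nm.slot x hx, hX])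
    have hYA : Q e (j0 + 1) ∈ A := h.nm.mem y _ hY
    -- Every other position has the same status for `D` and `D'`, since a second use of the arc from
    -- `X` to `Y` would be at the same position of the same path.
    have hold : ∀ e', ∀ j < m e', ¬ (e' = e ∧ j = j0) →
        (D' ρ (Q e' j) (Q e' (j + 1)) ↔ D ρ (Q e' j) (Q e' (j + 1))) := by
      refine fun e' j hj hne => ⟨fun h1 => ?_, hD ρ _ _⟩
      by_contra h2
      obtain ⟨-, hX', hY'⟩ := hen ρ _ _ h.nm (hQ.adj e' j hj) h1 h2
      have e1 := Option.some.inj (hX'.symm.trans hX)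
      have e2 := Option.some.inj (hY'.symm.trans hY)
      obtain rfl := hQ.disj e' e j hj j0 hj0 e1 e2
      exact hne ⟨rfl, hQ.inj0 _ j hj j0 hj0 e1⟩
    obtain ⟨i0, hs0⟩ := exists_seg_left (Q := Q) (m := m) (e := e) (hDA ρ h.nm) hj0.le hXA
      (fun _ => hd)
    obtain ⟨j1, hs1⟩ := exists_seg_right (Q := Q) (m := m) (D := D ρ) (e := e) (i := j0 + 1) hj0
      hYA (fun t ht => by obtain rfl : t = j0 := by omega
                          exact hd)
    obtain ⟨x', b, hx', hb, hfb⟩ := h.c1 e i0 j0 hs0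
    obtain ⟨z, y', hz, hy', hfz⟩ := h.c1 e (j0 + 1) j1 hs1
    have hxx : EndAt P occ Q m e j0 x := .inr ⟨hj0, hx, hX⟩
    obtain rfl := EndAt.right_unique h.nm hx' hxx
    have hj1 := hs1.le
    -- The two pieces differ: one ends at position `j0`, the other at `j1 ≥ j0 + 1`, and an end
    -- determines its position.
    have hzx : z ≠ x' := by
      rintro rfl
      have := hz.left_unique hQ hxx
      omega
    have hyy : y' = y := by
      rcases hy' with ⟨h1, -⟩ | ⟨-, h1⟩
      · omega
      · exact h.nm.inj _ _ _ h1 hY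
    have hb0 : 0 < b := by
      rcases hb with ⟨-, h1⟩ | ⟨-, h1⟩
      · omega
      · have := h.nm.lb _ _ h1
        omega
    set g' : Fin l → ℕ → ℕ := fun e' x1 => if e' = e ∧ x1 = z then b
      else if e' = e ∧ x1 = x' then 0 else f.g e' x1 with hg'
    have hgz : g' e z = b := by simp [hg']
    have hgx : g' e x' = 0 := by simp [hg', hzx.symm]
    have hgo : ∀ e' x1, ¬ (e' = e ∧ x1 = z) → ¬ (e' = e ∧ x1 = x') → g' e' x1 = f.g e' x1 := by
      intro e' x1 h1 h2
      simp [hg', h1, h2]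
    have sJ : Seg A (D' ρ) Q m e i0 j1 := by
      have h0 := hs0.le
      refine ⟨by omega, hs1.le_m, hs0.mem, ?_, ?_, ?_⟩
      · intro t ht ht'
        rcases lt_trichotomy t j0 with h1 | rfl | h1
        · exact hD _ _ _ (hs0.mid t ht h1)
        · exact hd'
        · exact hD _ _ _ (hs1.mid t (by omega) ht')
      · intro t ht hdt
        exact hs0.left t ht ((hold e t (by omega) (by omega)).1 hdt)
      · intro hj hdt
        exact hs1.right hj ((hold e j1 hj (by omega)).1 hdt)
    refine ⟨⟨f.b, g'⟩, .inr ⟨hE, e, z, hz.le, hzx, hfz.trans hyy, by omega, fun _ => rfl,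
      hgz.trans hfb.symm, hgx, fun e' x1 _ => hgo e' x1⟩, ρ, h.nm, h.b1, h.b0, ?_, ?_⟩
    · intro e' i j hs
      by_cases he : e' = e
      · subst he
        -- A maximal piece across the new arc must be the merged one; all others were maximal
        -- before.
        by_cases hi : i ≤ j0 ∧ j0 < j
        · have hi0 : i = i0 := by
            rcases lt_trichotomy i i0 with h1 | h1 | h1
            · exfalso
              refine hs0.left (i0 - 1) (by omega) ?_
              have := hs0.le
              exact (hold e' (i0 - 1) (by omega) (by omega)).1 (hs.mid (i0 - 1) (by omega) (by omega))
            · exact h1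
            · exfalso
              exact hs.left (i - 1) (by omega) (hD _ _ _ (hs0.mid (i - 1) (by omega) (by omega)))
          subst hi0
          obtain rfl := hs.right_unique sJ
          exact ⟨z, b, hz, hb, hgz⟩
        · have hle := hs.le
          have hlm := hs.le_m
          have hjj : j ≠ j0 := by
            rintro rfl
            exact hs.right hj0 hd'
          have hij : i ≠ j0 + 1 := by
            rintro rfl
            exact hs.left j0 rfl hd'
          have hs' : Seg A (D ρ) Q m e' i j := by
            refine ⟨hle, hlm, hs.mem, ?_, ?_, ?_⟩
            · intro t ht ht'
              exact (hold e' t (by omega) (by omega)).1 (hs.mid t ht ht')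
            · exact fun t ht hdt => hs.left t ht (hD _ _ _ hdt)
            · exact fun hj hdt => hs.right hj (hD _ _ _ hdt)
          obtain ⟨x1, y1, h1, h2, h3⟩ := h.c1 e' i j hs'
          refine ⟨x1, y1, h1, h2, (hgo e' x1 ?_ ?_).trans h3⟩
          · rintro ⟨-, rfl⟩
            obtain rfl := h1.left_unique hQ hz
            exact hij (hs'.left_unique hs1)
          · rintro ⟨-, rfl⟩
            exact hjj (h1.left_unique hQ hxx)
      · obtain ⟨x1, y1, h1, h2, h3⟩ := h.c1 e' i j
          (hs.congr fun j hj => hold e' j hj fun h => he h.1)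
        exact ⟨x1, y1, h1, h2, (hgo e' x1 (fun h => he h.1) (fun h => he h.1)).trans h3⟩
    · intro e' x1 hx1 h0
      change g' e' x1 ≠ 0 at h0
      change ∃ i j, Seg A (D' ρ) Q m e' i j ∧ EndAt P occ Q m e' j x1 ∧ BegAt ρ Q e' i (g' e' x1)
      by_cases h1 : e' = e ∧ x1 = z
      · obtain ⟨rfl, rfl⟩ := h1
        exact ⟨i0, j1, sJ, hz, by rw [hgz]; exact hb⟩
      · by_cases h2 : e' = e ∧ x1 = x'
        · obtain ⟨rfl, rfl⟩ := h2
          exact absurd hgx h0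
        · rw [hgo e' x1 h1 h2] at h0 ⊢
          obtain ⟨i, j, hs, h3, h4⟩ := h.c2 e' x1 hx1 h0
          refine ⟨i, j, ?_, h3, h4⟩
          by_cases he : e' = e
          · subst he
            have hjj : j ≠ j0 := by
              rintro rfl
              exact h2 ⟨rfl, EndAt.right_unique h.nm h3 hxx⟩
            have hij : i ≠ j0 + 1 := by
              rintro rfl
              obtain rfl := hs.right_unique hs1
              exact h1 ⟨rfl, EndAt.right_unique h.nm h3 hz⟩
            have hle := hs.le
            refine ⟨hle, hs.le_m, hs.mem, fun t ht ht' => hD _ _ _ (hs.mid t ht ht'), ?_, ?_⟩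
            · intro t ht hdt
              have := hs.le_m
              exact hs.left t ht ((hold e' t (by omega) (by omega)).1 hdt)
            · intro hj hdt
              exact hs.right hj ((hold e' j hj (by omega)).1 hdt)
          · exact hs.congr fun j hj => (hold e' j hj fun h => he h.1).symm
  · refine ⟨f, .inl ⟨fun _ => rfl, fun _ _ _ => rfl⟩, ρ, h.congr (fun e j hj => ⟨hD _ _ _, fun h1 => ?_⟩)
      (fun _ => rfl) fun _ _ _ => rfl⟩
    by_contra h2
    exact hnew ⟨e, j, hj, h1, h2⟩

theorem CmpS.congr {occ : ℕ → Option V} {A : Set V} {D D' : (ℕ → Option V) → V → V → Prop}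
    {f : DPState k l} (h : CmpS P q η Q m occ A D f)
    (hD : ∀ ρ, CmpW P q η Q m occ A (D ρ) f ρ → ∀ e, ∀ j < m e,
      (D ρ (Q e j) (Q e (j + 1)) ↔ D' ρ (Q e j) (Q e (j + 1)))) :
    CmpS P q η Q m occ A D' f := by
  obtain ⟨ρ, h⟩ := h
  exact ⟨ρ, h.congr (hD ρ h) (fun _ => rfl) fun _ _ _ => rfl⟩

/-- Pigeonhole: the state has `l * (P + 1)` entries and there are more classes than that from `P +
2` on. This is what fixes the number of names. -/
theorem exists_unused (g : Fin l → ℕ → ℕ) (hq : P + 2 + (l * (P + 1) + 1) ≤ q) :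
    ∃ c, P + 2 ≤ c ∧ c < q ∧ ∀ e, ∀ x ≤ P, g e x ≠ c := by
  classical
  obtain ⟨c, hc, hc'⟩ := Finset.exists_mem_notMem_of_card_lt_card
    (s := (Finset.univ ×ˢ Finset.range (P + 1)).image fun z : Fin l × ℕ => g z.1 z.2)
    (t := Finset.Ico (P + 2) q) (by
      refine lt_of_le_of_lt Finset.card_image_le ?_
      simp only [Finset.card_product, Finset.card_univ, Fintype.card_fin, Finset.card_range,
        Nat.card_Ico]
      omega)
  rw [Finset.mem_Ico] at hc
  refine ⟨c, hc.1, hc.2, fun e x hx h => hc' ?_⟩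
  exact Finset.mem_image.2 ⟨(e, x), by simp; omega, h⟩

/-- The vertex may be forgotten only if no piece waits in its slot. That holds automatically for a
trace, because its out-neighbours all lie in `A` and the arcs inside `A` have been treated. -/
theorem CmpS.forget {occ : ℕ → Option V} {A : Set V} {f : DPState k l}
    (hQ : PathSys H T rootH rootT η Q m)
    (h : CmpS P q η Q m occ A (fun _ a b => a ∈ A ∧ b ∈ A) f) {s : ℕ} (hs : s < P)
    (hq : P + 2 + (l * (P + 1) + 1) ≤ q)
    (hcl : ∀ X v, occ s = some X → v ∉ A → ¬ T.Adj X v) :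
    ∃ f', ForgetR P q s f f' ∧
      CmpS P q η Q m (Function.update occ s none) A (fun _ a b => a ∈ A ∧ b ∈ A) f' := by
  obtain ⟨ρ, h⟩ := h
  obtain ⟨c, hc1, hc2, hc⟩ := exists_unused f.g hq
  -- A piece ending in slot `s` before the end of its path continues along some arc. A head inside
  -- `A` contradicts maximality, a head outside contradicts `hcl`.
  have h0 : ∀ e, f.g e s = 0 := by
    intro e
    by_contra h0
    obtain ⟨i, j, h1, h2, -⟩ := h.c2 e s hs.le h0
    rcases h2 with ⟨-, h2⟩ | ⟨h2, h3, h4⟩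
    · omega
    · have hj : Q e j ∈ A := h.nm.mem (s + 2) _ (by rw [h.nm.slot s hs, h4])
      by_cases h5 : Q e (j + 1) ∈ A
      · exact h1.right h2 ⟨hj, h5⟩
      · exact hcl _ _ h4 h5 (hQ.adj e j h2)
  refine ⟨⟨f.b, fun e x => if f.g e x = s + 2 then c else f.g e x⟩,
    ⟨c, hc1, hc2, h0, fun _ => rfl, fun e x hx => ⟨hc e x hx, rfl⟩⟩, _,
    h.nm.forget P q hs hc1 hc2, h.b1, h.b0, ?_, ?_⟩
  · intro e i j hsg
    obtain ⟨x, y, h1, h2, h3⟩ := h.c1 e i j hsg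
    have hy : 0 < y := (h2.lt h.nm (by omega)).1
    have hxs : x ≠ s := by
      rintro rfl
      rw [h0] at h3
      omega
    refine ⟨x, _, ?_, ?_, rfl⟩
    · rcases h1 with h1 | ⟨h4, h5, h6⟩
      · exact .inl h1
      · exact .inr ⟨h4, h5, by rw [Function.update_of_ne hxs]; exact h6⟩
    · have hyc : y ≠ c := by rw [← h3]; exact hc e x h1.le
      simp only [h3]
      rcases h2 with ⟨h2, h4⟩ | ⟨h2, h4⟩
      · exact .inl ⟨h2, by rw [if_neg (by omega)]; exact h4⟩
      · refine .inr ⟨h2, ?_⟩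
        split_ifs with h5
        · rw [Function.update_self, ← h5]; exact h4
        · rw [Function.update_of_ne hyc, Function.update_of_ne h5]; exact h4
  · intro e x hx hne
    simp only [ne_eq] at hne
    have hne' : f.g e x ≠ 0 := by
      split_ifs at hne with h5
      · omega
      · exact hne
    obtain ⟨i, j, h1, h2, h3⟩ := h.c2 e x hx hne'
    have hxs : x ≠ s := by
      rintro rfl
      exact hne' (h0 e)
    refine ⟨i, j, h1, ?_, ?_⟩
    · rcases h2 with h2 | ⟨h4, h5, h6⟩
      · exact .inl h2
      · exact .inr ⟨h4, h5, by rw [Function.update_of_ne hxs]; exact h6⟩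
    · simp only
      rcases h3 with ⟨h3, h4⟩ | ⟨h3, h4⟩
      · exact .inl ⟨h3, by rw [if_neg (by omega)]; exact h4⟩
      · refine .inr ⟨h3, ?_⟩
        split_ifs with h5
        · rw [Function.update_self, ← h5]; exact h4
        · rw [Function.update_of_ne (hc e x hx), Function.update_of_ne h5]; exact h4

/-- At this moment no arc at `v` counts as treated. The new pieces are therefore exactly the single
positions where a path visits `v`, and each of them is named according to whether it is the start,
the end or an inner position. -/
theorem CmpS.intro {occ : ℕ → Option V} {A : Set V} {f : DPState k l}
    (hQ : PathSys H T rootH rootT η Q m)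
    (h : CmpS P q η Q m occ A (fun _ a b => a ∈ A ∧ b ∈ A) f) {s : ℕ} {v : V}
    (hs : s < P) (hq : P + 2 ≤ q) (hv : v ∉ A) (hocc : occ s = none) :
    ∃ f', IntroR H rootH rootT P s v f f' ∧
      CmpS P q η Q m (Function.update occ s (some v)) (insert v A) (fun _ a b => a ∈ A ∧ b ∈ A)
        f' := by
  classical
  obtain ⟨ρ, h⟩ := h
  obtain ⟨u, hu⟩ : ∃ u : Option (Fin k), ∀ w, u = some w ↔ η w = v := by
    by_cases h1 : ∃ w, η w = v
    · obtain ⟨w, rfl⟩ := h1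
      refine ⟨some w, fun w' => ⟨fun h => ?_, fun h => ?_⟩⟩
      · rw [Option.some.inj h]
      · rw [hQ.inj h]
    · exact ⟨none, fun w => ⟨fun h => by simp at h, fun h => absurd ⟨w, h⟩ h1⟩⟩
  have hg0 : ∀ e, f.g e s = 0 := by
    intro e
    by_contra h0
    obtain ⟨i, j, -, h2, -⟩ := h.c2 e s hs.le h0
    rcases h2 with ⟨-, h2⟩ | ⟨-, -, h2⟩
    · omega
    · rw [hocc] at h2; simp at h2
  -- The visit to `v` before the last position is recorded in slot `s`, a visit at the last position
  -- under the terminal `P`; a loop at `v` has both.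
  set g' : Fin l → ℕ → ℕ := fun e x => if x = s then
      (if u = some (H.src e) then 1 else if ∃ j, 0 < j ∧ j < m e ∧ Q e j = v then s + 2 else 0)
    else if x = P ∧ u = some (H.tgt e) then s + 2 else f.g e x with hg'
  have hsrc : ∀ e, u = some (H.src e) ↔ Q e 0 = v := fun e => by rw [hu, hQ.start]
  have htgt : ∀ e, u = some (H.tgt e) ↔ Q e (m e) = v := fun e => by rw [hu, hQ.finish]
  have hseg : ∀ e i j, Seg (insert v A) (fun a b => a ∈ A ∧ b ∈ A) Q m e i j ↔
      Seg A (fun a b => a ∈ A ∧ b ∈ A) Q m e i j ∨ (i = j ∧ j ≤ m e ∧ Q e j = v) := by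
    refine fun e i j => ⟨fun h1 => ?_, ?_⟩
    · by_cases h2 : Q e i = v
      · refine .inr ?_
        have hij : i = j := by
          by_contra hne
          exact hv (h2 ▸ (h1.mid i le_rfl (by have := h1.le; omega)).1)
        exact ⟨hij, h1.le_m, hij ▸ h2⟩
      · exact .inl ⟨h1.le, h1.le_m, h1.mem.resolve_left h2, h1.mid, h1.left, h1.right⟩
    · rintro (h1 | ⟨rfl, h1, h2⟩)
      · exact ⟨h1.le, h1.le_m, Set.mem_insert_of_mem _ h1.mem, h1.mid, h1.left, h1.right⟩
      · refine ⟨le_rfl, h1, by rw [h2]; exact Set.mem_insert _ _, fun t _ _ => by omega, ?_, ?_⟩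
        · rintro t rfl hd
          exact hv (h2 ▸ hd.2)
        · intro _ hd
          exact hv (h2 ▸ hd.1)
  have hend : ∀ e i j x, Seg A (fun a b => a ∈ A ∧ b ∈ A) Q m e i j → EndAt P occ Q m e j x →
      EndAt P (Function.update occ s (some v)) Q m e j x ∧ x ≠ s := by
    rintro e i j x h1 (⟨h2, h3⟩ | ⟨h2, h3, h4⟩)
    · exact ⟨.inl ⟨h2, h3⟩, by omega⟩
    · have hxs : x ≠ s := by
        rintro rfl
        rw [hocc] at h4
        simp at h4
      exact ⟨.inr ⟨h2, h3, by rw [Function.update_of_ne hxs]; exact h4⟩, hxs⟩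
  have hbeg : ∀ e i y, BegAt ρ Q e i y → BegAt (Function.update ρ (s + 2) (some v)) Q e i y := by
    rintro e i y (h1 | ⟨h1, h2⟩)
    · exact .inl h1
    · refine .inr ⟨h1, ?_⟩
      rw [Function.update_of_ne, h2]
      rintro rfl
      rw [h.nm.slot s hs, hocc] at h2
      simp at h2
  have hnotA : ∀ e j i, Seg A (fun a b => a ∈ A ∧ b ∈ A) Q m e i j → Q e j ∈ A := by
    intro e j i h1
    rcases eq_or_lt_of_le h1.le with rfl | h2
    · exact h1.mem
    · have := (h1.mid (j - 1) (by omega) (by omega)).2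
      rwa [show j - 1 + 1 = j by omega] at this
  have hsame : ∀ e i j x, Seg A (fun a b => a ∈ A ∧ b ∈ A) Q m e i j → EndAt P occ Q m e j x →
      g' e x = f.g e x := by
    intro e i j x h1 h2
    have h3 := (hend e i j x h1 h2).2
    simp only [hg', h3, if_false]
    rw [if_neg]
    rintro ⟨rfl, h4⟩
    rcases h2 with ⟨rfl, -⟩ | ⟨-, h2, -⟩
    · exact hv (((htgt e).1 h4) ▸ hnotA e _ i h1)
    · omega
  refine ⟨⟨fun w => if u = some w then 1 else f.b w, g'⟩, ⟨u, ?_, ?_, ?_, ?_⟩, _,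
    h.nm.intro P q hs hq hv, ?_, ?_, ?_, ?_⟩
  · intro i
    rw [hu, hQ.root]
  · intro w hw
    refine ⟨h.b0 w (by rw [(hu w).1 hw]; exact hv), if_pos hw⟩
  · exact fun w hw => if_neg hw
  · intro e x hx
    by_cases hxs : x = s
    · by_cases h1 : u = some (H.src e)
      · exact .inl ⟨hxs, h1, by simp [hg', hxs, h1]⟩
      · refine .inr (.inl ⟨hxs, h1, ?_⟩)
        subst hxs
        simp only [hg', h1, if_false, if_true, hg0]
        split_ifs <;> simp
    · by_cases h1 : x = P ∧ u = some (H.tgt e)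
      · refine .inr (.inr (.inl ⟨hxs, h1.1, h1.2, ?_⟩))
        simp only [hg', if_neg hxs, if_pos h1]
      · refine .inr (.inr (.inr ⟨hxs, h1, ?_⟩))
        simp only [hg', if_neg hxs, if_neg h1]
  · intro w hw
    by_cases h1 : u = some w
    · exact if_pos h1
    · refine (if_neg h1).trans (h.b1 w (hw.resolve_left fun h2 => h1 ((hu w).2 h2)))
  · intro w hw
    rw [Set.mem_insert_iff, not_or] at hw
    exact (if_neg fun h1 => hw.1 ((hu w).1 h1)).trans (h.b0 w hw.2)
  · intro e i j hsg
    rcases (hseg e i j).1 hsg with h1 | ⟨rfl, h1, h2⟩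
    · obtain ⟨x, y, h3, h4, h5⟩ := h.c1 e i j h1
      exact ⟨x, y, (hend e i j x h1 h3).1, hbeg e i y h4, (hsame e i j x h1 h3).trans h5⟩
    · rcases eq_or_lt_of_le h1 with h3 | h3
      · refine ⟨P, s + 2, .inl ⟨h3, rfl⟩, .inr ⟨by have := hQ.pos e; omega, by simp [h2]⟩, ?_⟩
        have h4 := (htgt e).2 (h3 ▸ h2)
        simp only [hg', if_neg hs.ne', h4, and_self, if_true]
      · refine ⟨s, g' e s, .inr ⟨h3, hs, by simp [h2]⟩, ?_, rfl⟩
        rcases Nat.eq_zero_or_pos i with rfl | h4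
        · refine .inl ⟨rfl, ?_⟩
          simp only [hg', if_true, (hsrc e).2 h2]
        · refine .inr ⟨h4, ?_⟩
          -- If `v` were also the start of the path, positions `0` and `i` would coincide although
          -- both precede the last one.
          have h5 : ¬ u = some (H.src e) := by
            rw [hsrc]
            intro h5
            have := hQ.inj0 e 0 (by omega) i h3 (h5.trans h2.symm)
            omega
          have h6 : ∃ j, 0 < j ∧ j < m e ∧ Q e j = v := ⟨i, h4, h3, h2⟩
          simp only [hg', if_true, h5, if_false, if_pos h6, Function.update_self, h2]
  · intro e x hx h0
    change g' e x ≠ 0 at h0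
    change ∃ i j, Seg (insert v A) (fun a b => a ∈ A ∧ b ∈ A) Q m e i j ∧ EndAt P _ Q m e j x ∧
      BegAt _ Q e i (g' e x)
    have hm := hQ.pos e
    by_cases hxs : x = s
    · subst hxs
      by_cases h1 : u = some (H.src e)
      · refine ⟨0, 0, (hseg e 0 0).2 (.inr ⟨rfl, by omega, (hsrc e).1 h1⟩),
          .inr ⟨hm, hs, by simp [(hsrc e).1 h1]⟩, .inl ⟨rfl, by simp [hg', h1]⟩⟩
      · by_cases h2 : ∃ j, 0 < j ∧ j < m e ∧ Q e j = v
        · obtain ⟨j, h3, h4, h5⟩ := id h2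
          refine ⟨j, j, (hseg e j j).2 (.inr ⟨rfl, h4.le, h5⟩), .inr ⟨h4, hs, by simp [h5]⟩,
            .inr ⟨h3, ?_⟩⟩
          simp only [hg', if_true, if_neg h1, if_pos h2, Function.update_self, h5]
        · exact absurd (by simp only [hg', if_true, if_neg h1, if_neg h2]) h0
    · by_cases h1 : x = P ∧ u = some (H.tgt e)
      · have h2 := (htgt e).1 h1.2
        refine ⟨m e, m e, (hseg e _ _).2 (.inr ⟨rfl, le_rfl, h2⟩), .inl ⟨rfl, h1.1⟩,
          .inr ⟨hm, ?_⟩⟩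
        simp only [hg', if_neg hxs, if_pos h1, Function.update_self, h2]
      · have h2 : g' e x = f.g e x := by simp only [hg', if_neg hxs, if_neg h1]
        rw [h2] at h0 ⊢
        obtain ⟨i, j, h3, h4, h5⟩ := h.c2 e x hx h0
        exact ⟨i, j, (hseg e i j).2 (.inl h3), (hend e i j x h3 h4).1, hbeg e i _ h5⟩

/-- Once all vertices are present and all arcs treated, every path is a single piece from position
`0` to the terminal, and that piece begins under the name `1`. -/
theorem CmpS.final {occ : ℕ → Option V} {f : DPState k l}
    (h : CmpS P q η Q m occ Set.univ (fun _ a b => a ∈ Set.univ ∧ b ∈ Set.univ) f) :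
    (∀ u, f.b u = 1) ∧ ∀ e, f.g e P = 1 := by
  obtain ⟨ρ, h⟩ := h
  refine ⟨fun u => h.b1 u (Set.mem_univ _), fun e => ?_⟩
  obtain ⟨x, y, h1, h2, h3⟩ := h.c1 e 0 (m e) ⟨Nat.zero_le _, le_rfl, Set.mem_univ _,
    fun _ _ _ => ⟨Set.mem_univ _, Set.mem_univ _⟩, fun t ht => by omega, fun h => by omega⟩
  rcases h1 with ⟨-, rfl⟩ | ⟨h1, -⟩
  · rcases h2 with ⟨-, rfl⟩ | ⟨h2, -⟩
    · exact h3
    · omega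
  · omega

end Cmp

/-! ### Numbers as states -/

section Digits

variable (k q : ℕ)

/-- The number of values of the digit `i`. -/
def digitBase (i : ℕ) : ℕ := if i < k then 2 else q

/-- The weight of the digit `i`. -/
def wt : ℕ → ℕ
  | 0 => 1
  | i + 1 => wt i * digitBase k q i

/-- The digit `i` of `S`. -/
def dig (S i : ℕ) : ℕ := S % wt k q (i + 1) / wt k q i

variable {k q}

theorem wt_pos (hq : 0 < q) : ∀ i, 0 < wt k q i
  | 0 => Nat.one_pos
  | i + 1 => Nat.mul_pos (wt_pos hq i) (by unfold digitBase; split_ifs <;> omega)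

theorem wt_dvd {i j : ℕ} (h : i ≤ j) : wt k q i ∣ wt k q j := by
  induction h with
  | refl => exact dvd_rfl
  | step _ ih => exact ih.trans (Dvd.intro _ rfl)

theorem dig_zero (i : ℕ) : dig k q 0 i = 0 := by simp [dig]

theorem exists_number (hq : 0 < q) (f : ℕ → ℕ) (hf : ∀ i, f i < digitBase k q i) (L : ℕ) :
    ∃ S < wt k q L, ∀ i < L, dig k q S i = f i := by
  induction L with
  | zero => exact ⟨0, wt_pos hq 0, fun i hi => by omega⟩
  | succ L ih =>
    obtain ⟨S, hS, h⟩ := ih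
    have hlt : S + wt k q L * f L < wt k q (L + 1) := by
      have := hf L
      rw [wt]
      nlinarith
    refine ⟨S + wt k q L * f L, hlt, fun i hi => ?_⟩
    rcases Nat.lt_succ_iff_lt_or_eq.1 hi with hi' | rfl
    · rw [← h i hi', dig, dig]
      obtain ⟨d, hd⟩ := wt_dvd (k := k) (q := q) (show i + 1 ≤ L from hi')
      conv_lhs => rw [hd, mul_assoc, Nat.add_mul_mod_self_left]
    · rw [dig, Nat.mod_eq_of_lt hlt, Nat.add_mul_div_left _ _ (wt_pos hq i), Nat.div_eq_of_lt hS,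
        zero_add]

end Digits

section Numbers

variable {V : Type*} {k l t : ℕ} (H : MultiDigraph (Fin k) (Fin l)) (T : Digraph V)
  (rootH : Fin t → Fin k) (rootT : Fin t → V) (P q : ℕ)

variable (k l) in
/-- The state encoded by a number. -/
def stOf (S : ℕ) : DPState k l where
  b u := dig k q S u
  g e x := dig k q S (k + e * (P + 1) + x)

@[simp] theorem stOf_b (S : ℕ) (u : Fin k) : (stOf k l P q S).b u = dig k q S u := rfl

@[simp] theorem stOf_g (S : ℕ) (e : Fin l) (x : ℕ) :
    (stOf k l P q S).g e x = dig k q S (k + e * (P + 1) + x) := rfl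

/-- Agreement of states on the relevant cells. -/
def DPState.Agree (f f' : DPState k l) : Prop :=
  (∀ u, f'.b u = f.b u) ∧ ∀ e, ∀ x ≤ P, f'.g e x = f.g e x

variable {P} in
theorem ix_lt {e : Fin l} {x : ℕ} (hx : x ≤ P) : k + e * (P + 1) + x < k + l * (P + 1) := by
  have := Nat.mul_le_mul_right (P + 1) e.2
  rw [Nat.succ_mul] at this
  omega

variable {P} in
theorem ix_div (e : ℕ) {x : ℕ} (hx : x ≤ P) : (k + e * (P + 1) + x - k) / (P + 1) = e := by
  rw [show k + e * (P + 1) + x - k = x + e * (P + 1) by omega, Nat.add_mul_div_right _ _ (by omega),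
    Nat.div_eq_of_lt (by omega), zero_add]

variable {P} in
theorem ix_mod (e : ℕ) {x : ℕ} (hx : x ≤ P) : (k + e * (P + 1) + x - k) % (P + 1) = x := by
  rw [show k + e * (P + 1) + x - k = x + e * (P + 1) by omega, Nat.add_mul_mod_self_right,
    Nat.mod_eq_of_lt (by omega)]

/-- The digits are the `k` flags followed by an `l × (P + 1)` matrix in row order; every conversion
between states and numbers goes through this splitting. -/
theorem forall_ix (p : ℕ → Prop) : (∀ i < k + l * (P + 1), p i) ↔
    (∀ u : Fin k, p u) ∧ ∀ e : Fin l, ∀ x ≤ P, p (k + e * (P + 1) + x) := by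
  refine ⟨fun h => ⟨fun u => h u (by have := u.2; omega), fun e x hx => h _ (ix_lt hx)⟩,
    fun h i hi => ?_⟩
  by_cases hk : i < k
  · exact h.1 ⟨i, hk⟩
  · have h1 : (i - k) / (P + 1) < l := by
      rw [Nat.div_lt_iff_lt_mul (by omega)]
      omega
    have h2 := Nat.mod_lt (i - k) (show 0 < P + 1 by omega)
    have h3 := Nat.div_add_mod' (i - k) (P + 1)
    have := h.2 ⟨(i - k) / (P + 1), h1⟩ ((i - k) % (P + 1)) (by omega)
    rwa [show k + (i - k) / (P + 1) * (P + 1) + (i - k) % (P + 1) = i by omega] at this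

variable {q} in
theorem exists_stOf (hq : 0 < q) (f : DPState k l) (hb : ∀ u, f.b u < 2)
    (hg : ∀ e, ∀ x ≤ P, f.g e x < q) :
    ∃ S < wt k q (k + l * (P + 1)), f.Agree P (stOf k l P q S) := by
  obtain ⟨S, hS, h⟩ := exists_number (k := k) hq (fun i => if h : i < k then f.b ⟨i, h⟩ else
    if h : (i - k) / (P + 1) < l then f.g ⟨_, h⟩ ((i - k) % (P + 1)) else 0) (by
      intro i
      have h2 := Nat.mod_lt (i - k) (show 0 < P + 1 by omega)
      simp only [digitBase]
      split_ifs
      · exact hb _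
      · exact hg _ _ (by omega)
      · exact hq) (k + l * (P + 1))
  rw [forall_ix] at h
  refine ⟨S, hS, fun u => ?_, fun e x hx => ?_⟩
  · simpa using h.1 u
  · have := h.2 e x hx
    simpa only [show ¬ k + e * (P + 1) + x < k by omega, dif_neg, not_false_eq_true, ix_div _ hx,
      ix_mod _ hx, e.2, dif_pos, stOf_g] using this

variable {H rootH rootT P q}

theorem IntroR.congr {s : ℕ} {v : V} {f f' f'' : DPState k l}
    (h : IntroR H rootH rootT P s v f f') (ha : f'.Agree P f'') :
    IntroR H rootH rootT P s v f f'' := by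
  obtain ⟨u, h1, h2, h3, h4⟩ := h
  refine ⟨u, h1, fun w hw => ?_, fun w hw => ?_, fun e x hx => ?_⟩
  · rw [ha.1]; exact h2 w hw
  · rw [ha.1]; exact h3 w hw
  · rw [ha.2 e x hx]; exact h4 e x hx

theorem ArcR.congr {en : Prop} {x y : ℕ} {f f' f'' : DPState k l} (hx : x ≤ P)
    (h : ArcR P en x y f f') (ha : f'.Agree P f'') : ArcR P en x y f f'' := by
  rcases h with ⟨h1, h2⟩ | ⟨h0, e, z, hz, h1, h2, h3, h4, h5, h6, h7⟩
  · refine .inl ⟨fun w => ?_, fun e x hx => ?_⟩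
    · rw [ha.1]; exact h1 w
    · rw [ha.2 e x hx]; exact h2 e x hx
  · refine .inr ⟨h0, e, z, hz, h1, h2, h3, fun w => ?_, ?_, ?_, fun e' x' hx' => ?_⟩
    · rw [ha.1]; exact h4 w
    · rw [ha.2 _ _ hz]; exact h5
    · rw [ha.2 _ _ hx]; exact h6
    · rw [ha.2 _ _ hx']; exact h7 e' x' hx'

theorem ForgetR.congr {s : ℕ} {f f' f'' : DPState k l}
    (h : ForgetR P q s f f') (ha : f'.Agree P f'') : ForgetR P q s f f'' := by
  obtain ⟨c, h1, h2, h3, h4, h5⟩ := h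
  refine ⟨c, h1, h2, h3, fun w => ?_, fun e x hx => ?_⟩
  · rw [ha.1]; exact h4 w
  · rw [ha.2 e x hx]; exact h5 e x hx

/-! ### Correct tables and their preservation. -/

variable (H rootH rootT P q)

/-- The set `X` of numbers is a correct table: all its members are realisable, and for every
immersion it has a member that describes the trace of the immersion. -/
structure Good (occ : ℕ → Option V) (A : Set V) (D : (ℕ → Option V) → V → V → Prop)
    (X : ℕ → Prop) : Prop where
  snd : ∀ S, X S → Snd H T rootH rootT P q occ A D (stOf k l P q S)
  cmp : ∀ η Q m, PathSys H T rootH rootT η Q m → ∃ S, X S ∧ CmpS P q η Q m occ A D (stOf k l P q S)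

variable {H T rootH rootT P q}

/-- Soundness follows a new member back to an old one; completeness moves the trace of each
immersion forward. The state so obtained has entries small enough to be a number (`CmpW.lt`), but
that number reproduces it only on the relevant cells, hence the hypothesis `hR`. -/
theorem Good.step {occ occ' : ℕ → Option V} {A A' : Set V}
    {D D' : (ℕ → Option V) → V → V → Prop} {X X' : ℕ → Prop} (hq : 2 ≤ q)
    (h : Good H T rootH rootT P q occ A D X) (R : DPState k l → DPState k l → Prop)
    (hX : ∀ S < wt k q (k + l * (P + 1)), X' S ↔
      ∃ S', X S' ∧ R (stOf k l P q S') (stOf k l P q S))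
    (hX' : ∀ S, X' S → S < wt k q (k + l * (P + 1)))
    (hR : ∀ f f' f'', R f f' → f'.Agree P f'' → R f f'')
    (hs : ∀ f f', Snd H T rootH rootT P q occ A D f → R f f' →
      Snd H T rootH rootT P q occ' A' D' f')
    (hc : ∀ η Q m, PathSys H T rootH rootT η Q m → ∀ f, CmpS P q η Q m occ A D f →
      ∃ f', R f f' ∧ CmpS P q η Q m occ' A' D' f') : Good H T rootH rootT P q occ' A' D' X' := by
  refine ⟨fun S hS => ?_, fun η Q m hp => ?_⟩
  · obtain ⟨S', hS', hr⟩ := (hX S (hX' S hS)).1 hS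
    exact hs _ _ (h.snd S' hS') hr
  · obtain ⟨S, hS, hcS⟩ := h.cmp η Q m hp
    obtain ⟨f', hr, ρ, hf'⟩ := hc η Q m hp _ hcS
    obtain ⟨hb, hg⟩ := hf'.lt hq
    obtain ⟨S', hS', ha⟩ := exists_stOf (P := P) (by omega) f' hb hg
    exact ⟨S', (hX S' hS').2 ⟨S, hS, hR _ _ _ hr ha⟩, ρ,
      hf'.congr (fun _ _ _ => Iff.rfl) ha.1 ha.2⟩

theorem Good.init [Nonempty V] {occ : ℕ → Option V} (hocc : ∀ s, occ s = none) {X : ℕ → Prop}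
    (hX : ∀ S, X S ↔ S = 0) :
    Good H T rootH rootT P q occ ∅ (fun _ a b => a ∈ (∅ : Set V) ∧ b ∈ (∅ : Set V)) X := by
  refine ⟨fun S hS => ?_, fun η Q m _ => ⟨0, (hX 0).2 rfl, ?_⟩⟩
  · rw [(hX S).1 hS]
    exact snd_init hocc (fun u => dig_zero _) fun e x _ => dig_zero _
  · exact cmpS_init hocc (fun u => dig_zero _) fun e x _ => dig_zero _

theorem Good.forget {occ : ℕ → Option V} {A : Set V} {X X' : ℕ → Prop} {s : ℕ}
    (h : Good H T rootH rootT P q occ A (fun _ a b => a ∈ A ∧ b ∈ A) X) (hs : s < P)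
    (hq : P + 2 + (l * (P + 1) + 1) ≤ q)
    (hcl : ∀ a v, occ s = some a → v ∉ A → ¬ T.Adj a v)
    (hX : ∀ S < wt k q (k + l * (P + 1)), X' S ↔
      ∃ S', X S' ∧ ForgetR P q s (stOf k l P q S') (stOf k l P q S))
    (hX' : ∀ S, X' S → S < wt k q (k + l * (P + 1))) :
    Good H T rootH rootT P q (Function.update occ s none) A (fun _ a b => a ∈ A ∧ b ∈ A) X' :=
  h.step (by omega) _ hX hX' (fun _ _ _ h1 h2 => h1.congr h2)
    (fun _ _ h1 h2 => Snd.forget (D := fun a b => a ∈ A ∧ b ∈ A) h1 hs h2)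
    fun _ _ _ hp _ h1 => h1.forget hp hs hq hcl

/-- The arcs treated after the first `i` slots and the first `o` names, when `v` is introduced. -/
def phaseD (A : Set V) (v : V) (occ : ℕ → Option V) (i o : ℕ) (ρ : ℕ → Option V) (a b : V) : Prop :=
  (a ∈ A ∧ b ∈ A) ∨ (b = v ∧ ∃ x < i, occ x = some a) ∨ (a = v ∧ ∃ y < o, ρ y = some b)

/-- No slot precedes `0`, and no vertex has a name below `2`. So the first phase treats no arc
beyond those inside `A`, and the statement can serve as the start of the loop over arcs. -/
theorem Good.intro {occ : ℕ → Option V} {A : Set V} {X X' : ℕ → Prop} {s : ℕ} {v : V}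
    (h : Good H T rootH rootT P q occ A (fun _ a b => a ∈ A ∧ b ∈ A) X) (hs : s < P)
    (hq : P + 2 ≤ q) (hv : v ∉ A) (hocc : occ s = none)
    (hX : ∀ S < wt k q (k + l * (P + 1)), X' S ↔
      ∃ S', X S' ∧ IntroR H rootH rootT P s v (stOf k l P q S') (stOf k l P q S))
    (hX' : ∀ S, X' S → S < wt k q (k + l * (P + 1))) :
    Good H T rootH rootT P q (Function.update occ s (some v)) (insert v A)
      (phaseD A v (Function.update occ s (some v)) 0 2) X' := by
  have h1 := h.step (by omega) _ hX hX' (fun _ _ _ h1 h2 => h1.congr h2)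
    (fun _ _ h1 h2 => Snd.intro (D := fun a b => a ∈ A ∧ b ∈ A) h1 hs hq hv hocc h2)
    fun _ _ _ hp _ h1 => h1.intro hp hs hq hv hocc
  refine ⟨fun S hS => (h1.snd S hS).mono fun ρ a b _ hD => .inl hD, fun η Q m hp => ?_⟩
  obtain ⟨S, hS, hc⟩ := h1.cmp η Q m hp
  refine ⟨S, hS, hc.congr fun ρ hw e j _ => ⟨.inl, ?_⟩⟩
  rintro (h2 | ⟨-, x, hx, -⟩ | ⟨-, y, hy, hy'⟩)
  · exact h2
  · omega
  · have := hw.nm.lb _ _ hy'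
    omega

theorem Good.arc {occ : ℕ → Option V} {A : Set V} {D D' : (ℕ → Option V) → V → V → Prop}
    {X X' : ℕ → Prop} {x y : ℕ} {en : Prop}
    (h : Good H T rootH rootT P q occ A D X) (hq : 2 ≤ q) (hx : x < P) (hy : 2 ≤ y)
    (hX : ∀ S < wt k q (k + l * (P + 1)), X' S ↔
      ∃ S', X S' ∧ ArcR P en x y (stOf k l P q S') (stOf k l P q S))
    (hX' : ∀ S, X' S → S < wt k q (k + l * (P + 1)))
    (hDA : ∀ ρ, Naming P q occ A ρ → ∀ a b, D ρ a b → a ∈ A ∧ b ∈ A)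
    (hD : ∀ ρ a b, D ρ a b → D' ρ a b)
    (hen : en → ∀ ρ X Y, Naming P q occ A ρ → occ x = some X → ρ y = some Y →
      T.Adj X Y ∧ ¬ D ρ X Y ∧ D' ρ X Y)
    (hen' : ∀ ρ a b, Naming P q occ A ρ → T.Adj a b → D' ρ a b → ¬ D ρ a b →
      en ∧ occ x = some a ∧ ρ y = some b) : Good H T rootH rootT P q occ A D' X' :=
  h.step hq _ hX hX' (fun _ _ _ h1 h2 => h1.congr hx.le h2)
    (fun _ _ h1 h2 => h1.arc hx hy h2 hD hen)
    fun _ _ _ hp _ h1 => h1.arc hp hx hDA hD hen'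

theorem phaseD_mem {occ : ℕ → Option V} {A : Set V} {v : V} {i o : ℕ} (hi : i ≤ P)
    {ρ : ℕ → Option V} (h : Naming P q occ (insert v A) ρ) {a b : V}
    (hD : phaseD A v occ i o ρ a b) : a ∈ insert v A ∧ b ∈ insert v A := by
  rcases hD with ⟨h1, h2⟩ | ⟨rfl, x, hx, hx'⟩ | ⟨rfl, y, -, hy⟩
  · exact ⟨Set.mem_insert_of_mem _ h1, Set.mem_insert_of_mem _ h2⟩
  · exact ⟨h.mem (x + 2) _ (by rw [h.slot x (by omega), hx']), Set.mem_insert _ _⟩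
  · exact ⟨Set.mem_insert _ _, h.mem y _ hy⟩

theorem Good.arc_in {occ : ℕ → Option V} {A : Set V} {X X' : ℕ → Prop} {s x o : ℕ} {v : V}
    {en : Prop} (hirr : ∀ a, ¬ T.Adj a a)
    (h : Good H T rootH rootT P q occ (insert v A) (phaseD A v occ x o) X) (hs : s < P)
    (hx : x < P) (hq : 2 ≤ q) (hv : v ∉ A) (hocc : occ s = some v)
    (hX : ∀ S < wt k q (k + l * (P + 1)), X' S ↔
      ∃ S', X S' ∧ ArcR P en x (s + 2) (stOf k l P q S') (stOf k l P q S))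
    (hX' : ∀ S, X' S → S < wt k q (k + l * (P + 1)))
    (hen : en ↔ ∃ a, occ x = some a ∧ T.Adj a v) :
    Good H T rootH rootT P q occ (insert v A) (phaseD A v occ (x + 1) o) X' := by
  refine h.arc hq hx (by omega) hX hX' (fun ρ hn a b => phaseD_mem hx.le hn) ?_ ?_ ?_
  · rintro ρ a b (h1 | ⟨h1, x', h2, h3⟩ | h1)
    · exact .inl h1
    · exact .inr (.inl ⟨h1, x', by omega, h3⟩)
    · exact .inr (.inr h1)
  · intro hE ρ a b hn ha hb
    obtain ⟨a', ha', hT⟩ := hen.1 hE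
    obtain rfl := Option.some.inj (ha.symm.trans ha')
    rw [hn.slot s hs, hocc] at hb
    obtain rfl := Option.some.inj hb
    refine ⟨hT, ?_, .inr (.inl ⟨rfl, x, by omega, ha⟩)⟩
    rintro (⟨-, h1⟩ | ⟨-, x', h2, h3⟩ | ⟨rfl, -⟩)
    · exact hv h1
    · have := hn.occ_inj P q hx (by omega) ha h3
      omega
    · exact hirr _ hT
  · rintro ρ a b hn hT (h1 | ⟨rfl, x', h2, h3⟩ | h1) hnD
    · exact absurd (.inl h1) hnD
    · by_cases hxx : x' = x
      · subst hxx
        exact ⟨hen.2 ⟨a, h3, hT⟩, h3, by rw [hn.slot s hs, hocc]⟩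
      · exact absurd (.inr (.inl ⟨rfl, x', by omega, h3⟩)) hnD
    · exact absurd (.inr (.inr h1)) hnD

/-- The program does not know which vertex an anonymous name `y` denotes, or whether it denotes any.
Accordingly `en` only has to be right for each vertex that some admissible naming assigns to `y`. -/
theorem Good.arc_out {occ : ℕ → Option V} {A : Set V} {X X' : ℕ → Prop} {s i y : ℕ} {v : V}
    {en : Prop} (hirr : ∀ a, ¬ T.Adj a a)
    (h : Good H T rootH rootT P q occ (insert v A) (phaseD A v occ i y) X) (hs : s < P)
    (hi : i ≤ P) (hy : 2 ≤ y) (hq : 2 ≤ q) (hv : v ∉ A) (hocc : occ s = some v)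
    (hX : ∀ S < wt k q (k + l * (P + 1)), X' S ↔
      ∃ S', X S' ∧ ArcR P en s y (stOf k l P q S') (stOf k l P q S))
    (hX' : ∀ S, X' S → S < wt k q (k + l * (P + 1)))
    (hen : ∀ ρ b, Naming P q occ (insert v A) ρ → ρ y = some b → (en ↔ T.Adj v b)) :
    Good H T rootH rootT P q occ (insert v A) (phaseD A v occ i (y + 1)) X' := by
  refine h.arc hq hs hy hX hX' (fun ρ hn a b => phaseD_mem hi hn) ?_ ?_ ?_
  · rintro ρ a b (h1 | h1 | ⟨h1, y', h2, h3⟩)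
    · exact .inl h1
    · exact .inr (.inl h1)
    · exact .inr (.inr ⟨h1, y', by omega, h3⟩)
  · intro hE ρ a b hn ha hb
    obtain rfl := Option.some.inj (ha.symm.trans hocc)
    have hT := (hen ρ b hn hb).1 hE
    refine ⟨hT, ?_, .inr (.inr ⟨rfl, y, by omega, hb⟩)⟩
    rintro (⟨h1, -⟩ | ⟨rfl, -⟩ | ⟨-, y', h2, h3⟩)
    · exact hv h1
    · exact hirr _ hT
    · have := hn.inj _ _ _ hb h3
      omega
  · rintro ρ a b hn hT (h1 | h1 | ⟨rfl, y', h2, h3⟩) hnD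
    · exact absurd (.inl h1) hnD
    · exact absurd (.inr (.inl h1)) hnD
    · by_cases hyy : y' = y
      · subst hyy
        exact ⟨(hen ρ b hn h3).2 hT, hocc, h3⟩
      · exact absurd (.inr (.inr ⟨rfl, y', by omega, h3⟩)) hnD

/-- The phases treat arcs into `v` from slots and arcs from `v` to named vertices. Arcs into `v`
from other vertices of `A` do not exist, and an arc from `v` to a vertex without a name cannot occur
in a path that has a trace in the table. -/
theorem Good.finish {occ : ℕ → Option V} {A : Set V} {X : ℕ → Prop} {v : V}
    (h : Good H T rootH rootT P q occ (insert v A) (phaseD A v occ P q) X)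
    (hcl : ∀ a ∈ A, (∀ x < P, occ x ≠ some a) → ¬ T.Adj a v) :
    Good H T rootH rootT P q occ (insert v A) (fun _ a b => a ∈ insert v A ∧ b ∈ insert v A) X := by
  refine ⟨fun S hS => (h.snd S hS).mono fun ρ a b hn hD => phaseD_mem le_rfl hn hD,
    fun η Q m hp => ?_⟩
  obtain ⟨S, hS, hc⟩ := h.cmp η Q m hp
  refine ⟨S, hS, hc.congr fun ρ hw e j hj => ⟨phaseD_mem le_rfl hw.nm, ?_⟩⟩
  rintro ⟨h1, h2⟩
  have hT := hp.adj e j hj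
  by_contra hD
  rcases h1 with h1 | h1
  -- If the arc from `v` were untreated, its head would begin a maximal piece at a positive
  -- position. By `c1` that beginning has a name below `q`, so the arc had been treated after all.
  · obtain ⟨j1, hs1⟩ := exists_seg_right (Q := Q) (m := m) (D := phaseD A v occ P q ρ) (e := e)
      (i := j + 1) hj h2 (fun t ht => by
        obtain rfl : t = j := by omega
        exact hD)
    obtain ⟨x, y, -, hy, -⟩ := hw.c1 e _ _ hs1
    rcases hy with ⟨hy, -⟩ | ⟨-, hy⟩
    · omega
    · exact hD (.inr (.inr ⟨h1, y, hw.nm.ub _ _ hy, hy⟩))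
  · rcases h2 with h2 | h2
    · by_cases h3 : ∃ x < P, occ x = some (Q e j)
      · exact hD (.inr (.inl ⟨h2, h3⟩))
      · rw [h2] at hT
        exact hcl _ h1 (fun x hx h4 => h3 ⟨x, hx, h4⟩) hT
    · exact hD (.inl ⟨h1, h2⟩)

theorem Good.immersible_iff {occ : ℕ → Option V} {X : ℕ → Prop}
    (h : Good H T rootH rootT P q occ Set.univ (fun _ a b => a ∈ Set.univ ∧ b ∈ Set.univ) X) :
    RootedImmersible H rootH T rootT ↔
      ∃ S, X S ∧ (∀ u, (stOf k l P q S).b u = 1) ∧ ∀ e, (stOf k l P q S).g e P = 1 := by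
  refine ⟨fun hI => ?_, fun ⟨S, hS, hb, hg⟩ => (h.snd S hS).immersible hb hg⟩
  obtain ⟨η, Q, m, hp⟩ := hI.exists_pathSys
  obtain ⟨S, hS, hc⟩ := h.cmp η Q m hp
  exact ⟨S, hS, hc.final⟩

/-! ### The transitions in terms of digits -/

variable (k l P q)

/-- Digit `i` of the transition `ForgetR` with the class `P + 2 + a`. -/
def TForget (s a S S' i : ℕ) : Prop :=
  i < k ∧ dig k q S' i = dig k q S i ∨ ¬ i < k ∧ (dig k q S i ≠ P + 2 + a ∧
    ((i - k) % (P + 1) = s → dig k q S i = 0)) ∧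
    (dig k q S i = s + 2 ∧ dig k q S' i = P + 2 + a ∨
      dig k q S i ≠ s + 2 ∧ dig k q S' i = dig k q S i)

/-- Digit `i` of the transition `ArcR` with the end `a`. -/
def TArc (en : Prop) (x y a S S' i : ℕ) : Prop :=
  a = l * (P + 1) ∧ dig k q S' i = dig k q S i ∨ ¬ a = l * (P + 1) ∧
    (((en ∧ dig k q S (k + a) = y) ∧ k + a ≠ k + a / (P + 1) * (P + 1) + x) ∧
      dig k q S (k + a / (P + 1) * (P + 1) + x) ≠ 0) ∧
    (i = k + a ∧ dig k q S' i = dig k q S (k + a / (P + 1) * (P + 1) + x) ∨ ¬ i = k + a ∧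
      (i = k + a / (P + 1) * (P + 1) + x ∧ dig k q S' i = 0 ∨
        ¬ i = k + a / (P + 1) * (P + 1) + x ∧ dig k q S' i = dig k q S i))

/-- Digit `i` of the transition `IntroR` with the vertex `a` of `H` (none if `a = k`). -/
def TIntro (src tgt : ℕ → ℕ) (ok : ℕ → Prop) (s a S S' i : ℕ) : Prop :=
  ok a ∧ (i < k ∧ (i = a ∧ dig k q S i = 0 ∧ dig k q S' i = 1 ∨
      ¬ i = a ∧ dig k q S' i = dig k q S i) ∨ ¬ i < k ∧
    ((i - k) % (P + 1) = s ∧ (src ((i - k) / (P + 1)) = a ∧ dig k q S' i = 1 ∨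
        ¬ src ((i - k) / (P + 1)) = a ∧ (dig k q S' i = dig k q S i ∨ dig k q S' i = s + 2)) ∨
      ¬ (i - k) % (P + 1) = s ∧
        (((i - k) % (P + 1) = P ∧ tgt ((i - k) / (P + 1)) = a) ∧ dig k q S' i = s + 2 ∨
          ¬ ((i - k) % (P + 1) = P ∧ tgt ((i - k) / (P + 1)) = a) ∧
            dig k q S' i = dig k q S i)))

/-- Digit `i` of the test for acceptance. -/
def TFin (_a S S' i : ℕ) : Prop :=
  dig k q S' i = 0 ∧ (i < k ∧ dig k q S i = 1 ∨
    ¬ i < k ∧ ((i - k) % (P + 1) = P → dig k q S i = 1))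

variable {k l P q}

theorem forgetR_iff {s S S' : ℕ} (hq : q = P + 3 + l * (P + 1)) (hs : s < P) :
    ForgetR P q s (stOf k l P q S) (stOf k l P q S') ↔
      ∃ a < l * (P + 1) + 1, ∀ i < k + l * (P + 1), TForget k P q s a S S' i := by
  constructor
  · rintro ⟨c, h1, h2, h3, h4, h5⟩
    refine ⟨c - (P + 2), by omega, (forall_ix P _).2 ⟨fun u => .inl ⟨u.2, h4 u⟩, fun e x hx =>
      .inr ⟨by omega, ?_⟩⟩⟩
    obtain ⟨h6, h7⟩ := h5 e x hx
    have h3 := h3 e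
    rw [ix_mod _ hx, show P + 2 + (c - (P + 2)) = c by omega]
    refine ⟨⟨h6, fun h => h ▸ h3⟩, ?_⟩
    split_ifs at h7 with h8
    · exact .inl ⟨h8, h7⟩
    · exact .inr ⟨h8, h7⟩
  · rintro ⟨a, ha, h⟩
    rw [forall_ix] at h
    have h2 : ∀ e : Fin l, ∀ x ≤ P, _ := fun e x hx =>
      (h.2 e x hx).resolve_left (fun h => absurd h.1 (by omega))
    refine ⟨P + 2 + a, by omega, by omega, fun e => ?_, fun u => ?_, fun e x hx => ?_⟩
    · have := (h2 e s hs.le).2.1.2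
      rw [ix_mod _ hs.le] at this
      exact this rfl
    · exact ((h.1 u).resolve_right fun h => h.1 u.2).2
    · obtain ⟨-, ⟨h3, -⟩, h4⟩ := h2 e x hx
      refine ⟨h3, ?_⟩
      rcases h4 with ⟨h4, h5⟩ | ⟨h4, h5⟩
      · exact h5.trans (if_pos h4).symm
      · exact h5.trans (if_neg h4).symm

theorem ix_inj {e e' : Fin l} {x x' : ℕ} (hx : x ≤ P) (hx' : x' ≤ P)
    (h : k + e * (P + 1) + x = k + e' * (P + 1) + x') : e = e' ∧ x = x' := by
  have h1 := ix_div (k := k) e hx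
  have h2 := ix_div (k := k) e' hx'
  have h3 := ix_mod (k := k) e hx
  have h4 := ix_mod (k := k) e' hx'
  rw [h] at h1 h3
  exact ⟨Fin.ext (h1.symm.trans h2), h3.symm.trans h4⟩

/-- The choice `a = e * (P + 1) + z` selects the edge and the end of the second piece; the extra
value `l * (P + 1)` means that the arc is not used. -/
theorem arcR_iff {en : Prop} {x y S S' : ℕ} (hk : 0 < k) (hx : x < P) :
    ArcR P en x y (stOf k l P q S) (stOf k l P q S') ↔
      ∃ a < l * (P + 1) + 1, ∀ i < k + l * (P + 1), TArc k l P q en x y a S S' i := by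
  constructor
  · rintro (⟨h1, h2⟩ | ⟨h0, e, z, hz, h1, h2, h3, h4, h5, h6, h7⟩)
    · exact ⟨l * (P + 1), by omega, (forall_ix P _).2
        ⟨fun u => .inl ⟨rfl, h1 u⟩, fun e x hx => .inl ⟨rfl, h2 e x hx⟩⟩⟩
    · have hlt := ix_lt (k := k) (e := e) hz
      have hd := ix_div (k := k) e hz
      rw [show k + e * (P + 1) + z - k = e * (P + 1) + z by omega] at hd
      refine ⟨e * (P + 1) + z, by omega, fun i hi => .inr ⟨by omega, ?_, ?_⟩⟩
      · rw [hd]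
        refine ⟨⟨⟨h0, ?_⟩, by omega⟩, h3⟩
        rw [← add_assoc]
        exact h2
      · rw [hd, ← add_assoc]
        revert i
        rw [forall_ix]
        refine ⟨fun u => .inr ⟨by have := u.2; omega, .inr ⟨by have := u.2; omega, h4 u⟩⟩,
          fun e' x' hx' => ?_⟩
        by_cases h8 : e' = e ∧ x' = z
        · obtain ⟨rfl, rfl⟩ := h8
          exact .inl ⟨rfl, h5⟩
        · refine .inr ⟨fun h => h8 (ix_inj hx' hz h), ?_⟩
          by_cases h9 : e' = e ∧ x' = x
          · obtain ⟨rfl, rfl⟩ := h9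
            exact .inl ⟨rfl, h6⟩
          · exact .inr ⟨fun h => h9 (ix_inj hx' hx.le h), h7 e' x' hx' h8 h9⟩
  · rintro ⟨a, ha, h⟩
    by_cases hal : a = l * (P + 1)
    · have h1 : ∀ i < k + l * (P + 1), _ := fun i hi =>
        ((h i hi).resolve_right fun h => h.1 hal).2
      rw [forall_ix] at h1
      exact .inl h1
    · have h1 : ∀ i < k + l * (P + 1), _ := fun i hi =>
        ((h i hi).resolve_left fun h => hal h.1).2
      -- The conditions that do not depend on the digit are tested at every digit. They are read off
      -- at digit `0`, which exists because `0 < k`.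
      obtain ⟨⟨⟨hE, h2⟩, h3⟩, h4⟩ := (h1 0 (by omega)).1
      have he : a / (P + 1) < l := by
        rw [Nat.div_lt_iff_lt_mul (by omega)]
        omega
      have hz := Nat.mod_lt a (show 0 < P + 1 by omega)
      have haz := Nat.div_add_mod' a (P + 1)
      have hka : k + a = k + a / (P + 1) * (P + 1) + a % (P + 1) := by omega
      have h5 : ∀ i < k + l * (P + 1), _ := fun i hi => (h1 i hi).2
      rw [hka] at h2 h3 h5
      rw [forall_ix] at h5
      set e : Fin l := ⟨a / (P + 1), he⟩
      refine .inr ⟨hE, e, a % (P + 1), by omega, by omega, h2, h4, fun u => ?_, ?_, ?_,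
        fun e' x' hx' h6 h7 => ?_⟩
      · have hu := u.2
        rcases h5.1 u with ⟨h6, -⟩ | ⟨-, ⟨h6, -⟩ | ⟨-, h6⟩⟩
        · omega
        · omega
        · exact h6
      · exact ((h5.2 e _ (by omega)).resolve_right fun h => h.1 rfl).2
      · rcases h5.2 e x hx.le with ⟨h6, -⟩ | ⟨-, ⟨-, h6⟩ | ⟨h6, -⟩⟩
        · exact absurd h6.symm h3
        · exact h6
        · exact absurd rfl h6
      · rcases h5.2 e' x' hx' with ⟨h8, -⟩ | ⟨-, ⟨h8, -⟩ | ⟨-, h8⟩⟩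
        · exact absurd (ix_inj hx' (by omega) (e' := e) h8) h6
        · exact absurd (ix_inj hx' hx.le (e' := e) h8) h7
        · exact h8

/-- The choice `a` is the vertex of `H` mapped to the new vertex, with `a = k` for none. For each
choice the clauses match digit by digit after `forall_ix`. -/
theorem introR_iff {s S S' : ℕ} {v : V} (hk : 0 < k) {src tgt : ℕ → ℕ}
    {ok : ℕ → Prop} (hsrc : ∀ e : Fin l, src e = H.src e) (htgt : ∀ e : Fin l, tgt e = H.tgt e)
    (hok : ∀ u : Fin k, ok u ↔ RootOk rootH rootT (some u) v)
    (hok' : ok k ↔ RootOk rootH rootT none v) :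
    IntroR H rootH rootT P s v (stOf k l P q S) (stOf k l P q S') ↔
      ∃ a < k + 1, ∀ i < k + l * (P + 1), TIntro k P q src tgt ok s a S S' i := by
  have key : ∀ (u : Option (Fin k)) (a : ℕ), (∀ w : Fin k, u = some w ↔ (w : ℕ) = a) →
      (ok a ↔ RootOk rootH rootT u v) →
      ((RootOk rootH rootT u v ∧ (∀ w : Fin k, u = some w → dig k q S w = 0 ∧ dig k q S' w = 1) ∧
    (∀ w : Fin k, u ≠ some w → dig k q S' w = dig k q S w) ∧ ∀ e : Fin l, ∀ x ≤ P,
      (x = s ∧ u = some (H.src e) ∧ dig k q S' (k + e * (P + 1) + x) = 1) ∨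
      (x = s ∧ u ≠ some (H.src e) ∧
        (dig k q S' (k + e * (P + 1) + x) = dig k q S (k + e * (P + 1) + x) ∨
          dig k q S' (k + e * (P + 1) + x) = s + 2)) ∨
      (x ≠ s ∧ x = P ∧ u = some (H.tgt e) ∧ dig k q S' (k + e * (P + 1) + x) = s + 2) ∨
      (x ≠ s ∧ ¬ (x = P ∧ u = some (H.tgt e)) ∧
        dig k q S' (k + e * (P + 1) + x) = dig k q S (k + e * (P + 1) + x))) ↔
      ∀ i < k + l * (P + 1), TIntro k P q src tgt ok s a S S' i) := by
    intro u a hu hoka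
    have h0 : (∀ i < k + l * (P + 1), TIntro k P q src tgt ok s a S S' i) ↔ ok a ∧
        ∀ i < k + l * (P + 1), TIntro k P q src tgt (fun _ => True) s a S S' i :=
      ⟨fun h => ⟨(h 0 (by omega)).1, fun i hi => ⟨trivial, (h i hi).2⟩⟩,
        fun h i hi => ⟨h.1, (h.2 i hi).2⟩⟩
    rw [h0, forall_ix, hoka]
    refine and_congr Iff.rfl ?_
    rw [← and_assoc]
    refine and_congr ?_ ?_
    · rw [← forall_and]
      refine forall_congr' fun w => ?_
      have := w.2
      simp only [TIntro, this, not_true, false_and, or_false, true_and, Ne, hu]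
      tauto
    · refine forall_congr' fun e => forall_congr' fun x => forall_congr' fun hx => ?_
      have h1 : ¬ (k + e * (P + 1) + x < k) := by omega
      simp only [TIntro, h1, not_false_eq_true, false_and, false_or, true_and, Ne, hu,
        ix_mod _ hx, ix_div _ hx, hsrc, htgt]
      generalize (x = s) = p1, (x = P) = p2, (↑(H.src e) = a) = p3, (↑(H.tgt e) = a) = p4
      by_cases p1 <;> by_cases p2 <;> by_cases p3 <;> by_cases p4 <;> simp [*]
  constructor
  · rintro ⟨u, h⟩
    rcases u with _ | u
    · exact ⟨k, by omega, (key none k (fun w => by have := w.2; simp; omega) hok').1 h⟩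
    · exact ⟨u, by omega, (key (some u) u (fun w => by simp [Fin.ext_iff, eq_comm]) (hok u)).1 h⟩
  · rintro ⟨a, ha, h⟩
    by_cases hak : a = k
    · subst hak
      exact ⟨none, (key none _ (fun w => by have := w.2; simp; omega) hok').2 h⟩
    · have ha' : a < k := by omega
      exact ⟨some ⟨a, ha'⟩, (key (some ⟨a, ha'⟩) a
        (fun w => by simp [Fin.ext_iff, eq_comm]) (hok ⟨a, ha'⟩)).2 h⟩

/-- Acceptance is phrased as one more table operation, whose new state must be `0`. Thus cell `0` of
the last table holds the answer and no separate search is needed. -/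
theorem tFin_iff {S : ℕ} : (∃ a < 1, ∀ i < k + l * (P + 1), TFin k P q a S 0 i) ↔
    (∀ u, (stOf k l P q S).b u = 1) ∧ ∀ e, (stOf k l P q S).g e P = 1 := by
  have : (∃ a < 1, ∀ i < k + l * (P + 1), TFin k P q a S 0 i) ↔
      ∀ i < k + l * (P + 1), TFin k P q 0 S 0 i :=
    ⟨fun ⟨a, _, h⟩ => h, fun h => ⟨0, by omega, h⟩⟩
  rw [this, forall_ix]
  refine and_congr (forall_congr' fun u => ?_) (forall_congr' fun e => ?_)
  · simp [TFin, dig_zero, u.2, stOf]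
  · constructor
    · intro h
      have := ((h P le_rfl).2.resolve_left fun h => absurd h.1 (by omega)).2
      exact this (ix_mod _ le_rfl)
    · intro h x hx
      refine ⟨dig_zero _, .inr ⟨by omega, fun h2 => ?_⟩⟩
      rw [ix_mod _ hx] at h2
      rw [h2]
      exact h

end Numbers

/-! ### The table operation of the program -/

/-- Agreement of the registers below `d`. -/
def Fr (d : ℕ) (σ τ : RamState) : Prop := ∀ y < d, τ.reg y = σ.reg y

theorem Fr.refl (d : ℕ) (σ : RamState) : Fr d σ σ := fun _ _ => rfl

theorem Fr.mono {d d' : ℕ} {σ τ : RamState} (h : Fr d σ τ) (hd : d' ≤ d) : Fr d' σ τ :=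
  fun y hy => h y (by omega)

theorem Fr.trans {d : ℕ} {σ τ υ : RamState} (h : Fr d σ τ) (h' : Fr d τ υ) : Fr d σ υ :=
  fun y hy => (h' y hy).trans (h y hy)

theorem Fr.setReg {d : ℕ} {σ τ : RamState} (h : Fr d σ τ) {x a : ℕ} (hx : d ≤ x) :
    Fr d σ (τ.setReg x a) := by
  intro y hy
  rw [RamState.setReg_reg, if_neg (by omega), h y hy]

theorem Fr.setMem {d : ℕ} {σ τ : RamState} (h : Fr d σ τ) {x a : ℕ} :
    Fr d σ (τ.setMem x a) := h

namespace Cmd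

/-- Requiring the invariant to ignore the two counter registers hides the counter updates from all
later verifications. -/
theorem wp_forr {K Z R : ℕ} {b : Bool} {x : ℕ} {e : Ex} {c : Cmd} {Q : RamState → Prop}
    {s : RamState} (N : ℕ) (hN : e.eval s = N) (hK : N < K) (hZ : N ≤ if b then R else Z)
    (Inv : ℕ → RamState → Prop)
    (hst : ∀ i τ τ', (∀ y, y ≠ x → y ≠ x + 1 → τ'.reg y = τ.reg y) → τ'.mem = τ.mem →
      Inv i τ → Inv i τ')
    (h0 : Inv 0 s)
    (hs : ∀ i < N, ∀ τ, Inv i τ → τ.reg x = i → τ.reg (x + 1) = N - i →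
      wp K Z R c (fun τ' => τ'.reg x = i ∧ τ'.reg (x + 1) = N - i ∧ Inv (i + 1) τ') τ)
    (hQ : ∀ τ, Inv N τ → Q τ) : wp K Z R (forr b x e c) Q s := by
  subst hN
  refine ⟨hK, hZ, Inv, hst 0 s _ (fun y h1 h2 => by simp [h1, h2]) rfl h0, fun i hi τ h1 h2 h3 => ?_,
    hQ⟩
  refine wp_mono (fun τ' h => ⟨h.1, h.2.1, ?_⟩) _ _ (hs i hi τ h1 h2 h3)
  exact hst _ τ' _ (fun y h1 h2 => by simp [h1, h2]) rfl h.2.2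

end Cmd

open Ex Cmd

notation "rK" => (1 : ℕ)
notation "rL" => (2 : ℕ)
notation "rT" => (3 : ℕ)
notation "rN" => (4 : ℕ)
notation "rR" => (5 : ℕ)
notation "rP" => (6 : ℕ)
notation "rRH" => (7 : ℕ)
notation "rRT" => (8 : ℕ)
notation "rAdj" => (9 : ℕ)
notation "rBag" => (10 : ℕ)
notation "aRH" => (11 : ℕ)
notation "aRT" => (12 : ℕ)
notation "aOcc" => (13 : ℕ)
notation "aInt" => (14 : ℕ)
notation "aWt" => (15 : ℕ)
notation "rLen" => (16 : ℕ)
notation "rQ" => (17 : ℕ)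
notation "rM" => (18 : ℕ)
notation "rTb" => (900 : ℕ)

/-- For all numbers `a < N`, all states `S` in the current table and all numbers `S'` such that `φ`
holds for all digits, put `S'` into the next table; then move on to the next table. -/
def genOp (φ N : Ex) : Cmd :=
  forr false 40 (N * (v rM * v rM)) (
    set 42 (v 40 / (v rM * v rM)) ;; set 43 ((v 40 / v rM).mod (v rM)) ;;
    set 44 ((v 40).mod (v rM)) ;; set 47 (1 - (1 - ld (v rTb + v 43))) ;;
    forr false 45 (v rLen) (ite φ skip (set 47 0)) ;;
    ite (v 47) (sto (v rTb + v rM + v 44) 1) skip) ;;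
  set rTb (v rTb + v rM)

/-- A single counter `j = S' + M * (S + M * a)` runs through all triples, which replaces three
nested loops. -/
theorem exists_lt_mul_iff {N M : ℕ} (p : ℕ → ℕ → ℕ → Prop) (S' : ℕ) (hS' : S' < M) :
    (∃ j < N * (M * M), S' = j % M ∧ p (j / (M * M)) (j / M % M) (j % M)) ↔
      ∃ a < N, ∃ S < M, p a S S' := by
  have hM : 0 < M := by omega
  constructor
  · rintro ⟨j, hj, rfl, h⟩
    exact ⟨_, (Nat.div_lt_iff_lt_mul (by positivity)).2 hj, _, Nat.mod_lt _ hM, h⟩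
  · rintro ⟨a, ha, S, hS, h⟩
    have h1 : (S' + M * (S + M * a)) / M = S + M * a := by
      rw [Nat.add_mul_div_left _ _ hM, Nat.div_eq_of_lt hS', zero_add]
    have h2 : (S' + M * (S + M * a)) % M = S' := by
      rw [Nat.add_mul_mod_self_left, Nat.mod_eq_of_lt hS']
    refine ⟨S' + M * (S + M * a), ?_, h2.symm, ?_⟩
    · have : S' + M * (S + M * a) < M * (S + M * a + 1) := by nlinarith
      have h3 : S + M * a + 1 ≤ M * (a + 1) := by nlinarith
      have h4 : M * (a + 1) ≤ M * N := Nat.mul_le_mul_left _ ha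
      calc _ < M * (S + M * a + 1) := this
        _ ≤ M * (M * N) := Nat.mul_le_mul_left _ (h3.trans h4)
        _ = N * (M * M) := by ring
    · rw [h2, ← Nat.div_div_eq_div_mul, h1, Nat.add_mul_mod_self_left, Nat.mod_eq_of_lt hS,
        Nat.add_mul_div_left _ _ hM, Nat.div_eq_of_lt hS, zero_add]
      exact h

/-- The next table occupies the cells directly behind the current one. These are still zero by
`hfresh`, so cells only have to be set, never cleared; the price is a memory bound that grows with
the number of operations. -/
theorem wp_genOp {K Z R : ℕ} {φ N : Ex} {σ : RamState} {M L n : ℕ} {X : ℕ → Prop}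
    {Φ : ℕ → ℕ → ℕ → ℕ → Prop} (hM : σ.reg rM = M) (hL : σ.reg rLen = L) (hN : N.eval σ = n)
    (hM0 : 0 < M)
    (hfresh : ∀ a ≥ σ.reg rTb + M, σ.mem a = 0)
    (hX : ∀ S < M, σ.mem (σ.reg rTb + S) ≠ 0 ↔ X S)
    (hZ : n * (M * M) ≤ Z) (hLZ : L ≤ Z) (hZK : Z < K) (hK1 : 2 ≤ K) (hTK : σ.reg rTb + M < K)
    (hφ : ∀ a < n, ∀ S < M, ∀ S' < M, ∀ i < L, ∀ τ, Fr 40 σ τ → τ.reg rTb = σ.reg rTb →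
      (∀ b < σ.reg rTb, τ.mem b = σ.mem b) → τ.reg 42 = a → τ.reg 43 = S → τ.reg 44 = S' →
      τ.reg 45 = i → (φ.Tr τ ↔ Φ a S S' i)) :
    (genOp φ N).wp K Z R (fun σ' => Fr 40 σ σ' ∧ σ'.reg rTb = σ.reg rTb + M ∧
      (∀ b < σ.reg rTb, σ'.mem b = σ.mem b) ∧ (∀ b ≥ σ.reg rTb + M + M, σ'.mem b = 0) ∧
      ∀ S' < M, σ'.mem (σ.reg rTb + M + S') ≠ 0 ↔
        ∃ a < n, ∃ S < M, X S ∧ ∀ i < L, Φ a S S' i) σ := by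
  have hMM : 0 < M * M := by positivity
  -- After `j` rounds the new table contains exactly the states produced by smaller counter values.
  refine wp_forr (n * (M * M)) (by simp [hM, hN]) (by omega) (by simpa using hZ)
    (fun j τ => Fr 40 σ τ ∧ τ.reg rTb = σ.reg rTb ∧ (∀ b < σ.reg rTb + M, τ.mem b = σ.mem b) ∧
      (∀ b ≥ σ.reg rTb + M + M, τ.mem b = 0) ∧ ∀ S' < M, τ.mem (σ.reg rTb + M + S') ≠ 0 ↔
        ∃ j' < j, S' = j' % M ∧ X (j' / M % M) ∧ ∀ i < L, Φ (j' / (M * M)) (j' / M % M) (j' % M) i)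
    ?_ ?_ ?_ ?_
  · rintro j τ τ' h1 h2 ⟨h3, h4, h5, h6, h7⟩
    rw [h2, h1 900 (by omega) (by omega)]
    exact ⟨fun y hy => (h1 y (by omega) (by omega)).trans (h3 y hy), h4, h5, h6, h7⟩
  · exact ⟨Fr.refl _ _, rfl, fun _ _ => rfl, fun b hb => hfresh b (by omega), fun S' hS' => by
      simp [hfresh (σ.reg 900 + M + S') (by omega)]⟩
  · rintro j hj τ ⟨h3, h4, h5, h6, h7⟩ hx hx1
    have hM' : τ.reg rM = M := (h3 _ (by omega)).trans hM
    have hL' : τ.reg rLen = L := (h3 _ (by omega)).trans hL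
    have ha : j / (M * M) < n := (Nat.div_lt_iff_lt_mul hMM).2 hj
    have hS : j / M % M < M := Nat.mod_lt _ hM0
    have hS' : j % M < M := Nat.mod_lt _ hM0
    have h8 := Nat.div_le_self j (M * M)
    have h9 := Nat.mod_le (j / M) M
    have h10 := Nat.div_le_self j M
    have h11 := Nat.mod_le j M
    refine ⟨?_, ?_, ?_, ?_, ?_⟩
    · simp [hx, hM']; omega
    · simp [hx, hM']; omega
    · simp [hx, hM']; omega
    · simp; omega
    set τ4 := (((τ.setReg 42 _).setReg 43 _).setReg 44 _).setReg 47 _ with hτ4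
    have r42 : τ4.reg 42 = j / (M * M) := by simp [hτ4, hx, hM']
    have r43 : τ4.reg 43 = j / M % M := by simp [hτ4, hx, hM']
    have r44 : τ4.reg 44 = j % M := by simp [hτ4, hx, hM']
    have r47 : τ4.reg 47 ≠ 0 ↔ X (j / M % M) := by
      rw [← hX _ hS, ← h5 _ (by omega), ← h4]
      simp [hτ4, hx, hM']
      omega
    have hfr : Fr 42 τ τ4 := (((((Fr.refl 42 τ).setReg (by omega)).setReg (by omega)).setReg
      (by omega)).setReg (by omega))
    have htb : τ4.reg 900 = σ.reg 900 := by rw [← h4]; simp [hτ4]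
    have hm4 : τ4.mem = τ.mem := rfl
    clear_value τ4
    -- Register `47` starts as membership of `S` in the current table and is reset at the first
    -- digit that fails.
    refine wp_forr L ((hfr _ (by omega)).trans hL') (by omega) (by simpa using hLZ)
      (fun i υ => Fr 45 τ4 υ ∧ υ.reg rTb = σ.reg rTb ∧ υ.mem = τ.mem ∧ (υ.reg 47 ≠ 0 ↔
        X (j / M % M) ∧ ∀ i' < i, Φ (j / (M * M)) (j / M % M) (j % M) i')) ?_ ?_ ?_ ?_
    · rintro i υ υ' g1 g2 ⟨g3, g4, g5, g6⟩
      rw [g2, g1 900 (by omega) (by omega), g1 47 (by omega) (by omega)]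
      exact ⟨fun y hy => (g1 y (by omega) (by omega)).trans (g3 y hy), g4, g5, g6⟩
    · exact ⟨Fr.refl _ _, htb, hm4, by simpa using r47⟩
    · rintro i hi υ ⟨g3, g4, g5, g6⟩ hy hy1
      have hΦ := hφ _ ha _ hS _ hS' i hi υ
        ((h3.trans (hfr.mono (by omega))).trans (g3.mono (by omega))) g4
        (fun b hb => by rw [g5, h5 b (by omega)])
        ((g3 _ (by omega)).trans r42) ((g3 _ (by omega)).trans r43) ((g3 _ (by omega)).trans r44) hy
      constructor
      · intro ht
        refine ⟨hy, hy1, g3, g4, g5, g6.trans (and_congr_right fun _ => ⟨fun h i' hi' => ?_,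
          fun h i' hi' => h i' (by omega)⟩)⟩
        rcases Nat.lt_succ_iff_lt_or_eq.1 hi' with h12 | rfl
        · exact h i' h12
        · exact hΦ.1 ht
      · intro ht
        refine ⟨by simp; omega, by simpa using hy, by simpa using hy1, g3.setReg (by omega),
          by simpa using g4, g5, ?_⟩
        simp only [RamState.setReg_reg, if_true, eval_ofNat, ne_eq, not_true, false_iff]
        rintro ⟨-, h⟩
        exact ht (hΦ.2 (h i (by omega)))
    · rintro υ ⟨g3, g4, g5, g6⟩
      have f1 : Fr 40 σ υ := (h3.trans (hfr.mono (by omega))).trans (g3.mono (by omega))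
      have v40 : υ.reg 40 = j := by rw [g3 _ (by omega), hfr _ (by omega), hx]
      have v41 : υ.reg 41 = n * (M * M) - j := by rw [g3 _ (by omega), hfr _ (by omega), hx1]
      have v44 : υ.reg 44 = j % M := by rw [g3 _ (by omega), r44]
      have v18 : υ.reg 18 = M := by rw [f1 _ (by omega), hM]
      constructor
      · intro ht
        refine ⟨by simp; omega, v40, v41, f1, g4, ?_, ?_, ?_⟩
        · intro b hb
          simp only [RamState.setMem_mem, eval_add, eval_v, g4, v18, v44]
          rw [if_neg (by omega), g5, h5 b hb]
        · intro b hb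
          simp only [RamState.setMem_mem, eval_add, eval_v, g4, v18, v44]
          rw [if_neg (by omega), g5, h6 b hb]
        · intro S' hS2
          simp only [RamState.setMem_mem, eval_add, eval_v, g4, v18, v44]
          by_cases h12 : S' = j % M
          · rw [if_pos (by omega)]
            refine ⟨fun _ => ⟨j, by omega, h12, g6.1 ht⟩, fun _ => by simp⟩
          · rw [if_neg (by omega), g5, h7 S' hS2]
            refine ⟨fun ⟨j', h13, h14⟩ => ⟨j', by omega, h14⟩, fun ⟨j', h13, h14, h15⟩ => ?_⟩
            rcases Nat.lt_succ_iff_lt_or_eq.1 h13 with h16 | rfl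
            · exact ⟨j', h16, h14, h15⟩
            · exact absurd h14 h12
      · intro ht
        refine ⟨v40, v41, f1, g4, ?_, ?_, ?_⟩
        · rw [g5]; exact h5
        · rw [g5]; exact h6
        · intro S' hS2
          rw [g5, h7 S' hS2]
          refine ⟨fun ⟨j', h13, h14⟩ => ⟨j', by omega, h14⟩, fun ⟨j', h13, h14, h15⟩ => ?_⟩
          rcases Nat.lt_succ_iff_lt_or_eq.1 h13 with h16 | rfl
          · exact ⟨j', h16, h14, h15⟩
          · exact absurd (g6.2 h15) ht
  · rintro τ ⟨h3, h4, h5, h6, h7⟩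
    have hM' : τ.reg rM = M := (h3 _ (by omega)).trans hM
    refine ⟨by simp [h4, hM']; omega, h3.setReg (by omega), by simp [h4, hM'],
      fun b hb => h5 b (by omega), h6, fun S' hS' => ?_⟩
    rw [RamState.setReg_mem, h7 S' hS']
    exact exists_lt_mul_iff (fun a S S' => X S ∧ ∀ i < L, Φ a S S' i) S' hS'

/-- The digit `j` of `S`. -/
def dg (S j : Ex) : Ex := (S.mod (ld (v aWt + (j + 1)))) / ld (v aWt + j)

theorem eval_dg {τ : RamState} {k q L : ℕ} (h : ∀ j ≤ L, τ.mem (τ.reg aWt + j) = wt k q j)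
    {S j : Ex} {S' j' : ℕ} (hS : S.eval τ = S') (hj : j.eval τ = j') (hj' : j' < L) :
    (dg S j).eval τ = dig k q S' j' := by
  simp only [dg, eval_div, eval_mod, eval_ld, eval_add, eval_v, eval_ofNat, hS, hj, h j' hj'.le]
  rw [h _ hj', dig]

/-- Acceptance. -/
def finOp : Cmd :=
  genOp ((dg (v 44) (v 45)).eq 0 * cnd ((v 45).lt (v rK)) ((dg (v 43) (v 45)).eq 1)
    ((((v 45 - v rK).mod (v rP + 1)).eq (v rP)).not + (dg (v 43) (v 45)).eq 1)) 1

/-- Forget the vertex in the slot in register `36`. -/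
def forgetOp : Cmd :=
  genOp (cnd ((v 45).lt (v rK)) ((dg (v 44) (v 45)).eq (dg (v 43) (v 45)))
    ((((dg (v 43) (v 45)).eq (v rP + 2 + v 42)).not *
      ((((v 45 - v rK).mod (v rP + 1)).eq (v 36)).not + (dg (v 43) (v 45)).eq 0)) *
      cnd ((dg (v 43) (v 45)).eq (v 36 + 2)) ((dg (v 44) (v 45)).eq (v rP + 2 + v 42))
        ((dg (v 44) (v 45)).eq (dg (v 43) (v 45))))) (v rL * (v rP + 1) + 1)

/-- Use the arc from the vertex in the slot in register `32` to the vertex whose name is in register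
`33`, if register `34` is not `0`. -/
def arcOp : Cmd :=
  genOp (cnd ((v 42).eq (v rL * (v rP + 1))) ((dg (v 44) (v 45)).eq (dg (v 43) (v 45)))
    ((((v 34 * (dg (v 43) (v rK + v 42)).eq (v 33)) *
        ((v rK + v 42).eq (v rK + v 42 / (v rP + 1) * (v rP + 1) + v 32)).not) *
        dg (v 43) (v rK + v 42 / (v rP + 1) * (v rP + 1) + v 32)) *
      cnd ((v 45).eq (v rK + v 42))
        ((dg (v 44) (v 45)).eq (dg (v 43) (v rK + v 42 / (v rP + 1) * (v rP + 1) + v 32)))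
        (cnd ((v 45).eq (v rK + v 42 / (v rP + 1) * (v rP + 1) + v 32)) ((dg (v 44) (v 45)).eq 0)
          ((dg (v 44) (v 45)).eq (dg (v 43) (v 45)))))) (v rL * (v rP + 1) + 1)

/-- Introduce the vertex in register `37` in the slot in register `36`. -/
def introOp : Cmd :=
  genOp ((ld (v aRH + v 42)).eq (ld (v aRT + v 37)) *
    cnd ((v 45).lt (v rK))
      (cnd ((v 45).eq (v 42)) ((dg (v 43) (v 45)).eq 0 * (dg (v 44) (v 45)).eq 1)
        ((dg (v 44) (v 45)).eq (dg (v 43) (v 45))))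
      (cnd (((v 45 - v rK).mod (v rP + 1)).eq (v 36))
        (cnd ((ld (5 + 2 * ((v 45 - v rK) / (v rP + 1)))).eq (v 42)) ((dg (v 44) (v 45)).eq 1)
          ((dg (v 44) (v 45)).eq (dg (v 43) (v 45)) + (dg (v 44) (v 45)).eq (v 36 + 2)))
        (cnd (((v 45 - v rK).mod (v rP + 1)).eq (v rP) *
            (ld (5 + 2 * ((v 45 - v rK) / (v rP + 1)) + 1)).eq (v 42))
          ((dg (v 44) (v 45)).eq (v 36 + 2)) ((dg (v 44) (v 45)).eq (dg (v 43) (v 45))))))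
    (v rK + 1)

/-! ### The memory layout -/

namespace RootedInput

variable (I : RootedInput)

/-- The size of the largest bag. -/
def maxBag : ℕ := Finset.univ.sup fun i => (I.bagList i).length
/-- The number of names. -/
def nq : ℕ := I.maxBag + 3 + I.l * (I.maxBag + 1)
/-- The number of digits. -/
def nL : ℕ := I.k + I.l * (I.maxBag + 1)
/-- The number of states. -/
def nM : ℕ := wt I.k I.nq I.nL
/-- The position of the roots of `H` in the input. -/
def oRootH : ℕ := 5 + 2 * I.l
/-- The position of the roots of `T` in the input. -/
def oRootT : ℕ := I.oRootH + I.t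
/-- The position of the adjacency matrix in the input. -/
def oAdj : ℕ := I.oRootT + I.t
/-- The position of bag `i` in the input. -/
def bagPos : ℕ → ℕ
  | 0 => I.oAdj + I.n * I.n
  | i + 1 => bagPos i + if h : i < I.r then 1 + (I.bagList ⟨i, h⟩).length else 0
/-- The position of the table of roots of `H`. -/
def pRH : ℕ := I.bagPos I.r
/-- The position of the table of roots of `T`. -/
def pRT : ℕ := I.pRH + (I.k + 1)
/-- The position of the table of slots. -/
def pOcc : ℕ := I.pRT + I.n
/-- The position of the table of introduced vertices. -/
def pInt : ℕ := I.pOcc + I.maxBag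
/-- The position of the table of weights. -/
def pWt : ℕ := I.pInt + I.n
/-- The position of the first table of states. -/
def pTab : ℕ := I.pWt + (I.nL + 1)

theorem nq_pos : 0 < I.nq := by unfold nq; omega

theorem nM_pos : 0 < I.nM := wt_pos I.nq_pos _

/-- The registers that are fixed after the preparation. -/
structure Glob (σ : RamState) : Prop where
  k : σ.reg rK = I.k
  l : σ.reg rL = I.l
  t : σ.reg rT = I.t
  n : σ.reg rN = I.n
  r : σ.reg rR = I.r
  P : σ.reg rP = I.maxBag
  adj : σ.reg rAdj = I.oAdj
  bag : σ.reg rBag = I.bagPos 0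
  rh : σ.reg aRH = I.pRH
  rt : σ.reg aRT = I.pRT
  occ : σ.reg aOcc = I.pOcc
  int : σ.reg aInt = I.pInt
  wt : σ.reg aWt = I.pWt
  len : σ.reg rLen = I.nL
  q : σ.reg rQ = I.nq
  M : σ.reg rM = I.nM

variable {I} in
theorem Glob.congr {σ τ : RamState} (h : I.Glob σ) (hf : Fr 20 σ τ) : I.Glob τ := by
  constructor <;> rw [hf _ (by omega)]
  exacts [h.k, h.l, h.t, h.n, h.r, h.P, h.adj, h.bag, h.rh, h.rt, h.occ, h.int, h.wt, h.len, h.q,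
    h.M]

/-- The content of a slot as a number. -/
def slotVal {n : ℕ} : Option (Fin n) → ℕ
  | none => 0
  | some w => w + 1

/-- The contents of the memory before the tables of states. -/
structure Data (occ : ℕ → Option (Fin I.n)) (A : Set (Fin I.n)) (m : ℕ → ℕ) : Prop where
  inp : ∀ a < I.pRH, m a = I.encode.getD a 0
  rh : ∀ i, m (I.pRH + I.rootH i) = i + 1
  rh0 : ∀ u ≤ I.k, (∀ i, (I.rootH i : ℕ) ≠ u) → m (I.pRH + u) = 0
  rt : ∀ i, m (I.pRT + I.rootT i) = i + 1
  rt0 : ∀ v : Fin I.n, (∀ i, I.rootT i ≠ v) → m (I.pRT + v) = 0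
  occ : ∀ s < I.maxBag, m (I.pOcc + s) = slotVal (occ s)
  int : ∀ v : Fin I.n, m (I.pInt + v) ≠ 0 ↔ v ∈ A
  wt : ∀ i ≤ I.nL, m (I.pWt + i) = wt I.k I.nq i

variable {I} in
theorem Data.congr {occ : ℕ → Option (Fin I.n)} {A : Set (Fin I.n)} {m m' : ℕ → ℕ}
    (h : I.Data occ A m) (hm : ∀ a < I.pTab, m' a = m a) : I.Data occ A m' := by
  have e1 : I.pTab = I.pWt + (I.nL + 1) := rfl
  have e2 : I.pWt = I.pInt + I.n := rfl
  have e3 : I.pInt = I.pOcc + I.maxBag := rfl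
  have e4 : I.pOcc = I.pRT + I.n := rfl
  have e5 : I.pRT = I.pRH + (I.k + 1) := rfl
  refine ⟨fun a ha => ?_, fun i => ?_, fun u hu h1 => ?_, fun i => ?_, fun v h1 => ?_,
    fun s hs => ?_, fun v => ?_, fun i hi => ?_⟩
  · rw [hm _ (by omega), h.inp a ha]
  · have := (I.rootH i).2
    rw [hm _ (by omega), h.rh i]
  · rw [hm _ (by omega), h.rh0 u hu h1]
  · have := (I.rootT i).2
    rw [hm _ (by omega), h.rt i]
  · have := v.2
    rw [hm _ (by omega), h.rt0 v h1]
  · rw [hm _ (by omega), h.occ s hs]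
  · have := v.2
    rw [hm _ (by omega), h.int v]
  · rw [hm _ (by omega), h.wt i hi]

/-- The current table of states is `X`; at most `c` tables precede it. -/
structure Tab (X : ℕ → Prop) (c : ℕ) (σ : RamState) : Prop where
  pos : ∃ c' ≤ c, σ.reg rTb = I.pTab + c' * I.nM
  mem : ∀ S < I.nM, σ.mem (σ.reg rTb + S) ≠ 0 ↔ X S
  fresh : ∀ a ≥ σ.reg rTb + I.nM, σ.mem a = 0
  lt : ∀ S, X S → S < I.nM

/-- The configurations of the main loop. -/
structure St (occ : ℕ → Option (Fin I.n)) (A : Set (Fin I.n)) (X : ℕ → Prop) (c : ℕ)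
    (σ : RamState) : Prop where
  glob : I.Glob σ
  data : I.Data occ A σ.mem
  tab : I.Tab X c σ

variable {I} in
theorem St.congr {occ : ℕ → Option (Fin I.n)} {A : Set (Fin I.n)} {X : ℕ → Prop} {c : ℕ}
    {σ τ : RamState} (h : I.St occ A X c σ) (hf : Fr 20 σ τ) (ht : τ.reg rTb = σ.reg rTb)
    (hm : τ.mem = σ.mem) : I.St occ A X c τ :=
  ⟨h.glob.congr hf, hm ▸ h.data, ⟨ht ▸ h.tab.pos, by rw [ht, hm]; exact h.tab.mem,
    by rw [ht, hm]; exact h.tab.fresh, h.tab.lt⟩⟩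

variable {I} in
theorem St.mono {occ : ℕ → Option (Fin I.n)} {A : Set (Fin I.n)} {X : ℕ → Prop} {c c' : ℕ}
    {σ : RamState} (h : I.St occ A X c σ) (hc : c ≤ c') : I.St occ A X c' σ :=
  ⟨h.glob, h.data, ⟨by
    obtain ⟨d, hd, h1⟩ := h.tab.pos
    exact ⟨d, hd.trans hc, h1⟩, h.tab.mem, h.tab.fresh, h.tab.lt⟩⟩

/-- Bounds for the words and the loops. -/
structure Bnd (K Z R Cm : ℕ) : Prop where
  hK : 100 ≤ K
  hJ : (I.k + I.l * (I.maxBag + 1) + 1) * (I.nM * I.nM) ≤ Z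
  hP : I.maxBag + 3 ≤ Z
  hZ : 2 * Z < K
  hF : I.pTab + (Cm + 2) * I.nM < K
  hR : I.r ≤ R
  hr : I.r < K

/-! ### Reading the input -/

/-- The list `xs` stands in memory from position `a` on. -/
def At (m : ℕ → ℕ) (a : ℕ) (xs : List ℕ) : Prop := ∀ j (h : j < xs.length), m (a + j) = xs[j]

theorem At.append {m : ℕ → ℕ} {a : ℕ} {xs ys : List ℕ} (h : At m a (xs ++ ys)) :
    At m a xs ∧ At m (a + xs.length) ys := by
  refine ⟨fun j hj => ?_, fun j hj => ?_⟩
  · rw [h j (by simp; omega), List.getElem_append_left]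
  · have := h (xs.length + j) (by simp; omega)
    rw [List.getElem_append_right (by omega), ← add_assoc] at this
    rw [this]
    simp

theorem At.flatMap {α : Type*} {m : ℕ → ℕ} {a : ℕ} {xs : List α} {f : α → List ℕ}
    (h : At m a (xs.flatMap f)) (i : ℕ) (hi : i < xs.length) :
    At m (a + ((xs.take i).flatMap f).length) (f xs[i]) := by
  induction xs generalizing a i with
  | nil => simp at hi
  | cons x xs ih =>
    rw [List.flatMap_cons] at h
    cases i with
    | zero => simpa using h.append.1
    | succ i =>
      have := ih h.append.2 i (by simpa using hi)
      simpa [add_assoc] using this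

theorem At.flatMap_const {r c : ℕ} {m : ℕ → ℕ} {a : ℕ} {f : Fin r → List ℕ}
    (h : At m a ((List.finRange r).flatMap f)) (hc : ∀ i, (f i).length = c) (i : Fin r) :
    At m (a + i * c) (f i) := by
  have h1 := h.flatMap i (by simp)
  have h2 : (((List.finRange r).take i).flatMap f).length = i * c := by
    rw [List.length_flatMap, List.sum_eq_card_nsmul _ c (by simp [hc])]
    simp
  rw [h2] at h1
  simpa using h1

open Classical in
theorem encode_eq : I.encode = [I.k, I.l, I.t, I.n, I.r]
    ++ (List.finRange I.l).flatMap (fun e => [(I.H.src e : ℕ), (I.H.tgt e : ℕ)])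
    ++ (List.finRange I.t).map (fun i => (I.rootH i : ℕ))
    ++ (List.finRange I.t).map (fun i => (I.rootT i : ℕ))
    ++ (List.finRange I.n).flatMap
        (fun a => (List.finRange I.n).map fun b => if I.T.Adj a b then 1 else 0)
    ++ (List.finRange I.r).flatMap
        (fun i => (I.bagList i).length :: (I.bagList i).map Fin.val) := by
  unfold encode
  congr 1
  refine congrArg (fun f => List.flatMap f (List.finRange I.r)) (funext fun i => ?_)
  congr 1
  generalize I.bagList i = xs
  induction xs <;> simp_all

theorem at_encode : At (fun a => I.encode.getD a 0) 0 I.encode := by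
  intro j hj
  simp [hj]

theorem encode_head : I.encode.getD 0 0 = I.k ∧ I.encode.getD 1 0 = I.l ∧ I.encode.getD 2 0 = I.t ∧
    I.encode.getD 3 0 = I.n ∧ I.encode.getD 4 0 = I.r := by
  have h := I.at_encode
  rw [encode_eq] at h ⊢
  have h1 := h.append.1.append.1.append.1.append.1.append.1
  exact ⟨h1 0 (by simp), h1 1 (by simp), h1 2 (by simp), h1 3 (by simp), h1 4 (by simp)⟩

theorem encode_edge (e : Fin I.l) : I.encode.getD (5 + 2 * e) 0 = I.H.src e ∧
    I.encode.getD (5 + 2 * e + 1) 0 = I.H.tgt e := by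
  have h := I.at_encode
  rw [encode_eq] at h ⊢
  have h1 := h.append.1.append.1.append.1.append.1.append.2.flatMap_const (c := 2) (fun _ => rfl) e
  have h2 := h1 0 (by simp)
  have h3 := h1 1 (by simp)
  simp only [List.length_cons, List.length_nil, add_zero, zero_add, mul_comm (e : ℕ) 2] at h2 h3
  exact ⟨h2, h3⟩

theorem length_edges : ((List.finRange I.l).flatMap
    (fun e => [(I.H.src e : ℕ), (I.H.tgt e : ℕ)])).length = 2 * I.l := by
  rw [List.length_flatMap, List.sum_eq_card_nsmul _ 2 (by simp)]
  simp [mul_comm]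

open Classical in
theorem length_adj : ((List.finRange I.n).flatMap
    (fun a => (List.finRange I.n).map fun b => if I.T.Adj a b then 1 else 0)).length =
      I.n * I.n := by
  rw [List.length_flatMap, List.sum_eq_card_nsmul _ I.n (by simp)]
  simp

theorem encode_rootH (i : Fin I.t) : I.encode.getD (I.oRootH + i) 0 = I.rootH i := by
  have h := I.at_encode
  rw [encode_eq] at h ⊢
  have h1 := h.append.1.append.1.append.1.append.2 i (by simp)
  have h2 : 0 + (List.length [I.k, I.l, I.t, I.n, I.r] + 2 * I.l) = I.oRootH := by
    simp [oRootH]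
  simp only [List.length_append, length_edges, h2] at h1
  refine h1.trans ?_
  simp

theorem encode_rootT (i : Fin I.t) : I.encode.getD (I.oRootT + i) 0 = I.rootT i := by
  have h := I.at_encode
  rw [encode_eq] at h ⊢
  have h1 := h.append.1.append.1.append.2 i (by simp)
  have h2 : 0 + (List.length [I.k, I.l, I.t, I.n, I.r] + 2 * I.l + I.t) = I.oRootT := by
    simp [oRootT, oRootH]
  simp only [List.length_append, length_edges, List.length_map, List.length_finRange, h2] at h1
  refine h1.trans ?_
  simp

theorem encode_adj (a b : Fin I.n) : I.encode.getD (I.oAdj + a * I.n + b) 0 ≠ 0 ↔ I.T.Adj a b := by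
  classical
  have h := I.at_encode
  rw [encode_eq] at h ⊢
  have h1 := (h.append.1.append.2.flatMap_const (c := I.n) (by simp) a) b (by simp)
  have h2 : 0 + (List.length [I.k, I.l, I.t, I.n, I.r] + 2 * I.l + I.t + I.t) = I.oAdj := by
    simp [oAdj, oRootT, oRootH]
  simp only [List.length_append, length_edges, List.length_map, List.length_finRange, h2] at h1
  rw [h1]
  simp

theorem bagPos_take (i : ℕ) (hi : i ≤ I.r) : I.bagPos 0 + (((List.finRange I.r).take i).flatMap
    (fun i => (I.bagList i).length :: (I.bagList i).map Fin.val)).length = I.bagPos i := by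
  induction i with
  | zero => simp
  | succ i ih =>
    have h1 : I.bagPos (i + 1) = I.bagPos i + (1 + (I.bagList ⟨i, hi⟩).length) := by
      rw [bagPos, dif_pos]
    rw [h1, ← ih (by omega), List.take_add_one]
    simp [show i < I.r by omega]
    omega

theorem encode_bag (i : Fin I.r) : I.encode.getD (I.bagPos i) 0 = (I.bagList i).length ∧
    ∀ j (hj : j < (I.bagList i).length),
      I.encode.getD (I.bagPos i + 1 + j) 0 = (I.bagList i)[j] := by
  have h := I.at_encode
  rw [encode_eq] at h ⊢
  have h1 := h.append.2.flatMap i (by simp)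
  have h2 : 0 + (List.length [I.k, I.l, I.t, I.n, I.r] + 2 * I.l + I.t + I.t + I.n * I.n)
      = I.bagPos 0 := by
    simp [bagPos, oAdj, oRootT, oRootH]
  have h3 := I.bagPos_take i i.2.le
  simp only [List.length_append, length_edges, length_adj, List.length_map, List.length_finRange,
    h2, h3, List.getElem_finRange] at h1
  refine ⟨h1 0 (by simp), fun j hj => ?_⟩
  have h4 := h1 (j + 1) (by simpa using hj)
  rw [add_assoc, add_comm 1 j]
  refine h4.trans ?_
  simp

theorem encode_length : I.encode.length = I.pRH := by
  have h2 : List.length [I.k, I.l, I.t, I.n, I.r] + 2 * I.l + I.t + I.t + I.n * I.n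
      = I.bagPos 0 := by
    simp [bagPos, oAdj, oRootT, oRootH]
  have h3 := I.bagPos_take I.r le_rfl
  rw [List.take_of_length_le (by simp)] at h3
  rw [encode_eq, pRH]
  rw [List.length_append, List.length_append, List.length_append, List.length_append,
    List.length_append, length_edges, length_adj, List.length_map, List.length_map,
    List.length_finRange, h2, h3]

theorem bagPos_mono {i j : ℕ} (h : i ≤ j) : I.bagPos i ≤ I.bagPos j := by
  induction h with
  | refl => exact le_rfl
  | step _ ih => exact ih.trans (by rw [bagPos]; omega)

theorem bagPos_succ (i : Fin I.r) : I.bagPos (i + 1) = I.bagPos i + 1 + (I.bagList i).length := by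
  rw [bagPos, dif_pos i.2, add_assoc]

theorem length_le_maxBag (i : Fin I.r) : (I.bagList i).length ≤ I.maxBag :=
  Finset.le_sup (f := fun i => (I.bagList i).length) (Finset.mem_univ i)

/-! ### The table operations -/

variable {I}
variable {K Z R Cm : ℕ} {occ : ℕ → Option (Fin I.n)} {A : Set (Fin I.n)} {X : ℕ → Prop} {c : ℕ}
  {σ : RamState}

/-- Each operation consumes one more block of memory, counted by `c`; the bound `Cm` on this count
keeps the addresses below `K`. Everything before the tables is untouched, so the layout can be
assumed while testing digits. -/
theorem St.wp_genOp (hB : I.Bnd K Z R Cm) (h : I.St occ A X c σ) (hc : c + 1 ≤ Cm) {φ N : Ex} {n : ℕ}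
    {Φ : ℕ → ℕ → ℕ → ℕ → Prop} (hN : N.eval σ = n)
    (hn : n ≤ I.k + I.l * (I.maxBag + 1) + 1)
    (hφ : ∀ a < n, ∀ S < I.nM, ∀ S' < I.nM, ∀ i < I.nL, ∀ τ, Fr 40 σ τ → I.Glob τ →
      I.Data occ A τ.mem → τ.reg 42 = a → τ.reg 43 = S → τ.reg 44 = S' → τ.reg 45 = i →
      (φ.Tr τ ↔ Φ a S S' i)) :
    (genOp φ N).wp K Z R (fun σ' => Fr 40 σ σ' ∧ ∃ X', I.St occ A X' (c + 1) σ' ∧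
      ∀ S' < I.nM, X' S' ↔ ∃ S, X S ∧ ∃ a < n, ∀ i < I.nL, Φ a S S' i) σ := by
  obtain ⟨c', hc', hpos⟩ := h.tab.pos
  have hM := I.nM_pos
  have hMM : 0 < I.nM * I.nM := by positivity
  have hZ1 : I.k + I.l * (I.maxBag + 1) + 1 ≤ Z :=
    (Nat.le_mul_of_pos_right _ hMM).trans hB.hJ
  have hF := hB.hF
  have hZ := hB.hZ
  have hK := hB.hK
  have h1 : (c' + 1) * I.nM ≤ Cm * I.nM := Nat.mul_le_mul_right _ (by omega)
  rw [Nat.add_mul] at hF h1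
  refine wp_mono ?_ _ _ (_root_.wp_genOp (M := I.nM) (L := I.nL) (n := n) (X := X) (Φ := Φ) h.glob.M
    h.glob.len hN hM h.tab.fresh h.tab.mem ((Nat.mul_le_mul_right _ hn).trans hB.hJ)
    (by unfold nL; omega) (by omega) (by omega) (by omega) ?_)
  · rintro σ' ⟨h2, h3, h4, h5, h6⟩
    refine ⟨h2, fun S' => S' < I.nM ∧ σ'.mem (σ.reg rTb + I.nM + S') ≠ 0,
      ⟨h.glob.congr (h2.mono (by omega)), h.data.congr (fun a ha => h4 a (by omega)),
        ⟨c' + 1, by omega, by rw [h3, hpos]; ring⟩, ?_, ?_, fun S hS => hS.1⟩, ?_⟩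
    · intro S hS
      rw [h3]
      exact ⟨fun h => ⟨hS, h⟩, fun h => h.2⟩
    · intro a ha
      exact h5 a (by omega)
    · intro S' hS'
      refine (and_congr_right fun _ => h6 S' hS').trans ?_
      constructor
      · rintro ⟨-, a, ha, S, hS, hXS, h7⟩
        exact ⟨S, hXS, a, ha, h7⟩
      · rintro ⟨S, hXS, a, ha, h7⟩
        exact ⟨hS', a, ha, S, h.tab.lt S hXS, hXS, h7⟩
  · intro a ha S hS S' hS' i hi τ h2 h3 h4
    exact hφ a ha S hS S' hS' i hi τ h2 (h.glob.congr (h2.mono (by omega)))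
      (h.data.congr fun b hb => h4 b (by omega))

theorem Data.eval_dg (h : I.Data occ A σ.mem) (hg : I.Glob σ) {S j : Ex} {S' j' : ℕ}
    (hS : S.eval σ = S') (hj : j.eval σ = j') (hj' : j' < I.nL) :
    (dg S j).eval σ = dig I.k I.nq S' j' :=
  _root_.eval_dg (L := I.nL) (fun j hj => by rw [hg.wt, h.wt j hj]) hS hj hj'

theorem St.wp_finOp (hB : I.Bnd K Z R Cm) (h : I.St occ A X c σ) (hc : c + 1 ≤ Cm) :
    finOp.wp K Z R (fun σ' => σ'.mem (σ'.reg rTb) ≠ 0 ↔ ∃ S, X S ∧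
      (∀ u, (stOf I.k I.l I.maxBag I.nq S).b u = 1) ∧
      ∀ e, (stOf I.k I.l I.maxBag I.nq S).g e I.maxBag = 1) σ := by
  refine wp_mono ?_ _ _ (h.wp_genOp hB hc (n := 1) (Φ := TFin I.k I.maxBag I.nq) rfl (by omega) ?_)
  · rintro σ' ⟨-, X', hX', h1⟩
    rw [← add_zero (σ'.reg rTb), hX'.tab.mem 0 I.nM_pos, h1 0 I.nM_pos]
    refine exists_congr fun S => and_congr_right fun _ => ?_
    exact tFin_iff
  · intro a ha S hS S' hS' i hi τ hf hg hd h42 h43 h44 h45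
    have d1 := hd.eval_dg hg (S := v 43) (j := v 45) h43 h45 hi
    have d2 := hd.eval_dg hg (S := v 44) (j := v 45) h44 h45 hi
    simp only [tr_mul, tr_eq, tr_cnd, tr_lt, tr_add, tr_not, d1, d2, eval_mod, eval_sub, eval_add,
      eval_v, eval_ofNat, h45, hg.k, hg.P, TFin, imp_iff_not_or]

theorem St.wp_forgetOp (hB : I.Bnd K Z R Cm) (h : I.St occ A X c σ) (hc : c + 1 ≤ Cm) {s : ℕ}
    (hs : s < I.maxBag) (h36 : σ.reg 36 = s) :
    forgetOp.wp K Z R (fun σ' => Fr 40 σ σ' ∧ ∃ X', I.St occ A X' (c + 1) σ' ∧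
      ∀ S' < I.nM, X' S' ↔ ∃ S, X S ∧ ForgetR I.maxBag I.nq s (stOf I.k I.l I.maxBag I.nq S)
        (stOf I.k I.l I.maxBag I.nq S')) σ := by
  refine wp_mono ?_ _ _ (h.wp_genOp hB hc (n := I.l * (I.maxBag + 1) + 1)
    (Φ := TForget I.k I.maxBag I.nq s) ?_ (by omega) ?_)
  · rintro σ' ⟨hf, X', hX', h1⟩
    refine ⟨hf, X', hX', fun S' hS' => (h1 S' hS').trans ?_⟩
    exact exists_congr fun S => and_congr_right fun _ => (forgetR_iff rfl hs).symm
  · simp [h.glob.l, h.glob.P]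
  · intro a ha S hS S' hS' i hi τ hf hg hd h42 h43 h44 h45
    have d1 := hd.eval_dg hg (S := v 43) (j := v 45) h43 h45 hi
    have d2 := hd.eval_dg hg (S := v 44) (j := v 45) h44 h45 hi
    have h36' : τ.reg 36 = s := (hf _ (by omega)).trans h36
    simp only [tr_mul, tr_eq, tr_cnd, tr_lt, tr_add, tr_not, d1, d2, eval_mod, eval_sub, eval_add,
      eval_v, eval_ofNat, h42, h45, h36', hg.k, hg.P, TForget, imp_iff_not_or, ne_eq]

theorem St.wp_arcOp (hk : 0 < I.k) (hB : I.Bnd K Z R Cm) (h : I.St occ A X c σ) (hc : c + 1 ≤ Cm)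
    {x y : ℕ} {en : Prop} (hx : x < I.maxBag) (h32 : σ.reg 32 = x) (h33 : σ.reg 33 = y)
    (h34 : σ.reg 34 ≠ 0 ↔ en) :
    arcOp.wp K Z R (fun σ' => Fr 40 σ σ' ∧ ∃ X', I.St occ A X' (c + 1) σ' ∧
      ∀ S' < I.nM, X' S' ↔ ∃ S, X S ∧ ArcR I.maxBag en x y (stOf I.k I.l I.maxBag I.nq S)
        (stOf I.k I.l I.maxBag I.nq S')) σ := by
  refine wp_mono ?_ _ _ (h.wp_genOp hB hc (n := I.l * (I.maxBag + 1) + 1)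
    (Φ := TArc I.k I.l I.maxBag I.nq en x y) ?_ (by omega) ?_)
  · rintro σ' ⟨hf, X', hX', h1⟩
    refine ⟨hf, X', hX', fun S' hS' => (h1 S' hS').trans ?_⟩
    exact exists_congr fun S => and_congr_right fun _ => (arcR_iff hk hx).symm
  · simp [h.glob.l, h.glob.P]
  · intro a ha S hS S' hS' i hi τ hf hg hd h42 h43 h44 h45
    have d1 := hd.eval_dg hg (S := v 43) (j := v 45) h43 h45 hi
    have d2 := hd.eval_dg hg (S := v 44) (j := v 45) h44 h45 hi
    have h32' : τ.reg 32 = x := (hf _ (by omega)).trans h32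
    have h33' : τ.reg 33 = y := (hf _ (by omega)).trans h33
    have h34' : τ.reg 34 ≠ 0 ↔ en := by rw [hf _ (by omega)]; exact h34
    -- For the choice of not using the arc, the computed digit positions are out of range. The
    -- conditional discards their values, so this case is settled before they are evaluated.
    by_cases hal : a = I.l * (I.maxBag + 1)
    · simp only [tr_eq, tr_cnd, d1, d2, eval_mul, eval_add, eval_v, eval_ofNat, h42, hg.l, hg.P,
        TArc, hal, not_true, false_and, or_false]
    · have e3 : (v rK + v 42).eval τ = I.k + a := by simp [hg.k, h42]
      have e4 : (v rK + v 42 / (v rP + 1) * (v rP + 1) + v 32).eval τ =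
          I.k + a / (I.maxBag + 1) * (I.maxBag + 1) + x := by simp [hg.k, hg.P, h42, h32']
      have h5 : a / (I.maxBag + 1) < I.l := by
        rw [Nat.div_lt_iff_lt_mul (by omega)]
        omega
      have h6 := Nat.mul_le_mul_right (I.maxBag + 1) h5
      rw [Nat.succ_mul] at h6
      have d3 := hd.eval_dg hg (S := v 43) h43 e3 (by unfold nL; omega)
      have d4 := hd.eval_dg hg (S := v 43) h43 e4 (by unfold nL; omega)
      have d5 : (dg (v 43) (v rK + v 42 / (v rP + 1) * (v rP + 1) + v 32)).Tr τ ↔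
          dig I.k I.nq S (I.k + a / (I.maxBag + 1) * (I.maxBag + 1) + x) ≠ 0 := by rw [Tr, d4]
      simp only [tr_eq, tr_cnd, tr_mul, tr_not, d1, d2, d3, d4, d5, e3, e4, eval_mul, eval_add,
        eval_v, eval_ofNat, h42, h45, h33', tr_v, h34', hg.l, hg.P, TArc, ne_eq]

/-- Both root tables hold the index of the root plus one, and `0` for a vertex that is not a root;
the additional entry at `k` is `0` and stands for no vertex. Compatibility with the roots then
becomes equality of two entries. -/
theorem Data.rootOk (hV : I.Valid) (h : I.Data occ A σ.mem) (v : Fin I.n) :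
    (∀ u : Fin I.k, σ.mem (I.pRH + u) = σ.mem (I.pRT + v) ↔
      RootOk I.rootH I.rootT (some u) v) ∧
    (σ.mem (I.pRH + I.k) = σ.mem (I.pRT + v) ↔ RootOk I.rootH I.rootT none v) := by
  have h0 : σ.mem (I.pRH + I.k) = 0 := h.rh0 _ le_rfl fun i => (I.rootH i).2.ne
  by_cases hv : ∃ i, I.rootT i = v
  · obtain ⟨i, rfl⟩ := hv
    rw [h0, h.rt]
    refine ⟨fun u => ⟨fun h1 j => ?_, fun h1 => ?_⟩, ⟨fun h1 => by omega, fun h1 => ?_⟩⟩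
    · by_cases hu : ∃ j, I.rootH j = u
      · obtain ⟨j', rfl⟩ := hu
        rw [h.rh] at h1
        obtain rfl : j' = i := Fin.ext (by omega)
        simp [hV.rootH_injective.eq_iff, hV.rootT_injective.eq_iff, eq_comm]
      · rw [h.rh0 u u.2.le fun j hj => hu ⟨j, Fin.ext hj⟩] at h1
        omega
    · rw [Option.some.inj ((h1 i).2 rfl), h.rh]
    · have := (h1 i).2 rfl
      simp at this
  · push Not at hv
    rw [h0, h.rt0 v hv]
    refine ⟨fun u => ⟨fun h1 j => ?_, fun h1 => ?_⟩, ⟨fun _ i => ?_, fun _ => rfl⟩⟩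
    · refine ⟨fun h2 => ?_, fun h2 => absurd h2 (hv j)⟩
      rw [Option.some.inj h2, h.rh] at h1
      omega
    · refine h.rh0 u u.2.le fun j hj => hv j ((h1 j).1 ?_)
      rw [Fin.ext hj]
    · simp [hv i]

theorem St.wp_introOp (hV : I.Valid) (hk : 0 < I.k) (hB : I.Bnd K Z R Cm) (h : I.St occ A X c σ)
    (hc : c + 1 ≤ Cm) {s : ℕ} {w : Fin I.n} (h36 : σ.reg 36 = s)
    (h37 : σ.reg 37 = w) :
    introOp.wp K Z R (fun σ' => Fr 40 σ σ' ∧ ∃ X', I.St occ A X' (c + 1) σ' ∧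
      ∀ S' < I.nM, X' S' ↔ ∃ S, X S ∧ IntroR I.H I.rootH I.rootT I.maxBag s w
        (stOf I.k I.l I.maxBag I.nq S) (stOf I.k I.l I.maxBag I.nq S')) σ := by
  have hdat := h.data.rootOk hV w
  have e5 : I.pRT = I.pRH + (I.k + 1) := rfl
  refine wp_mono ?_ _ _ (h.wp_genOp hB hc (n := I.k + 1)
    (Φ := TIntro I.k I.maxBag I.nq (fun e => I.encode.getD (5 + 2 * e) 0)
      (fun e => I.encode.getD (5 + 2 * e + 1) 0)
      (fun a => σ.mem (I.pRH + a) = σ.mem (I.pRT + w)) s) ?_ (by omega) ?_)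
  · rintro σ' ⟨hf, X', hX', h1⟩
    refine ⟨hf, X', hX', fun S' hS' => (h1 S' hS').trans ?_⟩
    exact exists_congr fun S => and_congr_right fun _ => (introR_iff hk
      (fun e => (I.encode_edge e).1) (fun e => (I.encode_edge e).2) hdat.1 hdat.2).symm
  · simp [h.glob.k]
  · intro a ha S hS S' hS' i hi τ hf hg hd h42 h43 h44 h45
    have d1 := hd.eval_dg hg (S := v 43) (j := v 45) h43 h45 hi
    have d2 := hd.eval_dg hg (S := v 44) (j := v 45) h44 h45 hi
    have h36' : τ.reg 36 = s := (hf _ (by omega)).trans h36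
    have h37' : τ.reg 37 = w := (hf _ (by omega)).trans h37
    -- The two entries are determined by `Data`, so the test has the same outcome in the running
    -- memory as in the memory at the start of the operation.
    have hroot : ∀ m m' : ℕ → ℕ, I.Data occ A m → I.Data occ A m' →
        m (I.pRH + a) = m (I.pRT + w) → m' (I.pRH + a) = m' (I.pRT + w) := by
      intro m m' h1 h2
      have e1 : m (I.pRH + a) = m' (I.pRH + a) := by
        by_cases hu : ∃ j, (I.rootH j : ℕ) = a
        · obtain ⟨j, rfl⟩ := hu
          rw [h1.rh, h2.rh]
        · push Not at hu
          rw [h1.rh0 a (by omega) hu, h2.rh0 a (by omega) hu]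
      have e2 : m (I.pRT + w) = m' (I.pRT + w) := by
        by_cases hu : ∃ j, I.rootT j = w
        · obtain ⟨j, rfl⟩ := hu
          rw [h1.rt, h2.rt]
        · push Not at hu
          rw [h1.rt0 w hu, h2.rt0 w hu]
      rw [e1, e2]
      exact id
    have hroot' : τ.mem (I.pRH + a) = τ.mem (I.pRT + w) ↔ σ.mem (I.pRH + a) = σ.mem (I.pRT + w) :=
      ⟨hroot _ _ hd h.data, hroot _ _ h.data hd⟩
    by_cases hik : i < I.k
    · simp only [tr_mul, tr_eq, tr_cnd, tr_lt, d1, d2, eval_add, eval_ld,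
        eval_v, eval_ofNat, h42, h45, h37', hg.k, hg.rh, hg.rt, TIntro, hik, not_true, false_and,
        or_false, true_and, hroot']
    · have hil : (i - I.k) / (I.maxBag + 1) < I.l := by
        rw [Nat.div_lt_iff_lt_mul (by omega)]
        unfold nL at hi
        omega
      have h7 : 5 + 2 * I.l ≤ I.pRH := by
        have := I.bagPos_mono (Nat.zero_le I.r)
        unfold pRH
        simp only [bagPos, oAdj, oRootT, oRootH] at this ⊢
        omega
      have i1 := hd.inp (5 + 2 * ((i - I.k) / (I.maxBag + 1))) (by omega)
      have i2 := hd.inp (5 + 2 * ((i - I.k) / (I.maxBag + 1)) + 1) (by omega)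
      simp only [tr_mul, tr_eq, tr_cnd, tr_lt, tr_add, d1, d2, eval_mod, eval_sub, eval_add, eval_ld,
        eval_mul, eval_div, eval_v, eval_ofNat, h42, h45, h36', h37', hg.k, hg.P, hg.rh, hg.rt,
        TIntro, hik, not_false_eq_true, false_and, false_or, true_and, hroot', i1, i2]

end RootedInput

/-! ### The main loop -/

namespace Cmd

variable {K Z R : ℕ} {c d : Cmd} {Q Q' : RamState → Prop} {s : RamState}

theorem wp_seq (h : c.wp K Z R Q' s) (h' : ∀ s', Q' s' → d.wp K Z R Q s') :
    (c ;; d).wp K Z R Q s := wp_mono h' c s h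

theorem wp_set {x : ℕ} {e : Ex} (a : ℕ) (he : e.eval s = a) (ha : a < K) (h : Q (s.setReg x a)) :
    (set x e).wp K Z R Q s := by
  subst he
  exact ⟨ha, h⟩

theorem wp_set_seq {x : ℕ} {e : Ex} (a : ℕ) (he : e.eval s = a) (ha : a < K)
    (h : d.wp K Z R Q (s.setReg x a)) : (set x e ;; d).wp K Z R Q s :=
  wp_set (Z := Z) (R := R) a he ha h

theorem wp_sto {e e' : Ex} (a b : ℕ) (he : e.eval s = a) (he' : e'.eval s = b) (hb : b < K)
    (h : Q (s.setMem a b)) : (sto e e').wp K Z R Q s := by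
  subst he he'
  exact ⟨hb, h⟩

theorem wp_sto_seq {e e' : Ex} (a b : ℕ) (he : e.eval s = a) (he' : e'.eval s = b) (hb : b < K)
    (h : d.wp K Z R Q (s.setMem a b)) : (sto e e' ;; d).wp K Z R Q s :=
  wp_sto (Z := Z) (R := R) a b he he' hb h

end Cmd

/-- Use all arcs between the new vertex (register `26`, slot in register `27`) and the vertices in
the slots, and all arcs from the new vertex to forgotten vertices. -/
def arcsCmd : Cmd :=
  forr false 29 (v rP) (set 31 (ld (v aOcc + v 29)) ;;
    set 32 (v 29) ;; set 33 (v 27 + 2) ;;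
    set 34 (v 31 * ld (v rAdj + (v 31 - 1) * v rN + v 26)).not.not ;; arcOp ;;
    set 32 (v 27) ;; set 33 (v 29 + 2) ;;
    set 34 (v 31 * ld (v rAdj + v 26 * v rN + (v 31 - 1))).not.not ;; arcOp) ;;
  set 32 (v 27) ;; set 34 1 ;;
  forr false 29 (v rQ - (v rP + 2)) (set 33 (v rP + 2 + v 29) ;; arcOp)

/-- Put the vertex in register `26` into a free slot, if it is new. -/
def introCmd : Cmd :=
  forr false 27 (v rP) (ite ((ld (v aInt + v 26)).eq 0 * (ld (v aOcc + v 27)).eq 0)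
    (sto (v aInt + v 26) 1 ;; sto (v aOcc + v 27) (v 26 + 1) ;; set 36 (v 27) ;; set 37 (v 26) ;;
      introOp ;; arcsCmd) skip)

/-- Forget the vertices that are not in the current bag. -/
def forgetCmd : Cmd :=
  forr false 24 (v rP) (set 26 (ld (v aOcc + v 24)) ;;
    ite (v 26) (set 29 1 ;;
      forr false 27 (v 23) (ite ((ld (v 22 + 1 + v 27) + 1).eq (v 26)) (set 29 0) skip) ;;
      ite (v 29) (sto (v aOcc + v 24) 0 ;; set 36 (v 24) ;; forgetOp) skip) skip)

/-- Process all bags. -/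
def mainCmd : Cmd :=
  set 22 (v rBag) ;;
  forr true 20 (v rR) (set 23 (ld (v 22)) ;; forgetCmd ;;
    forr false 24 (v 23) (set 26 (ld (v 22 + 1 + v 24)) ;; introCmd) ;;
    set 22 (v 22 + 1 + v 23))

/-! ### Invariant of the main loop and the treatment of arcs. -/

namespace RootedInput

/-- The properties of the slots, when the vertices in `A` have been introduced. -/
structure Sched (I : RootedInput) (occ : ℕ → Option (Fin I.n)) (A : Set (Fin I.n)) : Prop where
  mem : ∀ s < I.maxBag, ∀ a, occ s = some a → a ∈ A
  inj : ∀ s < I.maxBag, ∀ s' < I.maxBag, ∀ a, occ s = some a → occ s' = some a → s = s'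
  closed : ∀ a ∈ A, (∀ s < I.maxBag, occ s ≠ some a) → ∀ w ∉ A, ¬ I.T.Adj a w

/-- The invariant of the main loop. -/
structure Core (I : RootedInput) (occ : ℕ → Option (Fin I.n)) (A : Set (Fin I.n)) (c : ℕ)
    (σ : RamState) : Prop where
  sched : I.Sched occ A
  st : ∃ X, I.St occ A X c σ ∧ Good I.H I.T I.rootH I.rootT I.maxBag I.nq occ A
    (fun _ a b => a ∈ A ∧ b ∈ A) X

variable {I : RootedInput} {K Z R Cm : ℕ} {occ : ℕ → Option (Fin I.n)} {A : Set (Fin I.n)}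
  {X : ℕ → Prop} {c : ℕ} {σ : RamState}

theorem Core.congr (h : I.Core occ A c σ) {τ : RamState} (hf : Fr 20 σ τ)
    (ht : τ.reg rTb = σ.reg rTb) (hm : τ.mem = σ.mem) : I.Core occ A c τ := by
  obtain ⟨X, h1, h2⟩ := h.st
  exact ⟨h.sched, X, h1.congr hf ht hm, h2⟩

theorem Core.mono (h : I.Core occ A c σ) {c' : ℕ} (hc : c ≤ c') : I.Core occ A c' σ := by
  obtain ⟨X, h1, h2⟩ := h.st
  exact ⟨h.sched, X, h1.mono hc, h2⟩

theorem slotVal_lt {n : ℕ} (o : Option (Fin n)) : slotVal o ≤ n := by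
  cases o with
  | none => exact Nat.zero_le _
  | some w => exact w.2

theorem slotVal_ne_zero {n : ℕ} {o : Option (Fin n)} : slotVal o ≠ 0 ↔ ∃ a, o = some a := by
  cases o <;> simp [slotVal]

theorem Bnd.n_lt (hB : I.Bnd K Z R Cm) : I.n + 1 < K := by
  have h := hB.hF
  have h1 : I.n ≤ I.pTab := by unfold pTab pWt; omega
  have h2 := Nat.le_mul_of_pos_left I.nM (show 0 < Cm + 2 by omega)
  have h3 : 1 ≤ (Cm + 2) * I.nM := by
    have := I.nM_pos
    omega
  omega

theorem Data.adj {m : ℕ → ℕ} (h : I.Data occ A m) (a b : Fin I.n) :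
    m (I.oAdj + a * I.n + b) ≠ 0 ↔ I.T.Adj a b := by
  rw [h.inp, encode_adj]
  have h1 := I.bagPos_mono (Nat.zero_le I.r)
  have h2 : I.bagPos 0 = I.oAdj + I.n * I.n := rfl
  have h3 : (a + 1 : ℕ) * I.n ≤ I.n * I.n := Nat.mul_le_mul_right _ a.2
  have h4 := b.2
  unfold pRH
  rw [Nat.add_mul] at h3
  omega

theorem Data.adj_left {m : ℕ → ℕ} (h : I.Data occ A m) (o : Option (Fin I.n)) (w : Fin I.n) :
    slotVal o * m (I.oAdj + (slotVal o - 1) * I.n + w) ≠ 0 ↔ ∃ a, o = some a ∧ I.T.Adj a w := by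
  cases o with
  | none => simp [slotVal]
  | some a =>
    rw [mul_ne_zero_iff]
    simp [slotVal, ← h.adj a w]

theorem Data.adj_right {m : ℕ → ℕ} (h : I.Data occ A m) (o : Option (Fin I.n)) (w : Fin I.n) :
    slotVal o * m (I.oAdj + w * I.n + (slotVal o - 1)) ≠ 0 ↔ ∃ a, o = some a ∧ I.T.Adj w a := by
  cases o with
  | none => simp [slotVal]
  | some a =>
    rw [mul_ne_zero_iff]
    simp [slotVal, ← h.adj w a]

theorem nq_eq : I.nq = I.maxBag + 2 + (I.l * (I.maxBag + 1) + 1) := by unfold nq; omega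

theorem not_not_ne {a : ℕ} : 1 - (1 - a) ≠ 0 ↔ a ≠ 0 := by omega

/-- For vertices in slots the adjacency matrix is consulted in both directions. For forgotten
vertices nothing is looked up: by `Sched.closed` and semi-completeness the arc from the new vertex
is always present, so the arc is enabled for every class. -/
theorem St.wp_arcsCmd (hV : I.Valid) (hk : 0 < I.k) (hB : I.Bnd K Z R Cm) {s : ℕ} {w : Fin I.n}
    (hsch : I.Sched occ A) (hs : s < I.maxBag) (hw : w ∉ A)
    (h : I.St (Function.update occ s (some w)) (insert w A) X c σ)
    (hG : Good I.H I.T I.rootH I.rootT I.maxBag I.nq (Function.update occ s (some w)) (insert w A)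
      (phaseD A w (Function.update occ s (some w)) 0 2) X)
    (hocc : occ s = none)
    (hc : c + 2 * I.maxBag + (I.l * (I.maxBag + 1) + 1) ≤ Cm) (h26 : σ.reg 26 = w)
    (h27 : σ.reg 27 = s) :
    arcsCmd.wp K Z R (fun σ' => Fr 29 σ σ' ∧ ∃ X',
      I.St (Function.update occ s (some w)) (insert w A) X'
        (c + 2 * I.maxBag + (I.l * (I.maxBag + 1) + 1)) σ' ∧
      Good I.H I.T I.rootH I.rootT I.maxBag I.nq (Function.update occ s (some w)) (insert w A)
        (phaseD A w (Function.update occ s (some w)) I.maxBag I.nq) X') σ := by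
  have hirr := hV.semicomplete.1
  have hq := I.nq_eq
  have hZ := hB.hZ
  have hP := hB.hP
  have hK := hB.hK
  have hn := hB.n_lt
  have hwn := w.2
  have hMM : 0 < I.nM * I.nM := by
    have := I.nM_pos
    positivity
  have hCZ : I.k + I.l * (I.maxBag + 1) + 1 ≤ Z := (Nat.le_mul_of_pos_right _ hMM).trans hB.hJ
  have hos : Function.update occ s (some w) s = some w := Function.update_self ..
  generalize hoc : Function.update occ s (some w) = oc at *
  -- Names `0` and `1` denote no vertex, so after `x` slots the treated names are those below `2 +
  -- x`.
  refine wp_forr I.maxBag (by simp [h.glob.P]) (by omega) (by simp; omega)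
    (fun x τ => Fr 29 σ τ ∧ ∃ X', I.St oc (insert w A) X' (c + 2 * x) τ ∧
      Good I.H I.T I.rootH I.rootT I.maxBag I.nq oc (insert w A) (phaseD A w oc x (2 + x)) X')
    ?_ ?_ ?_ ?_
  · rintro x τ τ' h1 h2 ⟨h3, X', h4, h5⟩
    exact ⟨fun y hy => (h1 y (by omega) (by omega)).trans (h3 y hy), X',
      h4.congr (fun y hy => h1 y (by omega) (by omega)) (h1 _ (by omega) (by omega)) h2, h5⟩
  · exact ⟨Fr.refl _ _, X, by simpa using h, by simpa using hG⟩
  · rintro x hx τ ⟨h3, X', h4, h5⟩ hx0 hx1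
    have t26 : τ.reg 26 = w := (h3 _ (by omega)).trans h26
    have t27 : τ.reg 27 = s := (h3 _ (by omega)).trans h27
    have ho : τ.mem (I.pOcc + x) = slotVal (oc x) := h4.data.occ x hx
    have hso := slotVal_lt (oc x)
    refine wp_set_seq (slotVal (oc x)) (by simp [h4.glob.occ, hx0, ho]) (by omega) ?_
    refine wp_set_seq x (by simp [hx0]) (by omega) ?_
    refine wp_set_seq (s + 2) (by simp [t27]) (by omega) ?_
    -- The double negation makes the stored value `0` or `1`, so its word bound is immediate. The
    -- factor `slotVal` switches the arc off for an empty slot.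
    refine wp_set_seq (1 - (1 - slotVal (oc x) * τ.mem (I.oAdj + (slotVal (oc x) - 1) * I.n + w)))
      (by simp [Ex.not, h4.glob.adj, h4.glob.n, t26]) (by omega) ?_
    refine wp_seq (St.wp_arcOp (occ := oc) (A := insert w A) (X := X') (c := c + 2 * x)
      (x := x) (y := s + 2)
      (en := ∃ a, oc x = some a ∧ I.T.Adj a w) hk hB (h4.congr ?_ ?_ ?_) (by omega) hx ?_ ?_ ?_) ?_
    rotate_left 6
    · rintro σ1 ⟨f1, X1, k1, k2⟩
      have u31 : σ1.reg 31 = slotVal (oc x) := by simp [f1 31 (by omega)]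
      have u26 : σ1.reg 26 = w := by simp [f1 26 (by omega), t26]
      have u27 : σ1.reg 27 = s := by simp [f1 27 (by omega), t27]
      have u29 : σ1.reg 29 = x := by simp [f1 29 (by omega), hx0]
      have u30 : σ1.reg 30 = I.maxBag - x := by simp [f1 30 (by omega), hx1]
      have f2 : Fr 29 σ σ1 := h3.trans fun y hy => by
        rw [f1 y (by omega)]
        simp [show y ≠ 31 by omega, show y ≠ 32 by omega, show y ≠ 33 by omega,
          show y ≠ 34 by omega]
      have hG1 := h5.arc_in hirr hs hx (by omega) hw hos k2 k1.tab.lt Iff.rfl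
      refine wp_set_seq s (by simp [u27]) (by omega) ?_
      refine wp_set_seq (x + 2) (by simp [u29]) (by omega) ?_
      refine wp_set_seq (1 - (1 - slotVal (oc x) * σ1.mem (I.oAdj + w * I.n + (slotVal (oc x) - 1))))
        (by simp [Ex.not, k1.glob.adj, k1.glob.n, u26, u31]) (by omega) ?_
      refine wp_mono ?_ _ _ (St.wp_arcOp (occ := oc) (A := insert w A) (X := X1) (c := c + 2 * x + 1)
        (x := s) (y := x + 2)
        (en := ∃ a, oc x = some a ∧ I.T.Adj w a) hk hB (k1.congr ?_ ?_ ?_) (by omega) hs ?_ ?_ ?_)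
      · rintro σ2 ⟨g1, X2, j1, j2⟩
        refine ⟨by simp [g1 29 (by omega), u29], by simp [g1 30 (by omega), u30],
          f2.trans fun y hy => ?_, X2, j1.mono (by omega), ?_⟩
        · rw [g1 y (by omega)]
          simp [show y ≠ 32 by omega, show y ≠ 33 by omega, show y ≠ 34 by omega]
        · rw [← add_assoc]
          rw [add_comm 2 x] at hG1 ⊢
          refine hG1.arc_out hirr hs hx (by omega) (by omega) hw hos j2 j1.tab.lt ?_
          intro ρ b hρ hb
          rw [hρ.slot x hx] at hb
          simp [hb]
      · intro y hy
        simp [show y ≠ 32 by omega, show y ≠ 33 by omega, show y ≠ 34 by omega]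
      · simp
      · rfl
      · simp
      · simp
      · simp only [RamState.setReg_reg, if_true]
        rw [not_not_ne]
        exact k1.data.adj_right (oc x) w
    · intro y hy
      simp [show y ≠ 31 by omega, show y ≠ 32 by omega, show y ≠ 33 by omega, show y ≠ 34 by omega]
    · simp
    · rfl
    · simp
    · simp
    · simp only [RamState.setReg_reg, if_true]
      rw [not_not_ne]
      exact h4.data.adj_left (oc x) w
  · rintro τ ⟨h3, X', h4, h5⟩
    have t27 : τ.reg 27 = s := (h3 _ (by omega)).trans h27
    refine wp_set_seq s (by simp [t27]) (by omega) ?_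
    refine wp_set_seq 1 (by simp) (by omega) ?_
    -- These iterations run through the anonymous classes, the names from `maxBag + 2` to `nq - 1`.
    refine wp_forr (I.l * (I.maxBag + 1) + 1) (by simp [h4.glob.P, h4.glob.q, hq]) (by omega)
      (by simp; omega)
      (fun x υ => Fr 29 σ υ ∧ υ.reg 32 = s ∧ υ.reg 34 = 1 ∧
        ∃ X', I.St oc (insert w A) X' (c + 2 * I.maxBag + x) υ ∧
        Good I.H I.T I.rootH I.rootT I.maxBag I.nq oc (insert w A)
          (phaseD A w oc I.maxBag (2 + I.maxBag + x)) X') ?_ ?_ ?_ ?_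
    · rintro x τ τ' h1 h2 ⟨h3, h32, h34, X', h4, h5⟩
      exact ⟨fun y hy => (h1 y (by omega) (by omega)).trans (h3 y hy),
        (h1 _ (by omega) (by omega)).trans h32, (h1 _ (by omega) (by omega)).trans h34, X',
        h4.congr (fun y hy => h1 y (by omega) (by omega)) (h1 _ (by omega) (by omega)) h2, h5⟩
    · exact ⟨(h3.setReg (by omega)).setReg (by omega), by simp, by simp, X',
        h4.congr (((Fr.refl _ _).setReg (by omega)).setReg (by omega)) (by simp) rfl, h5⟩
    · rintro x hx υ ⟨h3, h32, h34, X', h4, h5⟩ hx0 hx1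
      refine wp_set_seq (I.maxBag + 2 + x) (by simp [h4.glob.P, hx0]) (by omega) ?_
      refine wp_mono ?_ _ _ (St.wp_arcOp (occ := oc) (A := insert w A) (X := X')
        (c := c + 2 * I.maxBag + x) (x := s) (y := I.maxBag + 2 + x)
        (en := True) hk hB (h4.congr ?_ ?_ ?_) (by omega) hs ?_ ?_ ?_)
      · rintro σ2 ⟨g1, X2, j1, j2⟩
        refine ⟨by simp [g1 29 (by omega), hx0], by simp [g1 30 (by omega), hx1],
          h3.trans fun y hy => ?_, by simp [g1 32 (by omega), h32],
          by simp [g1 34 (by omega), h34], X2, j1, ?_⟩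
        · rw [g1 y (by omega)]
          simp [show y ≠ 33 by omega]
        · rw [← add_assoc]
          rw [add_comm 2 I.maxBag] at h5 ⊢
          refine h5.arc_out hirr hs le_rfl (by omega) (by omega) hw hos j2 j1.tab.lt ?_
          intro ρ b hρ hb
          refine ⟨fun _ => ?_, fun _ => trivial⟩
          -- A vertex named by a class is in no slot, because each vertex has only one name. In
          -- particular it is not the new vertex.
          have h6 : ∀ s' < I.maxBag, oc s' ≠ some b := by
            intro s' hs' h7
            have := hρ.inj _ _ _ hb ((hρ.slot s' hs').trans h7)
            omega
          have hbw : b ≠ w := fun h7 => h6 s hs (by rw [hos, h7])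
          have hbA : b ∈ A := (hρ.mem _ _ hb).resolve_left hbw
          refine (hV.semicomplete.2 b w hbw).resolve_left (hsch.closed b hbA (fun s' hs' h7 => ?_) w hw)
          refine h6 s' hs' ?_
          rw [← hoc, Function.update_of_ne, h7]
          rintro rfl
          rw [hocc] at h7
          cases h7
      · exact (Fr.refl _ _).setReg (by omega)
      · simp
      · rfl
      · simpa using h32
      · simp
      · simp [h34]
    · rintro υ ⟨h3, h32, h34, X', h4, h5⟩
      exact ⟨h3, X', h4, by rwa [show 2 + I.maxBag + (I.l * (I.maxBag + 1) + 1) = I.nq by omega] at h5⟩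

end RootedInput

/-! ### Introducing the vertices of a bag and forgetting those that left. -/

namespace RootedInput

variable {I : RootedInput} {K Z R Cm : ℕ} {occ : ℕ → Option (Fin I.n)} {A : Set (Fin I.n)}
  {X : ℕ → Prop} {c : ℕ} {σ : RamState}

theorem Data.setOcc {m : ℕ → ℕ} (h : I.Data occ A m) {s : ℕ} (hs : s < I.maxBag)
    (o : Option (Fin I.n)) :
    I.Data (Function.update occ s o) A (Function.update m (I.pOcc + s) (slotVal o)) := by
  have e1 : I.pTab = I.pWt + (I.nL + 1) := rfl
  have e2 : I.pWt = I.pInt + I.n := rfl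
  have e3 : I.pInt = I.pOcc + I.maxBag := rfl
  have e4 : I.pOcc = I.pRT + I.n := rfl
  have e5 : I.pRT = I.pRH + (I.k + 1) := rfl
  refine ⟨fun a ha => ?_, fun i => ?_, fun u hu h1 => ?_, fun i => ?_, fun w h1 => ?_,
    fun s' hs' => ?_, fun w => ?_, fun i hi => ?_⟩
  · rw [Function.update_of_ne (by omega), h.inp a ha]
  · have := (I.rootH i).2
    rw [Function.update_of_ne (by omega), h.rh i]
  · rw [Function.update_of_ne (by omega), h.rh0 u hu h1]
  · have := (I.rootT i).2
    rw [Function.update_of_ne (by omega), h.rt i]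
  · have := w.2
    rw [Function.update_of_ne (by omega), h.rt0 w h1]
  · by_cases h1 : s' = s
    · subst h1
      rw [Function.update_self, Function.update_self]
    · rw [Function.update_of_ne (by omega), Function.update_of_ne h1, h.occ s' hs']
  · have := w.2
    rw [Function.update_of_ne (by omega), h.int w]
  · rw [Function.update_of_ne (by omega), h.wt i hi]

theorem Data.setInt {m : ℕ → ℕ} (h : I.Data occ A m) (w : Fin I.n) :
    I.Data occ (insert w A) (Function.update m (I.pInt + w) 1) := by
  have e1 : I.pTab = I.pWt + (I.nL + 1) := rfl
  have e2 : I.pWt = I.pInt + I.n := rfl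
  have e3 : I.pInt = I.pOcc + I.maxBag := rfl
  have e4 : I.pOcc = I.pRT + I.n := rfl
  have e5 : I.pRT = I.pRH + (I.k + 1) := rfl
  have hw := w.2
  refine ⟨fun a ha => ?_, fun i => ?_, fun u hu h1 => ?_, fun i => ?_, fun w h1 => ?_,
    fun s' hs' => ?_, fun w' => ?_, fun i hi => ?_⟩
  · rw [Function.update_of_ne (by omega), h.inp a ha]
  · have := (I.rootH i).2
    rw [Function.update_of_ne (by omega), h.rh i]
  · rw [Function.update_of_ne (by omega), h.rh0 u hu h1]
  · have := (I.rootT i).2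
    rw [Function.update_of_ne (by omega), h.rt i]
  · have := w.2
    rw [Function.update_of_ne (by omega), h.rt0 w h1]
  · rw [Function.update_of_ne (by omega), h.occ s' hs']
  · by_cases h1 : w' = w
    · subst h1
      simp
    · have h2 : (w' : ℕ) ≠ w := fun h => h1 (Fin.ext h)
      rw [Function.update_of_ne (by omega), h.int w', Set.mem_insert_iff]
      simp [h1]
  · rw [Function.update_of_ne (by omega), h.wt i hi]

theorem Tab.setMem (h : I.Tab X c σ) {a b : ℕ} (ha : a < I.pTab) : I.Tab X c (σ.setMem a b) := by
  obtain ⟨c', -, hp⟩ := h.pos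
  refine ⟨h.pos, fun S hS => ?_, fun a' ha' => ?_, h.lt⟩
  · rw [RamState.setMem_reg, RamState.setMem_mem, if_neg (by omega), h.mem S hS]
  · rw [RamState.setMem_reg] at ha'
    rw [RamState.setMem_mem, if_neg (by omega), h.fresh a' ha']

theorem Sched.intro (h : I.Sched occ A) {s : ℕ} {w : Fin I.n} (hs : s < I.maxBag) (hw : w ∉ A)
    (hocc : occ s = none) : I.Sched (Function.update occ s (some w)) (insert w A) := by
  refine ⟨fun s' hs' a ha => ?_, fun s' hs' s'' hs'' a h1 h2 => ?_, fun a ha h1 v hv => ?_⟩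
  · rw [Function.update_apply] at ha
    split_ifs at ha with h1
    · exact Set.mem_insert_iff.2 (.inl (Option.some.inj ha).symm)
    · exact Set.mem_insert_of_mem _ (h.mem s' hs' a ha)
  · rw [Function.update_apply] at h1 h2
    split_ifs at h1 h2 with h3 h4 h4
    · omega
    · exact absurd (h.mem _ hs'' _ h2) (Option.some.inj h1 ▸ hw)
    · exact absurd (h.mem _ hs' _ h1) (Option.some.inj h2 ▸ hw)
    · exact h.inj s' hs' s'' hs'' a h1 h2
  · rcases Set.mem_insert_iff.1 ha with rfl | ha
    · exact absurd (Function.update_self ..) (h1 s hs)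
    · refine h.closed a ha (fun s' hs' h2 => h1 s' hs' ?_) v fun h2 => hv (Set.mem_insert_of_mem _ h2)
      rw [Function.update_of_ne, h2]
      rintro rfl
      rw [hocc] at h2
      cases h2

theorem Sched.forget (h : I.Sched occ A) {s : ℕ}
    (hcl : ∀ a, occ s = some a → ∀ w ∉ A, ¬ I.T.Adj a w) :
    I.Sched (Function.update occ s none) A := by
  refine ⟨fun s' hs' a ha => ?_, fun s' hs' s'' hs'' a h1 h2 => ?_, fun a ha h1 v hv => ?_⟩
  · rw [Function.update_apply] at ha
    split_ifs at ha with h1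
    exact h.mem s' hs' a ha
  · rw [Function.update_apply] at h1 h2
    split_ifs at h1 h2 with h3 h4
    exact h.inj s' hs' s'' hs'' a h1 h2
  · by_cases h2 : ∃ s' < I.maxBag, occ s' = some a
    · obtain ⟨s', hs', h3⟩ := h2
      by_cases h4 : s' = s
      · exact hcl a (h4 ▸ h3) v hv
      · exact absurd (by rw [Function.update_of_ne h4, h3]) (h1 s' hs')
    · exact h.closed a ha (fun s' hs' h3 => h2 ⟨s', hs', h3⟩) v hv

variable (I) in
/-- A bound for the number of tables that are made when a vertex is introduced. -/
def stepTabs : ℕ := 1 + 2 * I.maxBag + (I.l * (I.maxBag + 1) + 1)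

theorem Core.wp_intro (hV : I.Valid) (hk : 0 < I.k) (hB : I.Bnd K Z R Cm) {s : ℕ} {w : Fin I.n}
    (h : I.Core occ A c σ) (hs : s < I.maxBag) (hw : w ∉ A) (hocc : occ s = none)
    (hc : c + I.stepTabs ≤ Cm) (h26 : σ.reg 26 = w) (h27 : σ.reg 27 = s) :
    (sto (v aInt + v 26) 1 ;; sto (v aOcc + v 27) (v 26 + 1) ;; set 36 (v 27) ;; set 37 (v 26) ;;
      introOp ;; arcsCmd).wp K Z R (fun σ' => Fr 29 σ σ' ∧
        I.Core (Function.update occ s (some w)) (insert w A) (c + I.stepTabs) σ') σ := by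
  obtain ⟨X, hX, hG⟩ := h.st
  have hn := hB.n_lt
  have hwn := w.2
  have hP := hB.hP
  have hZ := hB.hZ
  have hq := I.nq_eq
  unfold stepTabs at hc ⊢
  have e1 : I.pTab = I.pWt + (I.nL + 1) := rfl
  have e2 : I.pWt = I.pInt + I.n := rfl
  have e3 : I.pInt = I.pOcc + I.maxBag := rfl
  refine wp_sto_seq (I.pInt + w) 1 (by simp [hX.glob.int, h26]) rfl (by omega) ?_
  refine wp_sto_seq (I.pOcc + s) (w + 1) (by simp [hX.glob.occ, h27]) (by simp [h26]) (by omega) ?_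
  refine wp_set_seq s (by simp [h27]) (by omega) ?_
  refine wp_set_seq w (by simp [h26]) (by omega) ?_
  have hX1 : I.St (Function.update occ s (some w)) (insert w A) X c
      ((((σ.setMem (I.pInt + w) 1).setMem (I.pOcc + s) (w + 1)).setReg 36 s).setReg 37 w) :=
    St.congr (σ := (σ.setMem (I.pInt + w) 1).setMem (I.pOcc + s) (w + 1))
      ⟨hX.glob.congr (Fr.refl _ _).setMem.setMem, (hX.data.setInt w).setOcc hs (some w),
        (hX.tab.setMem (by omega)).setMem (by omega)⟩
      (((Fr.refl _ _).setReg (by omega)).setReg (by omega)) (by simp) rfl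
  refine wp_seq (hX1.wp_introOp hV hk hB (by omega) (s := s) (w := w) (by simp) (by simp)) ?_
  rintro σ1 ⟨f1, X1, k1, k2⟩
  have f2 : Fr 29 σ σ1 := fun y hy => by
    rw [f1 y (by omega)]
    simp [show y ≠ 36 by omega, show y ≠ 37 by omega]
  refine wp_mono ?_ _ _ (k1.wp_arcsCmd hV hk hB h.sched hs hw
    (hG.intro hs (by omega) hw hocc k2 k1.tab.lt) hocc (by omega)
    ((f2 _ (by omega)).trans h26) ((f2 _ (by omega)).trans h27))
  rintro σ2 ⟨g1, X2, j1, j2⟩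
  refine ⟨f2.trans g1, h.sched.intro hs hw hocc, X2, j1.mono (by omega), j2.finish ?_⟩
  intro a ha h1
  refine h.sched.closed a ha (fun s' hs' h2 => h1 s' hs' ?_) w hw
  rw [Function.update_of_ne, h2]
  rintro rfl
  rw [hocc] at h2
  cases h2

/-- There is no early exit: the loop visits every slot, and marking the vertex as introduced makes
the test fail afterwards. The count of tables nevertheless charges a full introduction to every
slot, which is harmless for the bound. -/
theorem Core.wp_introCmd (hV : I.Valid) (hk : 0 < I.k) (hB : I.Bnd K Z R Cm) {w : Fin I.n}
    (h : I.Core occ A c σ) (hfree : w ∉ A → ∃ s < I.maxBag, occ s = none)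
    (hc : c + I.maxBag * I.stepTabs ≤ Cm) (h26 : σ.reg 26 = w) :
    introCmd.wp K Z R (fun σ' => Fr 27 σ σ' ∧ ∃ occ',
      I.Core occ' (insert w A) (c + I.maxBag * I.stepTabs) σ' ∧
      ∀ s a, occ' s = some a → occ s = some a ∨ a = w) σ := by
  have hP := hB.hP
  have hZ := hB.hZ
  obtain ⟨X, hX, -⟩ := h.st
  -- Either nothing has happened, because the vertex was known or no free slot has been seen, or the
  -- vertex has been placed. If it is new, `hfree` excludes the first alternative at the end.
  refine wp_forr I.maxBag (by simp [hX.glob.P]) (by omega) (by simp; omega)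
    (fun s τ => Fr 27 σ τ ∧
      ((I.Core occ A c τ ∧ (w ∈ A ∨ ∀ s' < s, occ s' ≠ none)) ∨
        ∃ occ', I.Core occ' (insert w A) (c + s * I.stepTabs) τ ∧
        ∀ s a, occ' s = some a → occ s = some a ∨ a = w)) ?_ ?_ ?_ ?_
  · rintro s τ τ' h1 h2 ⟨h3, h4⟩
    have h5 : Fr 20 τ τ' := fun y hy => h1 y (by omega) (by omega)
    refine ⟨fun y hy => (h1 y (by omega) (by omega)).trans (h3 y hy), ?_⟩
    rcases h4 with ⟨h4, h6⟩ | ⟨occ', h4, h6⟩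
    · exact .inl ⟨h4.congr h5 (h1 _ (by omega) (by omega)) h2, h6⟩
    · exact .inr ⟨occ', h4.congr h5 (h1 _ (by omega) (by omega)) h2, h6⟩
  · exact ⟨Fr.refl _ _, .inl ⟨h, .inr fun s' hs' => by omega⟩⟩
  · rintro s hs τ ⟨h3, h4⟩ hx0 hx1
    have t26 : τ.reg 26 = w := (h3 _ (by omega)).trans h26
    rcases h4 with ⟨h4, h5⟩ | ⟨occ', h4, h5⟩
    · obtain ⟨X1, hX1, -⟩ := h4.st
      have hint := hX1.data.int w
      have hoc := hX1.data.occ s hs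
      have h7 := Nat.mul_le_mul_right I.stepTabs hs
      rw [Nat.succ_mul] at h7
      refine ⟨fun ht => ?_, fun ht => ?_⟩
      · simp only [tr_mul, tr_eq, eval_ld, eval_add, eval_v, eval_ofNat, hX1.glob.int, hX1.glob.occ,
          t26, hx0, hoc] at ht
        have hw : w ∉ A := fun h8 => hint.2 h8 ht.1
        have ho : occ s = none := by
          by_contra h8
          obtain ⟨a, ha⟩ := Option.ne_none_iff_exists'.1 h8
          exact slotVal_ne_zero.2 ⟨a, ha⟩ ht.2
        refine wp_mono ?_ _ _ (h4.wp_intro hV hk hB hs hw ho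
          ((Nat.add_le_add_left (show I.stepTabs ≤ _ by omega) c).trans hc) t26 hx0)
        rintro τ' ⟨g1, g2⟩
        refine ⟨(g1 _ (by omega)).trans hx0, (g1 _ (by omega)).trans hx1,
          h3.trans (g1.mono (by omega)), .inr ⟨_, g2.mono (by rw [Nat.add_mul]; omega), ?_⟩⟩
        intro s' a ha
        rw [Function.update_apply] at ha
        split_ifs at ha with h8
        · exact .inr (Option.some.inj ha).symm
        · exact .inl ha
      · refine ⟨hx0, hx1, h3, .inl ⟨h4, ?_⟩⟩
        rcases h5 with h5 | h5
        · exact .inl h5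
        · by_cases hw : w ∈ A
          · exact .inl hw
          · refine .inr fun s' hs' => ?_
            rcases Nat.lt_succ_iff_lt_or_eq.1 hs' with h8 | rfl
            · exact h5 s' h8
            · intro h9
              refine ht ?_
              simp only [tr_mul, tr_eq, eval_ld, eval_add, eval_v, eval_ofNat, hX1.glob.int,
                hX1.glob.occ, t26, hx0, hoc, h9]
              exact ⟨not_not.1 (mt hint.1 hw), rfl⟩
    · refine ⟨fun ht => ?_, fun ht => ⟨hx0, hx1, h3, .inr ⟨occ', h4.mono ?_, h5⟩⟩⟩
      · exfalso
        obtain ⟨X1, hX1, -⟩ := h4.st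
        have hint := (hX1.data.int w).2 (Set.mem_insert _ _)
        simp only [tr_mul, tr_eq, eval_ld, eval_add, eval_v, eval_ofNat, hX1.glob.int, t26] at ht
        exact hint ht.1
      · rw [Nat.add_mul]
        omega
  · rintro τ ⟨h3, ⟨h4, h5⟩ | h4⟩
    · have hw : w ∈ A := by
        by_contra hw
        obtain ⟨s, hs, h6⟩ := hfree hw
        exact (h5.resolve_left hw) s hs h6
      refine ⟨h3, occ, ?_, fun s a ha => .inl ha⟩
      rw [Set.insert_eq_of_mem hw]
      exact h4.mono (by omega)
    · exact ⟨h3, h4⟩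

/-- The vertices of the first `i` bags. -/
def before (I : RootedInput) (i : ℕ) : Set (Fin I.n) := {a | ∃ i' : Fin I.r, i' < i ∧ a ∈ I.bagList i'}

/-- The bags of `a` form an interval that ends before bag `i`, while `w` occurs only from bag `i`
on. So they share no bag, and no bag of `a` lies to the right of a bag of `w`, as an arc from `a` to
`w` would require. -/
theorem not_adj_of_before (hV : I.Valid) (i : Fin I.r) {a w : Fin I.n} (ha : a ∈ I.before i)
    (hai : a ∉ I.bagList i) (hw : w ∉ I.before i) : ¬ I.T.Adj a w := by
  obtain ⟨i', hi', ha'⟩ := ha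
  have key : ∀ j : Fin I.r, i < j → a ∉ I.bagList j := fun j hj h => hai <| by
    have := hV.decomposition.inter_subset i' i j hi' hj
      (Finset.mem_inter.2 ⟨List.mem_toFinset.2 ha', List.mem_toFinset.2 h⟩)
    exact List.mem_toFinset.1 this
  have key' : ∀ j : Fin I.r, w ∈ I.bagList j → i ≤ j := fun j hj => by
    by_contra h
    exact hw ⟨j, by simpa using h, hj⟩
  intro hT
  rcases hV.decomposition.arc a w hT with ⟨j, h1, h2⟩ | ⟨j, j', h3, h1, h2⟩
  · have h1 := List.mem_toFinset.1 h1
    have h2 := List.mem_toFinset.1 h2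
    rcases (key' j h2).lt_or_eq with h4 | rfl
    · exact key j h4 h1
    · exact hai h1
  · have h1 := List.mem_toFinset.1 h1
    have h2 := List.mem_toFinset.1 h2
    exact key j ((key' j' h2).trans_lt h3) h1

theorem before_succ (i : Fin I.r) : I.before (i + 1) = I.before i ∪ {a | a ∈ I.bagList i} := by
  ext a
  simp only [before, Set.mem_ofPred_eq, Set.mem_union, Nat.lt_succ_iff_lt_or_eq]
  constructor
  · rintro ⟨i', h1 | h1, h2⟩
    · exact .inl ⟨i', h1, h2⟩
    · exact .inr (Fin.ext h1 ▸ h2)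
  · rintro (⟨i', h1, h2⟩ | h2)
    · exact ⟨i', .inl h1, h2⟩
    · exact ⟨i, .inr rfl, h2⟩

theorem Data.bag {m : ℕ → ℕ} (h : I.Data occ A m) (i : Fin I.r) :
    m (I.bagPos i) = (I.bagList i).length ∧
    ∀ j (hj : j < (I.bagList i).length), m (I.bagPos i + 1 + j) = (I.bagList i)[j] := by
  have h1 := I.bagPos_succ i
  have h2 : I.bagPos (i + 1) ≤ I.pRH := I.bagPos_mono i.2
  refine ⟨?_, fun j hj => ?_⟩
  · rw [h.inp _ (by omega), (I.encode_bag i).1]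
  · rw [h.inp _ (by omega), (I.encode_bag i).2 j hj]

/-- A vertex is forgotten just when it is missing from the current bag, and at that moment
`not_adj_of_before` supplies the closure property which the transition needs. -/
theorem Core.wp_forgetCmd (hV : I.Valid) (hB : I.Bnd K Z R Cm) (i : Fin I.r)
    (h : I.Core occ (I.before i) c σ) (hc : c + I.maxBag ≤ Cm) (h22 : σ.reg 22 = I.bagPos i)
    (h23 : σ.reg 23 = (I.bagList i).length) :
    forgetCmd.wp K Z R (fun σ' => Fr 24 σ σ' ∧ ∃ occ',
      I.Core occ' (I.before i) (c + I.maxBag) σ' ∧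
      ∀ s < I.maxBag, ∀ a, occ' s = some a → a ∈ I.bagList i) σ := by
  have hP := hB.hP
  have hZ := hB.hZ
  have hn := hB.n_lt
  have hlen := I.length_le_maxBag i
  obtain ⟨X, hX, -⟩ := h.st
  refine wp_forr I.maxBag (by simp [hX.glob.P]) (by omega) (by simp; omega)
    (fun s τ => Fr 24 σ τ ∧ ∃ occ', I.Core occ' (I.before i) (c + s) τ ∧
      ∀ s' < s, ∀ a, occ' s' = some a → a ∈ I.bagList i) ?_ ?_ ?_ ?_
  · rintro s τ τ' h1 h2 ⟨h3, occ', h4, h5⟩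
    exact ⟨fun y hy => (h1 y (by omega) (by omega)).trans (h3 y hy), occ',
      h4.congr (fun y hy => h1 y (by omega) (by omega)) (h1 _ (by omega) (by omega)) h2, h5⟩
  · exact ⟨Fr.refl _ _, occ, h, fun s' hs' => by omega⟩
  · rintro s hs τ ⟨h3, occ', h4, h5⟩ hx0 hx1
    have t22 : τ.reg 22 = I.bagPos i := (h3 _ (by omega)).trans h22
    have t23 : τ.reg 23 = (I.bagList i).length := (h3 _ (by omega)).trans h23
    obtain ⟨X1, hX1, hG1⟩ := h4.st
    have hoc := hX1.data.occ s hs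
    have hsl := slotVal_lt (occ' s)
    refine wp_set_seq (slotVal (occ' s)) (by simp [hX1.glob.occ, hx0, hoc]) (by omega) ?_
    refine ⟨fun ht => ?_, fun ht => ?_⟩
    · obtain ⟨a, ha⟩ := slotVal_ne_zero.1 (show slotVal (occ' s) ≠ 0 by simpa using ht)
      refine wp_set_seq 1 rfl (by omega) ?_
      refine wp_seq (wp_forr (Q := fun υ => Fr 27 ((τ.setReg 26 (slotVal (occ' s))).setReg 29 1) υ ∧
          υ.reg rTb = τ.reg rTb ∧ υ.mem = τ.mem ∧ (υ.reg 29 ≠ 0 ↔ a ∉ I.bagList i))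
        (I.bagList i).length (by simp [t23]) (by omega) (by simp; omega)
        (fun j υ => Fr 27 ((τ.setReg 26 (slotVal (occ' s))).setReg 29 1) υ ∧
          υ.reg rTb = τ.reg rTb ∧ υ.mem = τ.mem ∧ (υ.reg 29 ≠ 0 ↔
          ∀ j' < j, ∀ hj' : j' < (I.bagList i).length, (I.bagList i)[j'] ≠ a)) ?_ ?_ ?_ ?_) ?_
      · rintro j υ υ' g1 g2 ⟨g3, g4, g5, g6⟩
        rw [g2, g1 900 (by omega) (by omega), g1 29 (by omega) (by omega)]
        exact ⟨fun y hy => (g1 y (by omega) (by omega)).trans (g3 y hy), g4, g5, g6⟩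
      · exact ⟨Fr.refl _ _, by simp, rfl, by simp⟩
      · rintro j hj υ ⟨g3, g4, g5, g6⟩ hy0 hy1
        have u22 : υ.reg 22 = I.bagPos i := by rw [g3 _ (by omega)]; simp [t22]
        have u26 : υ.reg 26 = a + 1 := by rw [g3 _ (by omega)]; simp [ha, slotVal]
        have hbj := (hX1.data.bag i).2 j hj
        have htr : ((ld (v 22 + 1 + v 27) + 1).eq (v 26)).Tr υ ↔ (I.bagList i)[j] = a := by
          simp only [tr_eq, eval_add, eval_ld, eval_v, eval_ofNat, u22, hy0, g5, hbj, u26,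
            Fin.ext_iff]
          omega
        refine ⟨fun h7 => ?_, fun h7 => ?_⟩
        · refine wp_set 0 rfl (by omega) ⟨by simpa using hy0, by simpa using hy1,
            g3.setReg (by omega), by simpa using g4, g5, ?_⟩
          simp only [RamState.setReg_reg, if_true, ne_eq, not_true, false_iff]
          intro h8
          exact h8 j (by omega) hj (htr.1 h7)
        · refine ⟨hy0, hy1, g3, g4, g5, g6.trans ⟨fun h8 j' hj' => ?_, fun h8 j' hj' =>
            h8 j' (by omega)⟩⟩
          rcases Nat.lt_succ_iff_lt_or_eq.1 hj' with h9 | rfl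
          · exact h8 j' h9
          · exact fun _ h9 => h7 (htr.2 h9)
      · rintro υ ⟨g3, g4, g5, g6⟩
        refine ⟨g3, g4, g5, g6.trans ⟨fun h8 h9 => ?_, fun h8 j' hj' h9 h10 => ?_⟩⟩
        · obtain ⟨j, hj, h10⟩ := List.mem_iff_getElem.1 h9
          exact h8 j hj hj h10
        · exact h8 (h10 ▸ List.getElem_mem h9)
      · rintro υ ⟨g3, g4, g5, g6⟩
        have f1 : Fr 26 τ υ := fun y hy => by
          rw [g3 y (by omega)]
          simp [show y ≠ 26 by omega, show y ≠ 29 by omega]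
        refine ⟨fun h7 => ?_, fun h7 => ?_⟩
        · have hab := g6.1 h7
          have hai := h4.sched.mem s hs a ha
          have hcl : ∀ b, occ' s = some b → ∀ w ∉ I.before i, ¬ I.T.Adj b w := by
            intro b hb w hw
            obtain rfl := Option.some.inj (ha.symm.trans hb)
            exact not_adj_of_before hV i hai hab hw
          have hX2 := hX1.congr (f1.mono (by omega)) g4 g5
          have e1 : I.pTab = I.pWt + (I.nL + 1) := rfl
          have e2 : I.pWt = I.pInt + I.n := rfl
          have e3 : I.pInt = I.pOcc + I.maxBag := rfl
          have u24 : υ.reg 24 = s := (f1 _ (by omega)).trans hx0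
          refine wp_sto_seq (I.pOcc + s) 0 (by simp [hX2.glob.occ, u24]) rfl (by omega) ?_
          refine wp_set_seq s (by simp [u24]) (by omega) ?_
          have hX3 : I.St (Function.update occ' s none) (I.before i) X1 (c + s)
              ((υ.setMem (I.pOcc + s) 0).setReg 36 s) :=
            St.congr (σ := υ.setMem (I.pOcc + s) 0) ⟨hX2.glob.congr (Fr.refl _ _).setMem,
              hX2.data.setOcc hs none, hX2.tab.setMem (by omega)⟩
              ((Fr.refl _ _).setReg (by omega)) (by simp) rfl
          refine wp_mono ?_ _ _ (hX3.wp_forgetOp hB (by omega) hs (by simp))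
          rintro υ' ⟨f2, X', k1, k2⟩
          have f3 : Fr 26 τ υ' := f1.trans fun y hy => by
            rw [f2 y (by omega)]
            simp [show y ≠ 36 by omega]
          refine ⟨(f3 _ (by omega)).trans hx0, (f3 _ (by omega)).trans hx1,
            h3.trans (f3.mono (by omega)), _, ⟨h4.sched.forget hcl, X', k1,
              hG1.forget hs I.nq_eq.ge (fun b w hb => hcl b hb w) k2 k1.tab.lt⟩, ?_⟩
          intro s' hs' b hb
          rw [Function.update_apply] at hb
          split_ifs at hb with h8
          exact h5 s' (by omega) b hb
        · refine ⟨(f1 _ (by omega)).trans hx0, (f1 _ (by omega)).trans hx1,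
            h3.trans (f1.mono (by omega)), occ',
            (h4.congr (f1.mono (by omega)) g4 g5).mono (by omega), ?_⟩
          intro s' hs' b hb
          rcases Nat.lt_succ_iff_lt_or_eq.1 hs' with h8 | rfl
          · exact h5 s' h8 b hb
          · obtain rfl := Option.some.inj (ha.symm.trans hb)
            exact not_not.1 (mt g6.2 h7)
    · refine ⟨by simpa using hx0, by simpa using hx1, h3.setReg (by omega), occ',
        (h4.congr ((Fr.refl _ _).setReg (by omega)) (by simp) rfl).mono (by omega), ?_⟩
      intro s' hs' b hb
      rcases Nat.lt_succ_iff_lt_or_eq.1 hs' with h8 | rfl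
      · exact h5 s' h8 b hb
      · exact absurd (slotVal_ne_zero.2 ⟨b, hb⟩) (by simpa using ht)
  · rintro τ ⟨h3, h4⟩
    exact ⟨h3, h4⟩

end RootedInput

namespace RootedInput

variable {I : RootedInput} {K Z R Cm : ℕ} {occ : ℕ → Option (Fin I.n)} {A : Set (Fin I.n)}
  {X : ℕ → Prop} {c : ℕ} {σ : RamState}

/-- After forgetting, the occupied slots hold distinct vertices of the current bag other than `w`,
hence fewer than the size of the bag, and there are at least that many slots. -/
theorem Sched.exists_free (h : I.Sched occ A) (i : Fin I.r) {w : Fin I.n}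
    (hw : w ∉ A) (hwi : w ∈ I.bagList i)
    (hocc : ∀ s < I.maxBag, ∀ a, occ s = some a → a ∈ I.bagList i) :
    ∃ s < I.maxBag, occ s = none := by
  by_contra! hne
  have h1 : ∀ s : Fin I.maxBag, ∃ a, occ s = some a := fun s =>
    Option.ne_none_iff_exists'.1 (hne s s.2)
  choose f hf using h1
  have hinj : Function.Injective f := fun s s' hs =>
    Fin.ext (h.inj s s.2 s' s'.2 (f s) (hf s) (by rw [hs, hf]))
  have hsub : Finset.univ.image f ⊆ (I.bagList i).toFinset.erase w := by
    intro a ha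
    obtain ⟨s, -, rfl⟩ := Finset.mem_image.1 ha
    refine Finset.mem_erase.2 ⟨fun h1 => hw (h1 ▸ h.mem s s.2 _ (hf s)), ?_⟩
    exact List.mem_toFinset.2 (hocc s s.2 _ (hf s))
  have hcard := Finset.card_le_card hsub
  rw [Finset.card_image_of_injective _ hinj, Finset.card_univ, Fintype.card_fin,
    Finset.card_erase_of_mem (List.mem_toFinset.2 hwi)] at hcard
  have h2 := List.toFinset_card_le (I.bagList i)
  have h3 := I.length_le_maxBag i
  have h4 : 0 < (I.bagList i).toFinset.card := Finset.card_pos.2 ⟨w, List.mem_toFinset.2 hwi⟩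
  omega

variable (I) in
/-- A bound for the number of tables that are made for a bag. -/
def bagTabs : ℕ := I.maxBag + I.maxBag * (I.maxBag * I.stepTabs)

theorem Core.wp_mainCmd (hV : I.Valid) (hk : 0 < I.k) (hB : I.Bnd K Z R Cm)
    (h : I.Core occ ∅ 0 σ) (hc : I.r * I.bagTabs ≤ Cm) :
    mainCmd.wp K Z R (fun σ' => ∃ occ', I.Core occ' Set.univ (I.r * I.bagTabs) σ') σ := by
  have hP := hB.hP
  have hZ := hB.hZ
  have hn := hB.n_lt
  have hr := hB.hr
  have e1 : I.pTab = I.pWt + (I.nL + 1) := rfl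
  have e2 : I.pWt = I.pInt + I.n := rfl
  have e3 : I.pInt = I.pOcc + I.maxBag := rfl
  have e4 : I.pOcc = I.pRT + I.n := rfl
  have e5 : I.pRT = I.pRH + (I.k + 1) := rfl
  have hF := hB.hF
  have hpos : ∀ i ≤ I.r, I.bagPos i < K := by
    intro i hi
    have : I.bagPos i ≤ I.pRH := I.bagPos_mono hi
    omega
  obtain ⟨X, hX, -⟩ := h.st
  refine wp_set_seq (I.bagPos 0) (by simp [hX.glob.bag]) (hpos 0 (Nat.zero_le _)) ?_
  refine wp_forr I.r (by simp [hX.glob.r]) hr (by simpa using hB.hR)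
    (fun i τ => τ.reg 22 = I.bagPos i ∧ ∃ occ', I.Core occ' (I.before i) (i * I.bagTabs) τ)
    ?_ ?_ ?_ ?_
  · rintro i τ τ' h1 h2 ⟨h3, occ', h4⟩
    exact ⟨(h1 _ (by omega) (by omega)).trans h3, occ',
      h4.congr (fun y hy => h1 y (by omega) (by omega)) (h1 _ (by omega) (by omega)) h2⟩
  · refine ⟨by simp, occ, ?_⟩
    have : I.before 0 = ∅ := by
      ext a
      simp [before]
    rw [this, zero_mul]
    exact h.congr ((Fr.refl _ _).setReg (by omega)) (by simp) rfl
  · rintro i hi τ ⟨h3, occ', h4⟩ hx0 hx1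
    obtain ⟨X1, hX1, -⟩ := h4.st
    have hbag := hX1.data.bag ⟨i, hi⟩
    have hlen := I.length_le_maxBag ⟨i, hi⟩
    have hcm := Nat.mul_le_mul_right I.bagTabs hi
    rw [Nat.succ_mul] at hcm
    have hbt : I.bagTabs = I.maxBag + I.maxBag * (I.maxBag * I.stepTabs) := rfl
    refine wp_set_seq (I.bagList ⟨i, hi⟩).length (by simp [h3, hbag.1]) (by omega) ?_
    refine wp_seq (Core.wp_forgetCmd (occ := occ') (c := i * I.bagTabs) hV hB ⟨i, hi⟩
      (h4.congr ((Fr.refl _ _).setReg (by omega)) (by simp) rfl) (by omega) (by simpa using h3)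
      (by simp)) ?_
    rintro σ1 ⟨f1, occ1, k1, k2⟩
    have u23 : σ1.reg 23 = (I.bagList ⟨i, hi⟩).length := by simp [f1 23 (by omega)]
    have u22 : σ1.reg 22 = I.bagPos i := by simp [f1 22 (by omega), h3]
    have u20 : σ1.reg 20 = i := by simp [f1 20 (by omega), hx0]
    have u21 : σ1.reg 21 = I.r - i := by simp [f1 21 (by omega), hx1]
    -- The slots keep containing only vertices of the current bag, so the argument for a free slot
    -- applies to each of its vertices in turn.
    refine wp_seq (wp_forr (Q := fun υ => Fr 24 σ1 υ ∧ ∃ occ2, I.Core occ2 (I.before (i + 1))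
        ((i + 1) * I.bagTabs) υ) (I.bagList ⟨i, hi⟩).length (by simp [u23]) (by omega)
      (by simp; omega) (fun j υ => Fr 24 σ1 υ ∧ ∃ occ2, I.Core occ2
        (I.before i ∪ {a | a ∈ (I.bagList ⟨i, hi⟩).take j})
        (i * I.bagTabs + I.maxBag + j * (I.maxBag * I.stepTabs)) υ ∧
        ∀ s < I.maxBag, ∀ a, occ2 s = some a → a ∈ I.bagList ⟨i, hi⟩) ?_ ?_ ?_ ?_) ?_
    · rintro j υ υ' g1 g2 ⟨g3, occ2, g4, g5⟩
      exact ⟨fun y hy => (g1 y (by omega) (by omega)).trans (g3 y hy), occ2,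
        g4.congr (fun y hy => g1 y (by omega) (by omega)) (g1 _ (by omega) (by omega)) g2, g5⟩
    · exact ⟨Fr.refl _ _, occ1, by simpa using k1, k2⟩
    · rintro j hj υ ⟨g3, occ2, g4, g5⟩ hy0 hy1
      obtain ⟨X2, hX2, -⟩ := g4.st
      have hbj := (hX2.data.bag ⟨i, hi⟩).2 j hj
      have hlt := ((I.bagList ⟨i, hi⟩)[j]).2
      have hjm : (j + 1) * (I.maxBag * I.stepTabs) ≤ I.maxBag * (I.maxBag * I.stepTabs) :=
        Nat.mul_le_mul_right _ (hj.trans_le hlen)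
      rw [Nat.succ_mul] at hjm
      have v22 : υ.reg 22 = I.bagPos i := (g3 _ (by omega)).trans u22
      have hbj' : υ.mem (υ.reg 22 + 1 + υ.reg 24) = (I.bagList ⟨i, hi⟩)[j] := by
        rw [v22, hy0, hbj]
      refine wp_set_seq ((I.bagList ⟨i, hi⟩)[j] : ℕ) (by simpa using hbj') (by omega) ?_
      refine wp_mono ?_ _ _ (Core.wp_introCmd (occ := occ2)
        (A := I.before i ∪ {a | a ∈ (I.bagList ⟨i, hi⟩).take j})
        (c := i * I.bagTabs + I.maxBag + j * (I.maxBag * I.stepTabs))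
        (w := (I.bagList ⟨i, hi⟩)[j]) hV hk hB
        (g4.congr ((Fr.refl _ _).setReg (by omega)) (by simp) rfl)
        (fun hw => g4.sched.exists_free ⟨i, hi⟩ hw (List.getElem_mem hj) g5) (by omega)
        (by simp))
      rintro υ' ⟨f2, occ3, m1, m2⟩
      have f3 : Fr 26 υ υ' := fun y hy => by
        rw [f2 y (by omega)]
        simp [show y ≠ 26 by omega]
      refine ⟨(f3 _ (by omega)).trans hy0, (f3 _ (by omega)).trans hy1, g3.trans (f3.mono (by omega)),
        occ3, ?_, ?_⟩
      · have : I.before i ∪ {a | a ∈ (I.bagList ⟨i, hi⟩).take (j + 1)} =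
            insert (I.bagList ⟨i, hi⟩)[j] (I.before i ∪ {a | a ∈ (I.bagList ⟨i, hi⟩).take j}) := by
          ext a
          rw [← List.take_concat_get' _ _ hj]
          simp only [Set.mem_union, Set.mem_ofPred_eq, List.mem_append, List.mem_singleton,
            Set.mem_insert_iff]
          tauto
        rw [this]
        exact m1.mono (by rw [Nat.add_mul]; omega)
      · intro s hs a ha
        rcases m2 s a ha with h5 | rfl
        · exact g5 s hs a h5
        · exact List.getElem_mem hj
    · rintro υ ⟨g3, occ2, g4, g5⟩
      refine ⟨g3, occ2, ?_⟩
      rw [I.before_succ ⟨i, hi⟩]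
      rw [List.take_length] at g4
      refine g4.mono ?_
      have := Nat.mul_le_mul_right (I.maxBag * I.stepTabs) hlen
      rw [Nat.succ_mul]
      omega
    · rintro υ ⟨g3, occ2, g4⟩
      have hp := I.bagPos_succ ⟨i, hi⟩
      refine wp_set (I.bagPos (i + 1)) ?_ (hpos _ hi) ⟨?_, ?_, by simp, occ2, ?_⟩
      · rw [hp]
        simp [g3 22 (by omega), g3 23 (by omega), u22, u23]
      · simp [g3 20 (by omega), u20]
      · simp [g3 21 (by omega), u21]
      · exact g4.congr ((Fr.refl _ _).setReg (by omega)) (by simp) rfl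
  · rintro τ ⟨-, occ', h4⟩
    refine ⟨occ', ?_⟩
    have : I.before I.r = Set.univ := by
      ext a
      obtain ⟨i, hi⟩ := hV.decomposition.cover a
      simpa [before] using ⟨i, List.mem_toFinset.1 hi⟩
    rwa [this] at h4

end RootedInput

/-! ### The whole program -/

/-- Read the sizes and compute the layout of the memory. -/
def headCmd : Cmd :=
  set rL (ld 1) ;; set rT (ld 2) ;; set rN (ld 3) ;; set rR (ld 4) ;;
  set rRH (5 + 2 * v rL) ;; set rRT (v rRH + v rT) ;; set rAdj (v rRT + v rT) ;;
  set rBag (v rAdj + v rN * v rN) ;; set rP 0 ;; set 22 (v rBag) ;;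
  forr true 20 (v rR) (set 23 (ld (v 22)) ;; ite ((v rP).lt (v 23)) (set rP (v 23)) skip ;;
    set 22 (v 22 + 1 + v 23))

/-- Compute the remaining positions. -/
def layoutCmd : Cmd :=
  set aRH (v 22) ;; set aRT (v 22 + (v rK + 1)) ;; set aOcc (v aRT + v rN) ;;
  set aInt (v aOcc + v rP) ;; set aWt (v aInt + v rN) ;; set rLen (v rK + v rL * (v rP + 1)) ;;
  set rQ (v rP + 3 + v rL * (v rP + 1)) ;; set rTb (v aWt + (v rLen + 1))

/-- Make the tables of roots. -/
def rootCmd : Cmd :=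
  forr false 20 (v rT) (sto (v aRH + ld (v rRH + v 20)) (v 20 + 1) ;;
    sto (v aRT + ld (v rRT + v 20)) (v 20 + 1))

/-- Make the table of weights and the first table of states. -/
def weightCmd : Cmd :=
  sto (v aWt) 1 ;;
  forr false 20 (v rLen) (ite ((v 20).lt (v rK)) (sto (v aWt + (v 20 + 1)) (ld (v aWt + v 20) * 2))
    (sto (v aWt + (v 20 + 1)) (ld (v aWt + v 20) * v rQ))) ;;
  set rM (ld (v aWt + v rLen)) ;; sto (v rTb) 1

/-- The program. -/
def progCmd : Cmd :=
  set rK (ld 0) ;; ite (v rK)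
    (headCmd ;; layoutCmd ;; rootCmd ;; weightCmd ;; mainCmd ;; finOp ;; set 0 (ld (v rTb)).not.not)
    (set 0 1)

/-! ### Preparation of the memory and correctness of the whole program. -/

namespace RootedInput

variable {I : RootedInput} {K Z R Cm : ℕ} {σ : RamState}

/-- The registers after `headCmd`. -/
structure Head (I : RootedInput) (σ : RamState) : Prop where
  k : σ.reg rK = I.k
  l : σ.reg rL = I.l
  t : σ.reg rT = I.t
  n : σ.reg rN = I.n
  r : σ.reg rR = I.r
  rh : σ.reg rRH = I.oRootH
  rt : σ.reg rRT = I.oRootT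
  adj : σ.reg rAdj = I.oAdj
  bag : σ.reg rBag = I.bagPos 0

theorem Head.congr (h : I.Head σ) {τ : RamState} (hf : ∀ y < 11, y ≠ rP → τ.reg y = σ.reg y) :
    I.Head τ := by
  constructor <;> rw [hf _ (by omega) (by omega)]
  exacts [h.k, h.l, h.t, h.n, h.r, h.rh, h.rt, h.adj, h.bag]

theorem Bnd.pos_lt (hB : I.Bnd K Z R Cm) : I.pTab + I.nM + I.nM < K := by
  have h := hB.hF
  have h2 := Nat.mul_le_mul_right I.nM (show 2 ≤ Cm + 2 by omega)
  omega

theorem bagPos_le (I : RootedInput) {i : ℕ} (hi : i ≤ I.r) : I.bagPos i ≤ I.pRH := I.bagPos_mono hi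

theorem pRH_le (I : RootedInput) : I.pRH + (I.k + 1) + I.n + I.maxBag + I.n + (I.nL + 1) = I.pTab :=
  rfl

theorem wp_headCmd (hB : I.Bnd K Z R Cm) (hk : σ.reg rK = I.k)
    (hm : σ.mem = fun a => I.encode.getD a 0) :
    headCmd.wp K Z R (fun σ' => I.Head σ' ∧ σ'.reg rP = I.maxBag ∧ σ'.reg 22 = I.pRH ∧
      σ'.mem = σ.mem) σ := by
  obtain ⟨m0, m1, m2, m3, m4⟩ := I.encode_head
  have hp := hB.pos_lt
  have hl := I.pRH_le
  have hb := I.bagPos_le (Nat.zero_le _)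
  have hb0 : I.bagPos 0 = 5 + 2 * I.l + I.t + I.t + I.n * I.n := rfl
  have hr := hB.hr
  have hK := hB.hK
  have hn := hB.n_lt
  refine wp_set_seq I.l (by rw [← m1, eval_ld, hm]; rfl) (by omega) ?_
  refine wp_set_seq I.t (by rw [← m2, eval_ld, RamState.setReg_mem, hm]; rfl) (by omega) ?_
  refine wp_set_seq I.n (by rw [← m3, eval_ld]; simp only [RamState.setReg_mem, hm]; rfl)
    (by omega) ?_
  refine wp_set_seq I.r (by rw [← m4, eval_ld]; simp only [RamState.setReg_mem, hm]; rfl)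
    (by omega) ?_
  refine wp_set_seq I.oRootH (by simp [oRootH]) (by unfold oRootH; omega) ?_
  refine wp_set_seq I.oRootT (by simp [oRootT]) (by unfold oRootT oRootH; omega) ?_
  refine wp_set_seq I.oAdj (by simp [oAdj]) (by unfold oAdj oRootT oRootH; omega) ?_
  refine wp_set_seq (I.bagPos 0) (by simp [bagPos]) (by omega) ?_
  refine wp_set_seq 0 rfl (by omega) ?_
  refine wp_set_seq (I.bagPos 0) (by simp) (by omega) ?_
  refine wp_forr I.r (by simp) hr (by simpa using hB.hR)
    (fun i τ => I.Head τ ∧ τ.reg 22 = I.bagPos i ∧ τ.mem = σ.mem ∧ τ.reg rP ≤ I.maxBag ∧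
      ∀ i' : Fin I.r, i' < i → (I.bagList i').length ≤ τ.reg rP) ?_ ?_ ?_ ?_
  · rintro i τ τ' h1 h2 ⟨h3, h4, h5, h6, h7⟩
    rw [h1 6 (by omega) (by omega), h1 22 (by omega) (by omega), h2]
    exact ⟨h3.congr fun y hy _ => h1 y (by omega) (by omega), h4, h5, h6, h7⟩
  · exact ⟨⟨by simp [hk], by simp, by simp, by simp, by simp, by simp, by simp, by simp, by simp⟩,
      by simp, by simp, by simp, fun i' hi' => by omega⟩
  · rintro i hi τ ⟨h3, h4, h5, h6, h7⟩ hx0 hx1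
    have hbl := (I.encode_bag ⟨i, hi⟩).1
    have hlen := I.length_le_maxBag ⟨i, hi⟩
    have hs := I.bagPos_succ ⟨i, hi⟩
    have hs' := I.bagPos_le (show i + 1 ≤ I.r from hi)
    simp only at hs hbl
    refine wp_set_seq (I.bagList ⟨i, hi⟩).length (by rw [← hbl]; simp [h4, h5, hm]) (by omega) ?_
    refine wp_seq (Q' := fun τ' => I.Head τ' ∧ τ'.reg 22 = I.bagPos i ∧ τ'.mem = σ.mem ∧
      τ'.reg rP ≤ I.maxBag ∧ (∀ i' : Fin I.r, i' < i + 1 → (I.bagList i').length ≤ τ'.reg rP) ∧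
      τ'.reg 23 = (I.bagList ⟨i, hi⟩).length ∧ τ'.reg 20 = i ∧ τ'.reg 21 = I.r - i)
      ⟨fun ht => ?_, fun ht => ?_⟩ ?_
    · have ht' : τ.reg rP < (I.bagList ⟨i, hi⟩).length := by simpa using ht
      refine wp_set (I.bagList ⟨i, hi⟩).length (by simp) (by omega)
        ⟨h3.congr fun y hy hy' => ?_, by simp [h4], h5, by simpa using hlen, fun i' hi' => ?_,
          by simp, by simp [hx0], by simp [hx1]⟩
      · simp [hy', show y ≠ 23 by omega]
      · simp only [RamState.setReg_reg, if_true]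
        rcases Nat.lt_succ_iff_lt_or_eq.1 hi' with h8 | h8
        · exact (h7 i' h8).trans ht'.le
        · exact (congrArg (fun i => (I.bagList i).length) (Fin.ext h8 : i' = ⟨i, hi⟩)).le
    · have ht' : (I.bagList ⟨i, hi⟩).length ≤ τ.reg rP := by simpa using ht
      refine ⟨h3.congr fun y hy hy' => ?_, by simp [h4], h5, by simpa using h6, fun i' hi' => ?_,
          by simp, by simp [hx0], by simp [hx1]⟩
      · simp [show y ≠ 23 by omega]
      · simp only [RamState.setReg_reg, Nat.reduceEqDiff, if_false]
        rcases Nat.lt_succ_iff_lt_or_eq.1 hi' with h8 | h8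
        · exact h7 i' h8
        · obtain rfl : i' = ⟨i, hi⟩ := Fin.ext h8
          exact ht'
    · rintro τ' ⟨g1, g2, g3, g4, g5, g6, g7, g8⟩
      refine wp_set (I.bagPos (i + 1)) (by simp [g2, g6, hs]) (by omega)
        ⟨by simp [g7], by simp [g8], g1.congr fun y hy _ => ?_, by simp, g3, by simpa using g4,
          by simpa using g5⟩
      simp [show y ≠ 22 by omega]
  · rintro τ ⟨h3, h4, h5, h6, h7⟩
    exact ⟨h3, le_antisymm h6 (Finset.sup_le fun i _ => h7 i i.2), h4, h5⟩

/-- The registers after `layoutCmd`. -/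
structure Lay (I : RootedInput) (σ : RamState) : Prop extends I.Head σ where
  P : σ.reg rP = I.maxBag
  arh : σ.reg aRH = I.pRH
  art : σ.reg aRT = I.pRT
  occ : σ.reg aOcc = I.pOcc
  int : σ.reg aInt = I.pInt
  wt : σ.reg aWt = I.pWt
  len : σ.reg rLen = I.nL
  q : σ.reg rQ = I.nq
  tb : σ.reg rTb = I.pTab

theorem Lay.congr (h : I.Lay σ) {τ : RamState} (hf : Fr 18 σ τ) (ht : τ.reg rTb = σ.reg rTb) :
    I.Lay τ := by
  refine ⟨h.toHead.congr fun y hy _ => hf y (by omega), ?_, ?_, ?_, ?_, ?_, ?_, ?_, ?_,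
    ht.trans h.tb⟩ <;> rw [hf _ (by omega)]
  exacts [h.P, h.arh, h.art, h.occ, h.int, h.wt, h.len, h.q]

theorem wp_layoutCmd (hB : I.Bnd K Z R Cm) (h : I.Head σ) (hP : σ.reg rP = I.maxBag)
    (h22 : σ.reg 22 = I.pRH) :
    layoutCmd.wp K Z R (fun σ' => I.Lay σ' ∧ σ'.mem = σ.mem) σ := by
  have hp := hB.pos_lt
  have e1 : I.pTab = I.pWt + (I.nL + 1) := rfl
  have e2 : I.pWt = I.pInt + I.n := rfl
  have e3 : I.pInt = I.pOcc + I.maxBag := rfl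
  have e4 : I.pOcc = I.pRT + I.n := rfl
  have e5 : I.pRT = I.pRH + (I.k + 1) := rfl
  have hZ := hB.hZ
  have hPZ := hB.hP
  have hn := hB.n_lt
  have hMM : 0 < I.nM * I.nM := by
    have := I.nM_pos
    positivity
  have hCZ : I.k + I.l * (I.maxBag + 1) + 1 ≤ Z := (Nat.le_mul_of_pos_right _ hMM).trans hB.hJ
  have hq := I.nq_eq
  have hL : I.nL = I.k + I.l * (I.maxBag + 1) := rfl
  refine wp_set_seq I.pRH (by simp [h22]) (by omega) ?_
  refine wp_set_seq I.pRT (by simp [h22, h.k, e5]) (by omega) ?_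
  refine wp_set_seq I.pOcc (by simp [h.n, e4]) (by omega) ?_
  refine wp_set_seq I.pInt (by simp [hP, e3]) (by omega) ?_
  refine wp_set_seq I.pWt (by simp [h.n, e2]) (by omega) ?_
  refine wp_set_seq I.nL (by simp [h.k, h.l, hP, hL]) (by omega) ?_
  refine wp_set_seq I.nq (by simp [h.l, hP, nq]) (by omega) ?_
  refine wp_set I.pTab (by simp [e1]) (by omega) ⟨⟨h.congr fun y hy _ => ?_, by simp [hP], by simp,
    by simp, by simp, by simp, by simp, by simp, by simp, by simp⟩, rfl⟩
  simp [show y ≠ 900 by omega, show y ≠ 17 by omega, show y ≠ 16 by omega, show y ≠ 15 by omega,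
    show y ≠ 14 by omega, show y ≠ 13 by omega, show y ≠ 12 by omega, show y ≠ 11 by omega]

/-- The memory when the first `i` roots have been entered. -/
structure Roots (I : RootedInput) (i : ℕ) (m : ℕ → ℕ) : Prop where
  inp : ∀ a < I.pRH, m a = I.encode.getD a 0
  rh : ∀ i' : Fin I.t, i' < i → m (I.pRH + I.rootH i') = i' + 1
  rh0 : ∀ u ≤ I.k, (∀ i' : Fin I.t, i' < i → (I.rootH i' : ℕ) ≠ u) → m (I.pRH + u) = 0
  rt : ∀ i' : Fin I.t, i' < i → m (I.pRT + I.rootT i') = i' + 1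
  rt0 : ∀ w : Fin I.n, (∀ i' : Fin I.t, i' < i → I.rootT i' ≠ w) → m (I.pRT + w) = 0
  zero : ∀ a ≥ I.pOcc, m a = 0

theorem Roots.step (hV : I.Valid) {i : ℕ} {m : ℕ → ℕ} (h : I.Roots i m) (hi : i < I.t) :
    I.Roots (i + 1) (Function.update (Function.update m (I.pRH + I.rootH ⟨i, hi⟩) (i + 1))
      (I.pRT + I.rootT ⟨i, hi⟩) (i + 1)) := by
  have e4 : I.pOcc = I.pRT + I.n := rfl
  have e5 : I.pRT = I.pRH + (I.k + 1) := rfl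
  have b1 := (I.rootH ⟨i, hi⟩).2
  have b2 := (I.rootT ⟨i, hi⟩).2
  refine ⟨fun a ha => ?_, fun i' hi' => ?_, fun u hu h1 => ?_, fun i' hi' => ?_, fun w h1 => ?_,
    fun a ha => ?_⟩
  · rw [Function.update_of_ne (by omega), Function.update_of_ne (by omega), h.inp a ha]
  · have b3 := (I.rootH i').2
    rw [Function.update_of_ne (by omega)]
    rcases Nat.lt_succ_iff_lt_or_eq.1 hi' with h8 | h8
    · have h9 : (I.rootH i' : ℕ) ≠ I.rootH ⟨i, hi⟩ := fun h10 => by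
        have := congrArg Fin.val (hV.rootH_injective (Fin.ext h10))
        simp only at this
        omega
      rw [Function.update_of_ne (by omega), h.rh i' h8]
    · obtain rfl : i' = ⟨i, hi⟩ := Fin.ext h8
      rw [Function.update_self]
  · have h2 := h1 ⟨i, hi⟩ (by simp)
    rw [Function.update_of_ne (by omega), Function.update_of_ne (by omega),
      h.rh0 u hu fun i' hi' => h1 i' (by omega)]
  · rcases Nat.lt_succ_iff_lt_or_eq.1 hi' with h8 | h8
    · have h9 : (I.rootT i' : ℕ) ≠ I.rootT ⟨i, hi⟩ := fun h10 => by
        have := congrArg Fin.val (hV.rootT_injective (Fin.ext h10))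
        simp only at this
        omega
      rw [Function.update_of_ne (by omega), Function.update_of_ne (by omega), h.rt i' h8]
    · obtain rfl : i' = ⟨i, hi⟩ := Fin.ext h8
      rw [Function.update_self]
  · have h2 : (I.rootT ⟨i, hi⟩ : ℕ) ≠ w := fun h3 => h1 ⟨i, hi⟩ (by simp) (Fin.ext h3)
    rw [Function.update_of_ne (by omega), Function.update_of_ne (by omega),
      h.rt0 w fun i' hi' => h1 i' (by omega)]
  · rw [Function.update_of_ne (by omega), Function.update_of_ne (by omega), h.zero a ha]

theorem t_le (hV : I.Valid) : I.t ≤ I.k := by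
  simpa using Fintype.card_le_of_injective _ hV.rootH_injective

theorem wp_rootCmd (hV : I.Valid) (hB : I.Bnd K Z R Cm) (h : I.Lay σ)
    (hm : σ.mem = fun a => I.encode.getD a 0) :
    rootCmd.wp K Z R (fun σ' => I.Lay σ' ∧ I.Roots I.t σ'.mem) σ := by
  have hZ := hB.hZ
  have hMM : 0 < I.nM * I.nM := by
    have := I.nM_pos
    positivity
  have hCZ : I.k + I.l * (I.maxBag + 1) + 1 ≤ Z := (Nat.le_mul_of_pos_right _ hMM).trans hB.hJ
  have ht := t_le hV
  have hb := I.bagPos_le (Nat.zero_le _)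
  have hb0 : I.bagPos 0 = I.oRootH + I.t + I.t + I.n * I.n := rfl
  have hb1 : I.oRootT = I.oRootH + I.t := rfl
  have e4 : I.pOcc = I.pRT + I.n := rfl
  have e5 : I.pRT = I.pRH + (I.k + 1) := rfl
  refine wp_forr I.t (by simp [h.t]) (by omega) (by simp; omega)
    (fun i τ => I.Lay τ ∧ I.Roots i τ.mem) ?_ ?_ ?_ ?_
  · rintro i τ τ' h1 h2 ⟨h3, h4⟩
    exact ⟨h3.congr (fun y hy => h1 y (by omega) (by omega)) (h1 _ (by omega) (by omega)), h2 ▸ h4⟩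
  · refine ⟨h, ⟨fun a _ => by rw [hm], fun i' hi' => by omega, fun u _ _ => ?_,
      fun i' hi' => by omega, fun w _ => ?_, fun a ha => ?_⟩⟩
    -- The tables are laid out behind the input, where the initial memory is zero.
    all_goals
      rw [hm]
      refine List.getD_eq_default _ _ ?_
      rw [encode_length]
      omega
  · rintro i hi τ ⟨h3, h4⟩ hx0 hx1
    have r1 : τ.mem (I.oRootH + i) = I.rootH ⟨i, hi⟩ := by
      rw [h4.inp _ (by omega), ← I.encode_rootH ⟨i, hi⟩]
    have r2 : τ.mem (I.oRootT + i) = I.rootT ⟨i, hi⟩ := by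
      rw [h4.inp _ (by omega), ← I.encode_rootT ⟨i, hi⟩]
    refine wp_sto_seq (I.pRH + I.rootH ⟨i, hi⟩) (i + 1)
      (by simp [h3.arh, h3.rh, hx0, r1]) (by simp [hx0]) (by omega) ?_
    refine wp_sto (I.pRT + I.rootT ⟨i, hi⟩) (i + 1) ?_ (by simp [hx0]) (by omega) ?_
    · simp only [eval_add, eval_v, eval_ld, RamState.setMem_reg, RamState.setMem_mem, h3.art, h3.rt,
        hx0]
      rw [if_neg (by omega), r2]
    · exact ⟨hx0, hx1, h3.congr (Fr.refl _ _).setMem.setMem rfl, h4.step hV hi⟩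
  · exact fun τ h => h

theorem wp_weightCmd (hB : I.Bnd K Z R Cm) (hn : 0 < I.n) (h : I.Lay σ) (hr : I.Roots I.t σ.mem) :
    weightCmd.wp K Z R (fun σ' => I.Core (fun _ => none) ∅ 0 σ') σ := by
  have hZ := hB.hZ
  have hK := hB.hK
  have hMM : 0 < I.nM * I.nM := by
    have := I.nM_pos
    positivity
  have hCZ : I.k + I.l * (I.maxBag + 1) + 1 ≤ Z := (Nat.le_mul_of_pos_right _ hMM).trans hB.hJ
  have hL : I.nL = I.k + I.l * (I.maxBag + 1) := rfl
  have e1 : I.pTab = I.pWt + (I.nL + 1) := rfl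
  have e2 : I.pWt = I.pInt + I.n := rfl
  have e3 : I.pInt = I.pOcc + I.maxBag := rfl
  have e4 : I.pOcc = I.pRT + I.n := rfl
  have e5 : I.pRT = I.pRH + (I.k + 1) := rfl
  have hp := hB.pos_lt
  have hwt : ∀ i ≤ I.nL, _root_.wt I.k I.nq i < K := fun i hi => by
    have h1 : _root_.wt I.k I.nq i ≤ I.nM := Nat.le_of_dvd I.nM_pos (wt_dvd hi)
    omega
  refine wp_sto_seq I.pWt 1 (by simp [h.wt]) rfl (by omega) ?_
  refine wp_seq (wp_forr (Q := fun τ => I.Lay τ ∧ (∀ a < I.pWt, τ.mem a = σ.mem a) ∧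
    (∀ a ≥ I.pTab, τ.mem a = 0) ∧ ∀ i ≤ I.nL, τ.mem (I.pWt + i) = _root_.wt I.k I.nq i)
    I.nL (by simp [h.len]) (by omega) (by simp; omega)
    (fun i τ => I.Lay τ ∧ (∀ a < I.pWt, τ.mem a = σ.mem a) ∧
      (∀ a ≥ I.pTab, τ.mem a = 0) ∧ ∀ i' ≤ i, τ.mem (I.pWt + i') = _root_.wt I.k I.nq i')
    ?_ ?_ ?_ ?_) ?_
  · rintro i τ τ' h1 h2 ⟨h3, h4⟩
    exact ⟨h3.congr (fun y hy => h1 y (by omega) (by omega)) (h1 _ (by omega) (by omega)), h2 ▸ h4⟩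
  · refine ⟨h.congr (Fr.refl _ _).setMem rfl, fun a ha => ?_, fun a ha => ?_, fun i' hi' => ?_⟩
    · rw [RamState.setMem_mem, if_neg (by omega)]
    · rw [RamState.setMem_mem, if_neg (by omega), hr.zero a (by omega)]
    · obtain rfl : i' = 0 := by omega
      simp [_root_.wt]
  · rintro i hi τ ⟨h3, h4, h5, h6⟩ hx0 hx1
    have key : ∀ e : Ex, e.eval τ = _root_.wt I.k I.nq (i + 1) →
        (sto (v aWt + (v 20 + 1)) e).wp K Z R (fun τ' => τ'.reg 20 = i ∧ τ'.reg 21 = I.nL - i ∧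
          I.Lay τ' ∧ (∀ a < I.pWt, τ'.mem a = σ.mem a) ∧ (∀ a ≥ I.pTab, τ'.mem a = 0) ∧
          ∀ i' ≤ i + 1, τ'.mem (I.pWt + i') = _root_.wt I.k I.nq i') τ := by
      intro e he
      refine wp_sto (I.pWt + (i + 1)) _ (by simp [h3.wt, hx0]) he (hwt _ hi)
        ⟨hx0, hx1, h3.congr (Fr.refl _ _).setMem rfl, fun a ha => ?_, fun a ha => ?_,
          fun i' hi' => ?_⟩
      · rw [RamState.setMem_mem, if_neg (by omega), h4 a ha]
      · rw [RamState.setMem_mem, if_neg (by omega), h5 a ha]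
      · rw [RamState.setMem_mem]
        by_cases h7 : i' = i + 1
        · rw [if_pos (by omega), h7]
        · rw [if_neg (by omega), h6 i' (by omega)]
    refine ⟨fun ht => key _ ?_, fun ht => key _ ?_⟩
    · have ht' : i < I.k := by simpa [hx0, h3.k] using ht
      simp [h3.wt, hx0, h6, _root_.wt, digitBase, ht']
    · have ht' : ¬ i < I.k := by simpa [hx0, h3.k] using ht
      simp [h3.wt, hx0, h6, _root_.wt, digitBase, ht', h3.q]
  · exact fun τ h => h
  · rintro τ ⟨h3, h4, h5, h6⟩
    have : Nonempty (Fin I.n) := ⟨⟨0, hn⟩⟩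
    refine wp_set_seq I.nM (by simp [h3.wt, h3.len, h6, nM]) (by omega) ?_
    -- The first table contains only the number `0`: nothing is mapped and there are no pieces.
    refine wp_sto I.pTab 1 (by simp [h3.tb]) rfl (by omega) ⟨⟨?_, ?_, ?_⟩, fun S => S = 0,
      ⟨?_, ?_, ?_⟩, Good.init (fun _ => rfl) fun S => Iff.rfl⟩
    · intro s _ a ha
      cases ha
    · intro s _ s' _ a ha
      cases ha
    · intro a ha
      exact absurd ha (Set.notMem_empty a)
    · constructor <;> simp [h3.k, h3.l, h3.t, h3.n, h3.r, h3.P, h3.adj, h3.bag, h3.arh, h3.art,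
        h3.occ, h3.int, h3.wt, h3.len, h3.q]
    · have hb : ∀ a < I.pWt,
          (((τ.setReg 18 I.nM).setMem I.pTab 1).mem a) = σ.mem a := fun a ha => by
        rw [RamState.setMem_mem, if_neg (by omega), RamState.setReg_mem, h4 a ha]
      refine ⟨fun a ha => ?_, fun i => ?_, fun u hu h1 => ?_, fun i => ?_, fun w h1 => ?_,
        fun s' hs' => ?_, fun w' => ?_, fun i hi => ?_⟩
      · rw [hb _ (by omega), hr.inp a ha]
      · have := (I.rootH i).2
        rw [hb _ (by omega), hr.rh i i.2]
      · rw [hb _ (by omega), hr.rh0 u hu fun i _ => h1 i]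
      · have := (I.rootT i).2
        rw [hb _ (by omega), hr.rt i i.2]
      · have := w.2
        rw [hb _ (by omega), hr.rt0 w fun i _ => h1 i]
      · rw [hb _ (by omega), hr.zero _ (by omega), slotVal]
      · have := w'.2
        rw [hb _ (by omega), hr.zero _ (by omega)]
        simp
      · rw [RamState.setMem_mem, if_neg (by omega), RamState.setReg_mem, h6 i hi]
    · refine ⟨⟨0, le_rfl, by simp [h3.tb]⟩, fun S hS => ?_, fun a ha => ?_, fun S hS => ?_⟩
      · simp only [RamState.setMem_reg, RamState.setReg_reg, Nat.reduceEqDiff, if_false, h3.tb,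
          RamState.setMem_mem, RamState.setReg_mem]
        by_cases h7 : S = 0
        · simp [h7]
        · rw [if_neg (by omega), h5 _ (by omega)]
          simp [h7]
      · have hM := I.nM_pos
        simp only [RamState.setMem_reg, RamState.setReg_reg, Nat.reduceEqDiff, if_false, h3.tb]
          at ha
        rw [RamState.setMem_mem, if_neg (by omega), RamState.setReg_mem, h5 _ (by omega)]
      · rw [hS]
        exact I.nM_pos

theorem wp_progCmd (hV : I.Valid) (hk : 0 < I.k) (hB : I.Bnd K Z R Cm)
    (hc : I.r * I.bagTabs + 1 ≤ Cm) :
    progCmd.wp K Z R (fun σ => (RootedImmersible I.H I.rootH I.T I.rootT → σ.reg 0 = 1) ∧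
      (¬ RootedImmersible I.H I.rootH I.T I.rootT → σ.reg 0 = 0)) (RamState.init I.encode) := by
  have hp := hB.pos_lt
  have hl := I.pRH_le
  have hK := hB.hK
  refine wp_set_seq I.k I.encode_head.1 (by omega) ⟨fun _ => ?_, fun ht => ?_⟩
  · refine wp_seq (wp_headCmd hB (by simp) rfl) ?_
    rintro σ1 ⟨a1, a2, a3, a4⟩
    refine wp_seq (wp_layoutCmd hB a1 a2 a3) ?_
    rintro σ2 ⟨b1, b2⟩
    refine wp_seq (wp_rootCmd hV hB b1 (b2.trans a4)) ?_
    rintro σ3 ⟨c1, c2⟩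
    refine wp_seq (wp_weightCmd hB hV.n_pos c1 c2) ?_
    intro σ4 d1
    refine wp_seq (d1.wp_mainCmd hV hk hB (by omega)) ?_
    rintro σ5 ⟨occ, e1⟩
    obtain ⟨X, hX, hG⟩ := e1.st
    refine wp_seq (hX.wp_finOp hB hc) ?_
    intro σ6 hf
    rw [← hG.immersible_iff] at hf
    refine wp_set _ rfl ?_ ⟨fun h => ?_, fun h => ?_⟩
    · simp only [Ex.not, eval_sub, eval_ofNat]
      omega
    · have := hf.2 h
      simp only [Ex.not, eval_sub, eval_ofNat, eval_ld, eval_v, RamState.setReg_reg, if_true]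
      omega
    · have := mt hf.1 h
      simp only [Ex.not, eval_sub, eval_ofNat, eval_ld, eval_v, RamState.setReg_reg, if_true]
      omega
  · exact absurd (by simpa using ht) hk.ne'

end RootedInput

/-! ### Resource bounds -/

theorem wt_add (k q j : ℕ) : wt k q (k + j) = 2 ^ k * q ^ j := by
  induction j with
  | zero =>
    have : ∀ i ≤ k, wt k q i = 2 ^ i := by
      intro i hi
      induction i with
      | zero => rfl
      | succ i ih => rw [wt, ih (by omega), digitBase, if_pos (by omega), pow_succ]
    simpa using this k le_rfl
  | succ j ih => rw [← add_assoc, wt, ih, digitBase, if_neg (by omega), pow_succ, mul_assoc]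

theorem dpExponent_nonneg (k l : ℕ) {p : ℕ} (hp : 2 ≤ p) : 0 ≤ dpExponent k l p := by
  have hp' : (1 : ℝ) ≤ p := by exact_mod_cast (by omega : 1 ≤ p)
  have ha : 0 ≤ Real.logb 2 p := Real.logb_nonneg one_lt_two hp'
  have hb : 0 ≤ Real.logb 2 l := by
    rcases Nat.eq_zero_or_pos l with rfl | hl
    · simp
    · exact Real.logb_nonneg one_lt_two (by exact_mod_cast hl)
  unfold dpExponent
  positivity

/-- Since `log p ≥ 1`, the exponent dominates `k` and `p * l`. As `k ≥ 1`, it also dominates `log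
p`, even when there are no edges. For `l ≥ 1` the number of names is at most `(p * l) ^ 4`, and
raising this to at most `2 * p * l` costs `8 * p * l * (log p + log l)` in the exponent. -/
theorem le_ceil_dpExponent {k l p P : ℕ} (hp : 2 ≤ p) (hP : P ≤ p + 1) (hk : 1 ≤ k) :
    k ≤ ⌈dpExponent k l p⌉₊ ∧ l * (P + 1) ≤ 2 * ⌈dpExponent k l p⌉₊ ∧
    P + 3 ≤ 2 ^ (3 * ⌈dpExponent k l p⌉₊) ∧
    (P + 3 + l * (P + 1)) ^ (l * (P + 1)) ≤ 2 ^ (8 * ⌈dpExponent k l p⌉₊) := by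
  set e := ⌈dpExponent k l p⌉₊ with he
  have hE : dpExponent k l p ≤ e := Nat.le_ceil _
  have hp' : (2 : ℝ) ≤ p := by exact_mod_cast hp
  have hk' : (1 : ℝ) ≤ k := by exact_mod_cast hk
  have ha : 1 ≤ Real.logb 2 p := by
    rw [Real.le_logb_iff_rpow_le one_lt_two (by linarith)]
    simpa using hp'
  have hb : 0 ≤ Real.logb 2 l := by
    rcases Nat.eq_zero_or_pos l with rfl | hl
    · simp
    · exact Real.logb_nonneg one_lt_two (by exact_mod_cast hl)
  have hpa : (2 : ℝ) ^ Real.logb 2 p = p := Real.rpow_logb two_pos (by norm_num) (by linarith)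
  set a := Real.logb 2 p with ha'
  set b := Real.logb 2 l with hb'
  have hl0 : (0 : ℝ) ≤ l := Nat.cast_nonneg l
  have hdef : dpExponent k l p = k * a + p * l * (b + a) := rfl
  have hpl : (0 : ℝ) ≤ p * l := by positivity
  have h1 : (p : ℝ) * l ≤ p * l * (b + a) := le_mul_of_one_le_right hpl (by linarith)
  have h2 : (k : ℝ) ≤ k * a := le_mul_of_one_le_right (by linarith) ha
  have h3 : a ≤ k * a := le_mul_of_one_le_left (by linarith) hk'
  have hke : k ≤ e := by
    have : (k : ℝ) ≤ e := by linarith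
    exact_mod_cast this
  have hple : p * l ≤ e := by
    have : (p : ℝ) * l ≤ e := by linarith
    exact_mod_cast this
  have hpe : p ≤ 2 ^ e := by
    have : (p : ℝ) ≤ 2 ^ (e : ℝ) := by
      rw [← hpa]
      exact Real.rpow_le_rpow_of_exponent_le one_le_two (by linarith)
    rw [Real.rpow_natCast] at this
    exact_mod_cast this
  have hlP : l * (P + 1) ≤ 2 * (p * l) := by nlinarith
  refine ⟨hke, by omega, ?_, ?_⟩
  · have h4 : 2 ^ 2 ≤ 2 ^ (2 * e) := Nat.pow_le_pow_right (by omega) (by omega)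
    calc P + 3 ≤ 2 ^ 2 * p := by omega
      _ ≤ 2 ^ (2 * e) * 2 ^ e := Nat.mul_le_mul h4 hpe
      _ = 2 ^ (3 * e) := by rw [← pow_add]; congr 1; omega
  · rcases Nat.eq_zero_or_pos l with rfl | hl
    · simpa using Nat.one_le_two_pow
    have hl' : (1 : ℝ) ≤ l := by exact_mod_cast hl
    have hlb : (2 : ℝ) ^ b = l := Real.rpow_logb two_pos (by norm_num) (by linarith)
    -- With `P ≤ p + 1`, `2 ≤ p` and `1 ≤ l` the left side is at most `8 * (p * l)`, and `8 ≤ (p *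
    -- l) ^ 3`.
    have h5 : P + 3 + l * (P + 1) ≤ (p * l) ^ 4 := by
      have h6 : p ≤ p * l := Nat.le_mul_of_pos_right _ hl
      have h7 : 2 ^ 3 ≤ (p * l) ^ 3 := Nat.pow_le_pow_left (by omega) 3
      calc P + 3 + l * (P + 1) ≤ 2 ^ 3 * (p * l) := by omega
        _ ≤ (p * l) ^ 3 * (p * l) := Nat.mul_le_mul_right _ h7
        _ = (p * l) ^ 4 := by ring
    have h8 : (P + 3 + l * (P + 1)) ^ (l * (P + 1)) ≤ (p * l) ^ (8 * (p * l)) := by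
      calc _ ≤ ((p * l) ^ 4) ^ (l * (P + 1)) := Nat.pow_le_pow_left h5 _
        _ = (p * l) ^ (4 * (l * (P + 1))) := by rw [← pow_mul]
        _ ≤ (p * l) ^ (8 * (p * l)) := Nat.pow_le_pow_right (by positivity) (by omega)
    refine h8.trans ?_
    have h9 : ((p : ℝ) * l) ^ (8 * (p * l)) ≤ 2 ^ (8 * e) := by
      rw [← hpa, ← hlb, ← Real.rpow_add two_pos, ← Real.rpow_natCast, ← Real.rpow_mul (by norm_num),
        ← Real.rpow_natCast 2]
      refine Real.rpow_le_rpow_of_exponent_le one_le_two ?_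
      push_cast
      have : (a + b) * (8 * (p * l)) = 8 * (p * l * (b + a)) := by ring
      rw [this]
      linarith
    exact_mod_cast h9

namespace Cmd

/-- The nesting depth of the loops with flag `b`. -/
def depth (b : Bool) : Cmd → ℕ
  | skip => 0
  | set _ _ => 0
  | sto _ _ => 0
  | seq p q => max (p.depth b) (q.depth b)
  | ite _ p q => max (p.depth b) (q.depth b)
  | forr b' _ _ p => p.depth b + if b' = b then 1 else 0

/-- The number of steps if all loops have one iteration. -/
def weight (c : Cmd) : ℕ := c.cst 1 1

/-- The cost is a polynomial in `R` and `Z` whose degrees are the nesting depths. Using `R + 1` and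
`Z + 1` keeps the factors at least `1`, so different branches can be compared at the larger depth.
-/
theorem cst_le (Z R : ℕ) (c : Cmd) :
    c.cst Z R ≤ c.weight * ((R + 1) ^ c.depth true * (Z + 1) ^ c.depth false) := by
  have hR : 1 ≤ R + 1 := by omega
  have hZ : 1 ≤ Z + 1 := by omega
  have h1 : ∀ i j, 1 ≤ (R + 1) ^ i * (Z + 1) ^ j := fun i j => Nat.one_le_iff_ne_zero.2 (by positivity)
  have key : ∀ {i j i' j'}, i ≤ i' → j ≤ j' →
      (R + 1) ^ i * (Z + 1) ^ j ≤ (R + 1) ^ i' * (Z + 1) ^ j' := fun hi hj =>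
    Nat.mul_le_mul (Nat.pow_le_pow_right hR hi) (Nat.pow_le_pow_right hZ hj)
  unfold weight
  induction c with
  | skip => exact Nat.le_mul_of_pos_right _ (h1 _ _)
  | set x e => exact Nat.le_mul_of_pos_right _ (h1 _ _)
  | sto a e => exact Nat.le_mul_of_pos_right _ (h1 _ _)
  | seq c d ihc ihd =>
    simp only [cst, depth, Nat.add_mul]
    exact Nat.add_le_add
      (ihc.trans (Nat.mul_le_mul_left _ (key (le_max_left _ _) (le_max_left _ _))))
      (ihd.trans (Nat.mul_le_mul_left _ (key (le_max_right _ _) (le_max_right _ _))))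
  | ite e c d ihc ihd =>
    simp only [cst, depth, Nat.add_mul]
    exact Nat.add_le_add (Nat.add_le_add
      (Nat.add_le_add (Nat.le_mul_of_pos_right _ (h1 _ _)) (Nat.le_mul_of_pos_right _ (h1 _ _)))
      (ihc.trans (Nat.mul_le_mul_left _ (key (le_max_left _ _) (le_max_left _ _)))))
      (ihd.trans (Nat.mul_le_mul_left _ (key (le_max_right _ _) (le_max_right _ _))))
  | forr b x e c ihc =>
    have h2 : c.cst Z R + 4 ≤ (c.cst 1 1 + 4) * ((R + 1) ^ c.depth true * (Z + 1) ^ c.depth false) := by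
      rw [Nat.add_mul]
      exact Nat.add_le_add ihc (Nat.le_mul_of_pos_right _ (h1 _ _))
    cases b
    · simp only [cst, depth, if_true, Nat.add_mul (e.cost + 4), ite_self, one_mul,
        Bool.false_eq_true, if_false, add_zero]
      refine Nat.add_le_add (Nat.le_mul_of_pos_right _ (h1 _ _)) ?_
      calc Z * (c.cst Z R + 4) ≤ (Z + 1) *
            ((c.cst 1 1 + 4) * ((R + 1) ^ c.depth true * (Z + 1) ^ c.depth false)) :=
          Nat.mul_le_mul (by omega) h2
        _ = _ := by ring
    · simp only [cst, depth, if_true, Nat.add_mul (e.cost + 4), ite_self, one_mul,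
        Bool.true_eq_false, if_false, add_zero]
      refine Nat.add_le_add (Nat.le_mul_of_pos_right _ (h1 _ _)) ?_
      calc R * (c.cst Z R + 4) ≤ (R + 1) *
            ((c.cst 1 1 + 4) * ((R + 1) ^ c.depth true * (Z + 1) ^ c.depth false)) :=
          Nat.mul_le_mul (by omega) h2
        _ = _ := by ring

instance decidableWf : (p : Cmd) → Decidable p.Wf
  | skip => inferInstanceAs (Decidable True)
  | set x e => inferInstanceAs (Decidable (x < 1000 ∧ e.Wf))
  | sto a e => inferInstanceAs (Decidable (a.Wf ∧ e.Wf))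
  | seq p q => by
      have := p.decidableWf
      have := q.decidableWf
      exact inferInstanceAs (Decidable (p.Wf ∧ q.Wf))
  | ite e p q => by
      have := p.decidableWf
      have := q.decidableWf
      exact inferInstanceAs (Decidable (e.Wf ∧ p.Wf ∧ q.Wf))
  | forr _ x e p => by
      have := p.decidableWf
      exact inferInstanceAs (Decidable (x + 1 < 1000 ∧ e.Wf ∧ p.Wf))

end Cmd

theorem progCmd_wf : progCmd.Wf := by
  decide

theorem progCmd_depth : progCmd.depth true = 1 := rfl

namespace RootedInput

variable {I : RootedInput}

/-- Between two different consecutive bags some vertex enters or leaves. Since its bags form an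
interval, each vertex enters at most once and leaves at most once, so there are at most `2 * n` such
changes. -/
theorem r_le (hV : I.Valid) (h : ∀ i j : Fin I.r, (i : ℕ) + 1 = j → I.bag i ≠ I.bag j) :
    I.r ≤ 2 * I.n + 1 := by
  have h1 : ∀ i : Fin (I.r - 1), ∃ a : Fin I.n × Bool,
      (a.2 = true → a.1 ∈ I.bag ⟨i + 1, by omega⟩ ∧ a.1 ∉ I.bag ⟨i, by omega⟩) ∧
      (a.2 = false → a.1 ∈ I.bag ⟨i, by omega⟩ ∧ a.1 ∉ I.bag ⟨i + 1, by omega⟩) := by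
    intro i
    have h2 := h ⟨i, by omega⟩ ⟨i + 1, by omega⟩ rfl
    by_contra! h3
    refine h2 (Finset.ext fun a => ⟨fun h4 => ?_, fun h4 => ?_⟩)
    · by_contra h5
      obtain ⟨h6, h7⟩ := h3 (a, false) (by simp)
      exact h5 (h7 h4)
    · by_contra h5
      have := h3 (a, true) fun _ => ⟨h4, h5⟩
      simp at this
  choose f hf using h1
  have hlt : ∀ i i' : Fin (I.r - 1), i < i' → f i ≠ f i' := by
    intro i i' hi he
    have hi' : (i : ℕ) + 1 ≤ i' := hi
    have key : ∀ j (hj : j ≤ I.r - 1) m (hm : m < I.r) m' (hm' : m' < I.r), m ≤ j → j ≤ m' →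
        ∀ (hj' : j < I.r) a, a ∈ I.bag ⟨m, hm⟩ → a ∈ I.bag ⟨m', hm'⟩ → a ∈ I.bag ⟨j, hj'⟩ := by
      intro j _ m hm m' hm' h1 h2 hj' a h3 h4
      rcases h1.lt_or_eq with h1 | rfl
      · rcases h2.lt_or_eq with h2 | rfl
        · exact hV.decomposition.inter_subset ⟨m, hm⟩ ⟨j, hj'⟩ ⟨m', hm'⟩ h1 h2
            (Finset.mem_inter.2 ⟨h3, h4⟩)
        · exact h4
      · exact h3
    cases hb : (f i).2 with
    | true =>
      have h2 := (hf i).1 hb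
      have h3 := (hf i').1 (he ▸ hb)
      rw [← he] at h3
      exact h3.2 (key i' (by omega) (i + 1) _ (i' + 1) _ (by omega) (by omega) (by omega) _ h2.1 h3.1)
    | false =>
      have h2 := (hf i).2 hb
      have h3 := (hf i').2 (he ▸ hb)
      rw [← he] at h3
      exact h2.2 (key (i + 1) (by omega) i _ i' _ (by omega) (by omega) (by omega) _ h2.1 h3.1)
  have hinj : Function.Injective f := by
    intro i i' he
    rcases lt_trichotomy i i' with h4 | h4 | h4
    · exact absurd he (hlt i i' h4)
    · exact h4
    · exact absurd he.symm (hlt i' i h4)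
  have := Fintype.card_le_of_injective f hinj
  simp at this
  omega

theorem maxBag_le (hV : I.Valid) {p : ℕ} (h : decompWidth I.bag ≤ p) : I.maxBag ≤ p + 1 := by
  refine Finset.sup_le fun i _ => ?_
  have h1 : (I.bag i).card = (I.bagList i).length := List.toFinset_card_of_nodup (hV.bag_nodup i)
  have h2 : (I.bag i).card - 1 ≤ decompWidth I.bag :=
    Finset.le_sup (f := fun i => (I.bag i).card - 1) (Finset.mem_univ i)
  omega

theorem maxBag_le_n (hV : I.Valid) : I.maxBag ≤ I.n := by
  refine Finset.sup_le fun i _ => ?_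
  have := (hV.bag_nodup i).length_le_card
  simpa using this

theorem bagPos_le_mul (I : RootedInput) (i : ℕ) : I.bagPos i ≤ I.bagPos 0 + i * (1 + I.maxBag) := by
  induction i with
  | zero => simp
  | succ i ih =>
    have h1 : I.bagPos (i + 1) =
      I.bagPos i + if h : i < I.r then 1 + (I.bagList ⟨i, h⟩).length else 0 := rfl
    rw [h1, Nat.succ_mul]
    split_ifs with h
    · have := I.length_le_maxBag ⟨i, h⟩
      omega
    · omega

theorem encode_lt {K : ℕ} (hk : I.k < K) (hl : I.l < K) (ht : I.t < K) (hn : I.n < K) (hr : I.r < K)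
    (hP : I.maxBag < K) (hK : 1 < K) : ∀ a ∈ I.encode, a < K := by
  intro a ha
  rw [encode_eq] at ha
  simp only [List.mem_append, List.mem_flatMap, List.mem_map, List.mem_finRange, true_and,
    List.mem_cons, List.not_mem_nil, or_false] at ha
  rcases ha with ((((((rfl | rfl | rfl | rfl | rfl) | ⟨e, rfl | rfl⟩) | ⟨i, rfl⟩) | ⟨i, rfl⟩) |
    ⟨u, w, rfl⟩) | ⟨i, rfl | ⟨w, -, rfl⟩⟩)
  any_goals assumption
  · exact (I.H.src e).2.trans hk
  · exact (I.H.tgt e).2.trans hk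
  · exact (I.rootH i).2.trans hk
  · exact (I.rootT i).2.trans hn
  · split_ifs <;> omega
  · exact (I.length_le_maxBag i).trans_lt hP
  · exact w.2.trans hn

/-- Without vertices there are no edges and no roots. The program decides this case separately,
because for `k = 0` the exponent vanishes while the bags may be arbitrarily large. -/
theorem rootedImmersible_of_k_eq_zero (hk : I.k = 0) :
    RootedImmersible I.H I.rootH I.T I.rootT := by
  have : IsEmpty (Fin I.k) := by rw [hk]; infer_instance
  exact ⟨⟨isEmptyElim, fun e => isEmptyElim (I.H.src e), fun a => isEmptyElim a,
    fun e => isEmptyElim (I.H.src e), fun e => isEmptyElim (I.H.src e),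
    fun e => isEmptyElim (I.H.src e)⟩, fun i => isEmptyElim (I.rootH i)⟩

/-- There are at most `2 ^ (9 * e)` states and `2 ^ (4 * e)` choices, so one table operation has at
most `2 ^ (4 * e + 18 * e)` rounds; this is `Z`. The word bound `K` must exceed the length of the
input and the total size of all tables made. -/
theorem bnd (hV : I.Valid) {e ν : ℕ} (hk : 0 < I.k) (hke : I.k ≤ e)
    (hle : I.l * (I.maxBag + 1) ≤ 2 * e) (hPe : I.maxBag + 3 ≤ 2 ^ (3 * e))
    (hqe : (I.maxBag + 3 + I.l * (I.maxBag + 1)) ^ (I.l * (I.maxBag + 1)) ≤ 2 ^ (8 * e))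
    (hν : I.n + I.r ≤ 2 ^ ν) :
    I.Bnd (2 ^ (7 + 2 * ν + 88 * e)) (2 ^ (22 * e)) I.r (I.r * I.bagTabs + 1) := by
  have hM : I.nM ≤ 2 ^ (9 * e) := by
    rw [nM, nL, wt_add]
    calc 2 ^ I.k * I.nq ^ (I.l * (I.maxBag + 1)) ≤ 2 ^ e * 2 ^ (8 * e) :=
          Nat.mul_le_mul (Nat.pow_le_pow_right (by omega) hke) hqe
      _ = 2 ^ (9 * e) := by rw [← pow_add]; congr 1; omega
  have hMM : 0 < I.nM * I.nM := by
    have := I.nM_pos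
    positivity
  have hJ : (I.k + I.l * (I.maxBag + 1) + 1) * (I.nM * I.nM) ≤ 2 ^ (22 * e) := by
    have h1 : I.k + I.l * (I.maxBag + 1) + 1 ≤ 2 ^ (4 * e) := by
      have := Nat.lt_two_pow_self (n := 4 * e)
      omega
    calc _ ≤ 2 ^ (4 * e) * (2 ^ (9 * e) * 2 ^ (9 * e)) :=
          Nat.mul_le_mul h1 (Nat.mul_le_mul hM hM)
      _ = 2 ^ (22 * e) := by rw [← pow_add, ← pow_add]; congr 1; omega
  have hL := (Nat.le_mul_of_pos_right _ hMM).trans hJ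
  have hPZ : I.maxBag + 3 ≤ 2 ^ (22 * e) := hPe.trans (Nat.pow_le_pow_right (by omega) (by omega))
  have hMZ : I.nM ≤ 2 ^ (22 * e) := hM.trans (Nat.pow_le_pow_right (by omega) (by omega))
  -- With `N = 2 ^ ν` this is `128 * N ^ 2 * Z ^ 4`: the factor `N ^ 2` accounts for the adjacency
  -- matrix and the number of bags, three factors `Z` for the tables made per bag, and one for the
  -- size of a table.
  have hKe : 2 ^ (7 + 2 * ν + 88 * e) = 128 * ((2 ^ ν) ^ 2 * (2 ^ (22 * e)) ^ 4) := by
    rw [← pow_mul, ← pow_mul, pow_add, pow_add]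
    ring
  have hN : 1 ≤ I.n + I.r := by have := hV.n_pos; omega
  have ht := t_le hV
  rw [hKe]
  generalize 2 ^ ν = N at *
  generalize 2 ^ (22 * e) = Z at *
  have hZ1 : 1 ≤ Z := by omega
  have hN1 : 1 ≤ N := by omega
  have hl : I.l ≤ I.l * (I.maxBag + 1) := Nat.le_mul_of_pos_right _ (by omega)
  have hZ4 : Z ≤ Z ^ 4 := Nat.le_self_pow (by omega) Z
  have hN2 : N ≤ N ^ 2 := Nat.le_self_pow (by omega) N
  have hZ4' : 1 ≤ Z ^ 4 := by omega
  have hN2' : 1 ≤ N ^ 2 := by omega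
  have hNZ : N ^ 2 ≤ N ^ 2 * Z ^ 4 := Nat.le_mul_of_pos_right _ (by omega)
  have hZN : Z ^ 4 ≤ N ^ 2 * Z ^ 4 := Nat.le_mul_of_pos_left _ (by omega)
  refine ⟨by omega, hJ, hPZ, by omega, ?_, le_rfl, by omega⟩
  have hstep : I.stepTabs ≤ 3 * Z := by unfold stepTabs; omega
  have hbag : I.bagTabs ≤ 4 * Z ^ 3 := by
    have h1 : Z ≤ Z ^ 3 := Nat.le_self_pow (by omega) Z
    calc I.bagTabs ≤ Z + Z * (Z * (3 * Z)) := by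
          unfold bagTabs
          exact Nat.add_le_add (by omega) (Nat.mul_le_mul (by omega) (Nat.mul_le_mul (by omega) hstep))
      _ = Z + 3 * Z ^ 3 := by ring
      _ ≤ _ := by omega
  have hCm : (I.r * I.bagTabs + 1 + 2) * I.nM ≤ 7 * (N ^ 2 * Z ^ 4) := by
    have h1 : 1 ≤ N ^ 2 * Z ^ 3 := Nat.one_le_iff_ne_zero.2 (by positivity)
    calc _ ≤ (N ^ 2 * (4 * Z ^ 3) + 3 * (N ^ 2 * Z ^ 3)) * Z :=
          Nat.mul_le_mul (by
            have := Nat.mul_le_mul (show I.r ≤ N ^ 2 by omega) hbag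
            omega) hMZ
      _ = _ := by ring
  have hnn : I.n * I.n ≤ N ^ 2 := by
    rw [sq]
    exact Nat.mul_le_mul (by omega) (by omega)
  have hrP : I.r * (1 + I.maxBag) ≤ N ^ 2 * Z ^ 4 := Nat.mul_le_mul (by omega) (by omega)
  have hb := I.bagPos_le_mul I.r
  have hb0 : I.bagPos 0 = 5 + 2 * I.l + I.t + I.t + I.n * I.n := rfl
  have hl := I.pRH_le
  have hLe : I.nL = I.k + I.l * (I.maxBag + 1) := rfl
  have hRH : I.pRH = I.bagPos I.r := rfl
  omega

end RootedInput

namespace RootedInput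

variable {I : RootedInput}

theorem exists_exec (hV : I.Valid) {p ν : ℕ} (hp : 2 ≤ p) (hw : decompWidth I.bag ≤ p)
    (hν : I.n + I.r < 2 ^ ν) :
    ∃ (final : RamState) (steps : ℕ),
      RamExec (2 ^ ((7 + 2 * ν + 88 * ⌈dpExponent I.k I.l p⌉₊) * progCmd.deg)) progCmd.comp
        (RamState.init I.encode) final steps ∧
      steps ≤ progCmd.cst (2 ^ (22 * ⌈dpExponent I.k I.l p⌉₊)) I.r ∧
      (RootedImmersible I.H I.rootH I.T I.rootT → final.reg 0 = 1) ∧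
      (¬ RootedImmersible I.H I.rootH I.T I.rootT → final.reg 0 = 0) := by
  set e := ⌈dpExponent I.k I.l p⌉₊
  have hK1 : 2 ^ 7 ≤ 2 ^ (7 + 2 * ν + 88 * e) := Nat.pow_le_pow_right (by omega) (by omega)
  have hK2 : 2 ^ ν ≤ 2 ^ (7 + 2 * ν + 88 * e) := Nat.pow_le_pow_right (by omega) (by omega)
  have hPn := maxBag_le_n hV
  have ht := t_le hV
  have hkl : I.k < 2 ^ (7 + 2 * ν + 88 * e) ∧ I.l < 2 ^ (7 + 2 * ν + 88 * e) := by
    rcases Nat.eq_zero_or_pos I.k with hk | hk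
    · have hl : I.l = 0 := by
        by_contra hl
        have := (I.H.src ⟨0, by omega⟩).2
        omega
      omega
    · obtain ⟨h1, h2, -⟩ := le_ceil_dpExponent (l := I.l) hp (maxBag_le hV hw) hk
      have h3 : I.l ≤ I.l * (I.maxBag + 1) := Nat.le_mul_of_pos_right _ (by omega)
      have h4 := Nat.lt_two_pow_self (n := 7 + 2 * ν + 88 * e)
      omega
  have henc := I.encode_lt hkl.1 hkl.2 (by omega) (by omega) (by omega) (by omega) (by omega)
  have hbdd : (RamState.init I.encode).Bdd (2 ^ (7 + 2 * ν + 88 * e)) := by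
    refine ⟨fun x => by simp [RamState.init], fun a => ?_⟩
    simp only [RamState.init, List.getD_eq_getElem?_getD]
    by_cases ha : a < I.encode.length
    · rw [List.getElem?_eq_getElem ha]
      exact henc _ (List.getElem_mem ha)
    · rw [List.getElem?_eq_none (by omega)]
      exact Nat.two_pow_pos _
  obtain ⟨s', σ', n, he, hn, hR, -, hQ⟩ := Cmd.exec_of_wp
    (B := 2 ^ ((7 + 2 * ν + 88 * e) * progCmd.deg)) (Z := 2 ^ (22 * e)) (R := I.r)
    (Q := fun σ => (RootedImmersible I.H I.rootH I.T I.rootT → σ.reg 0 = 1) ∧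
      (¬ RootedImmersible I.H I.rootH I.T I.rootT → σ.reg 0 = 0)) (by omega : 100 ≤ 2 ^ _) progCmd progCmd_wf
    (by rw [pow_mul]) (RamState.init I.encode) (RamState.init I.encode) ⟨fun _ _ => rfl, rfl⟩ hbdd
    (by
      -- For `k = 0` the bounds `Bnd` may fail, but the program stops after reading `k`.
      rcases Nat.eq_zero_or_pos I.k with hk | hk
      · refine wp_set_seq I.k I.encode_head.1 hkl.1 ⟨fun h => absurd hk (by simpa using h), fun _ =>
          wp_set (Z := 2 ^ (22 * e)) (R := I.r) 1 rfl (by omega) ⟨fun _ => by simp, fun h => ?_⟩⟩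
        exact absurd (rootedImmersible_of_k_eq_zero hk) h
      · obtain ⟨h1, h2, h3, h4⟩ := le_ceil_dpExponent (l := I.l) hp (maxBag_le hV hw) hk
        exact wp_progCmd hV hk (bnd hV hk h1 h2 h3 h4 hν.le) le_rfl)
  rw [← hR.reg 0 (by omega)] at hQ
  exact ⟨s', n, he, hn, hQ⟩

end RootedInput

/-- Bound `2 ^ (22 * e) + 1` by `2 ^ (22 * e + 1)` and use `e < E + 1`: the `d`-th power costs at
most `22 * d * E + 23 * d` in the exponent, and the second summand goes into the constant factor. -/
theorem steps_le {w d e r steps C : ℕ} {E : ℝ} (hE : 0 ≤ E) (hceil : (e : ℝ) < E + 1)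
    (hC2 : (22 * d : ℝ) ≤ C) (hC3 : (4 * (w * 2 ^ (23 * d)) : ℝ) ≤ C)
    (hst : steps ≤ w * ((r + 1) * (2 ^ (22 * e) + 1) ^ d)) (m : ℝ) (hm : (r + 1 : ℝ) ≤ 4 * m) :
    (steps : ℝ) ≤ C * (2 : ℝ) ^ (C * E) * m := by
  have hsteps : (steps : ℝ) ≤ w * 2 ^ (23 * d) * (2 : ℝ) ^ (C * E) * (r + 1) := by
    have h1 : steps ≤ w * ((r + 1) * 2 ^ ((22 * e + 1) * d)) := by
      refine hst.trans (Nat.mul_le_mul_left _ ?_)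
      rw [pow_mul 2 (22 * e + 1) d]
      refine Nat.mul_le_mul_left _ (Nat.pow_le_pow_left ?_ _)
      have := Nat.one_le_two_pow (n := 22 * e)
      rw [pow_succ]
      omega
    have h2 : (2 : ℝ) ^ ((22 * e + 1) * d) ≤ 2 ^ (23 * d) * (2 : ℝ) ^ (C * E) := by
      rw [← Real.rpow_natCast, ← Real.rpow_natCast, ← Real.rpow_add two_pos]
      refine Real.rpow_le_rpow_of_exponent_le one_le_two ?_
      push_cast
      have h3 : (22 * d : ℝ) * E ≤ C * E := mul_le_mul_of_nonneg_right hC2 hE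
      have h4 : (d : ℝ) * e ≤ d * (E + 1) := mul_le_mul_of_nonneg_left hceil.le (Nat.cast_nonneg d)
      nlinarith
    have h3 : (steps : ℝ) ≤ w * ((r + 1) * 2 ^ ((22 * e + 1) * d)) := by exact_mod_cast h1
    calc (steps : ℝ) ≤ w * ((r + 1) * 2 ^ ((22 * e + 1) * d)) := h3
      _ ≤ w * ((r + 1) * (2 ^ (23 * d) * (2 : ℝ) ^ (C * E))) := by gcongr
      _ = _ := by ring
  have hm0 : 0 ≤ m := by
    have : (0 : ℝ) ≤ r := Nat.cast_nonneg _
    linarith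
  calc (steps : ℝ) ≤ w * 2 ^ (23 * d) * (2 : ℝ) ^ (C * E) * (4 * m) :=
        hsteps.trans (by gcongr)
    _ = 4 * (w * 2 ^ (23 * d)) * (2 : ℝ) ^ (C * E) * m := by ring
    _ ≤ _ := by gcongr

theorem mainTheorem7 :
    ∃ (prog : RamProg) (C : ℕ), ∀ (I : RootedInput) (p : ℕ),
      I.Valid → 2 ≤ p → decompWidth I.bag ≤ p →
      ∃ (wordLength steps : ℕ) (final : RamState),
        RamExec (2 ^ wordLength) prog (RamState.init I.encode) final steps ∧
        (RootedImmersible I.H I.rootH I.T I.rootT → final.reg 0 = 1) ∧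
        (¬ RootedImmersible I.H I.rootH I.T I.rootT → final.reg 0 = 0) ∧
        (wordLength : ℝ) ≤ C * (1 + dpExponent I.k I.l p + Real.logb 2 (I.n + I.r)) ∧
        (steps : ℝ) ≤ C * (2 : ℝ) ^ (C * dpExponent I.k I.l p) * (I.n + I.r) ∧
        ((∀ i j : Fin I.r, (i : ℕ) + 1 = j → I.bag i ≠ I.bag j) →
          (steps : ℝ) ≤ C * (2 : ℝ) ^ (C * dpExponent I.k I.l p) * I.n) := by
  obtain ⟨d, hd⟩ : ∃ d, progCmd.depth false = d := ⟨_, rfl⟩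
  obtain ⟨w, hw⟩ : ∃ w, progCmd.weight = w := ⟨_, rfl⟩
  obtain ⟨D, hD⟩ : ∃ D, progCmd.deg = D := ⟨_, rfl⟩
  -- The first two summands are the requirements of `steps_le`. The third comes from the word
  -- length, where rounding up the logarithm and the exponent gives `7 + 2 + 88 = 97`.
  refine ⟨progCmd.comp, 4 * (w * 2 ^ (23 * d)) + 22 * d + 97 * D, fun I p hV hp hwidth => ?_⟩
  set C := 4 * (w * 2 ^ (23 * d)) + 22 * d + 97 * D with hC
  have hn := hV.n_pos
  obtain ⟨final, steps, hex, hst, hQ⟩ := RootedInput.exists_exec hV hp hwidth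
    (Nat.lt_pow_succ_log_self one_lt_two (I.n + I.r))
  rw [hD] at hex
  have hst := hst.trans (Cmd.cst_le _ _ _)
  rw [progCmd_depth, pow_one, hw, hd] at hst
  have hE := dpExponent_nonneg I.k I.l hp
  have hceil := Nat.ceil_lt_add_one hE
  set E := dpExponent I.k I.l p
  set e := ⌈E⌉₊
  have hC1 : (97 * D : ℝ) ≤ C := by exact_mod_cast (by omega : 97 * D ≤ C)
  have hC2 : (22 * d : ℝ) ≤ C := by exact_mod_cast (by omega : 22 * d ≤ C)
  have hC3 : (4 * (w * 2 ^ (23 * d)) : ℝ) ≤ C := by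
    exact_mod_cast (by omega : 4 * (w * 2 ^ (23 * d)) ≤ C)
  have hfin := steps_le hE hceil hC2 hC3 hst
  have hn' : (1 : ℝ) ≤ I.n := by exact_mod_cast hn
  have hr' : (0 : ℝ) ≤ I.r := Nat.cast_nonneg _
  -- The factor `4` in `steps_le` covers both estimates: `r + 1 ≤ 4 * (n + r)` always, and `r + 1 ≤
  -- 2 * n + 2 ≤ 4 * n` if consecutive bags differ.
  refine ⟨_, steps, final, hex, hQ.1, hQ.2, ?_, hfin _ (by linarith), fun hne => hfin _ ?_⟩
  · have h1 : (Nat.log 2 (I.n + I.r) : ℝ) ≤ Real.logb 2 (I.n + I.r) := by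
      have := Real.natLog_le_logb (I.n + I.r) 2
      push_cast at this
      exact this
    have h2 : (0 : ℝ) ≤ Nat.log 2 (I.n + I.r) := Nat.cast_nonneg _
    calc (((7 + 2 * (Nat.log 2 (I.n + I.r)).succ + 88 * e) * D : ℕ) : ℝ)
        = (7 + 2 * (Nat.log 2 (I.n + I.r) + 1) + 88 * e) * D := by push_cast; ring
      _ ≤ (97 * (1 + E + Real.logb 2 (I.n + I.r))) * D := by
          refine mul_le_mul_of_nonneg_right ?_ (Nat.cast_nonneg _)
          linarith
      _ = (97 * D) * (1 + E + Real.logb 2 (I.n + I.r)) := by ring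
      _ ≤ _ := mul_le_mul_of_nonneg_right hC1 (by linarith)
  · have := RootedInput.r_le hV hne
    have h1 : (I.r : ℝ) ≤ 2 * I.n + 1 := by exact_mod_cast this
    linarith
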